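/- Matroids and graphs are finite; graphs may have loops and parallel edges. For a graph $G$ and $X\subseteq E(G)$, let $G[X]$ be the subgraph with edge set $X$ whose vertices are the ends of edges in $X$. A theta is the union of three internally disjoint paths joining the same two distinct vertices. A \emph{biased graph} $(G,\mathcal B)$ is a graph $G$ with a set $\mathcal B$ of cycles of $G$ (identified with their edge sets) such that no theta of $G$ contains exactly two cycles of $\mathcal B$; a cycle is \emph{balanced} if it is in $\mathcal B$ and \emph{unbalanced} otherwise. The frame matroid $F(G,\mathcal B)$ is the matroid on $E(G)$ whose circuits are the edge sets of balanced cycles, thetas with no balanced cycle, tight handcuffs (two edge-disjoint unbalanced cycles meeting in exactly one vertex) and loose handcuffs (two vertex-disjoint unbalanced cycles together with a minimal path joining them). The lift matroid $L(G,\mathcal B)$ has the same circuits, except that the loose handcuffs are replaced by the unions of two vertex-disjoint unbalanced cycles. Write $\mathcal I(N)$ for the collection of independent sets of a matroid $N$. A matroid $M$ is \emph{quasi-graphic} if there is a graph $G$ such that: (1) $E(G)=E(M)$; (2) $r_M(E(H))\le |V(H)|$ for each component $H$ of $G$; (3) for each vertex $v$ of $G$, $\mathrm{cl}_M(E(G-v))$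 is contained in the union of $E(G-v)$ and the set of loops of $G$ at $v$; (4) $G[C]$ has at most two components for each circuit $C$ of $M$. A matroid $M$ is \emph{biased graphic} if there is a graph $G$ such that: (1) $E(G)=E(M)$; (2) with $\mathcal B$ the set of cycles of $G$ that are circuits of $M$, $\mathcal I(L(G,\mathcal B))\subseteq\mathcal I(M)\subseteq\mathcal I(F(G,\mathcal B))$; (3) every component of $M$ is contained in the edge set of a component of $G$. A matroid $M$ is a \emph{broken handcuff matroid} if there are a biased graph $(G,\mathcal B)$ and a family $((G_v,\mathcal B_v):v\in V(G))$ of biased graphs, with edge sets pairwise disjoint and disjoint from $E(G)$, such that $E(M)=E(G)\cup\bigcup_{v}E(G_v)$ and the circuits of $M$ are exactly the sets of the following types: (1) circuits of $F(G,\mathcal B)$; (2) circuits of $L(G_v,\mathcal B_v)$ for some $v$; (3) unions of an unbalanced cycle $C$ of $G$, an unbalanced cycle $C'$ of some $G_v$, and a path of $G$ that starts at $v$ and meets $C$ exactly in its last vertex (a trivial path if $v\in V(C)$); (4) unions of an unbalanced cycle of $G_v$, an unbalanced cycle of $G_w$, and a path of $G$ from $v$ to $w$, for some distinct $v,w\in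 V(G)$. Theorem. Let $M$ be a connected biased graphic matroid. Then $M$ is either quasi-graphic or a broken handcuff matroid. -/

import Mathlib

/- Graphs are Mathlib's multigraphs `Graph V α` (vertices in `V`, edges in `α`, loops and parallel
edges allowed), so that the edge set `E(G)` can literally be the ground set of a `Matroid α`. -/

namespace Graph

variable {V W α : Type*}

/-! ### Components, paths, cycles, thetas -/

/-- The set of vertices incident with an edge of `X`. -/
def vertsOf (G : Graph V α) (X : Set α) : Set V :=
  {x | ∃ e ∈ X, G.Inc e x}

/-- The subgraph `G[X]` induced by a set `X` of edges: the edges are those in `X`, the vertices are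
those incident with an edge in `X`. -/
def edgeInduce (G : Graph V α) (X : Set α) : Graph V α :=
  (G.restrict X).induce (G.vertsOf X)

/-- The set of connected components of `G`, as subgraphs. -/
def components (G : Graph V α) : Set (Graph V α) :=
  {H | ∃ x ∈ V(G), H = G.induce {y | Relation.ReflTransGen G.Adj x y}}

/-- `G.IsPath x y X P`: there is a path of `G` from `x` to `y` with vertex set `X` and edge
set `P`. Paths have no repeated vertices; the path from `x` to `x` with no edges is allowed. -/
inductive IsPath (G : Graph V α) : V → V → Set V → Set α → Prop
  | nil (x : V) (hx : x ∈ V(G)) : IsPath G x x {x} ∅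
  | cons (x y z : V) (e : α) (X : Set V) (P : Set α) (he : G.IsLink e x y)
      (hP : IsPath G y z X P) (hx : x ∉ X) : IsPath G x z (insert x X) (insert e P)

/-- `C` is the edge set of a cycle of `G`: a path together with a further edge that links its two
ends. A trivial path gives a loop, a path with one edge gives a pair of parallel edges. -/
def IsCycle (G : Graph V α) (C : Set α) : Prop :=
  ∃ x y X P e, G.IsPath x y X P ∧ e ∉ P ∧ G.IsLink e y x ∧ C = insert e P

/-- `P₁`, `P₂`, `P₃` are the edge sets of three internally disjoint (and distinct) paths joining the
same pair of distinct vertices. Their union is a theta, whose cycles are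
`P₁ ∪ P₂`, `P₁ ∪ P₃`, `P₂ ∪ P₃`. -/
def IsTheta (G : Graph V α) (P₁ P₂ P₃ : Set α) : Prop :=
  ∃ u v X₁ X₂ X₃, u ≠ v ∧
    G.IsPath u v X₁ P₁ ∧ G.IsPath u v X₂ P₂ ∧ G.IsPath u v X₃ P₃ ∧
    X₁ ∩ X₂ = {u, v} ∧ X₁ ∩ X₃ = {u, v} ∧ X₂ ∩ X₃ = {u, v} ∧
    Disjoint P₁ P₂ ∧ Disjoint P₁ P₃ ∧ Disjoint P₂ P₃

/-! ### Biased graphs, and the circuits of the frame matroid and the lift matroid -/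

/-- `(G, B)` is a biased graph: `B` is a collection of cycles (the balanced ones) such that no theta
contains exactly two of them. -/
structure IsBiased (G : Graph V α) (B : Set (Set α)) : Prop where
  isCycle : ∀ C ∈ B, G.IsCycle C
  theta : ∀ P₁ P₂ P₃, G.IsTheta P₁ P₂ P₃ → P₁ ∪ P₂ ∈ B → P₁ ∪ P₃ ∈ B → P₂ ∪ P₃ ∈ B

/-- A cycle that is not balanced. -/
def IsUnbalanced (G : Graph V α) (B : Set (Set α)) (C : Set α) : Prop :=
  G.IsCycle C ∧ C ∉ B

/-- A theta none of whose three cycles is balanced. -/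
def IsUnbalancedTheta (G : Graph V α) (B : Set (Set α)) (X : Set α) : Prop :=
  ∃ P₁ P₂ P₃, G.IsTheta P₁ P₂ P₃ ∧ P₁ ∪ P₂ ∉ B ∧ P₁ ∪ P₃ ∉ B ∧ P₂ ∪ P₃ ∉ B ∧
    X = P₁ ∪ P₂ ∪ P₃

/-- Two edge-disjoint unbalanced cycles meeting in exactly one vertex. -/
def IsTightHandcuff (G : Graph V α) (B : Set (Set α)) (X : Set α) : Prop :=
  ∃ C₁ C₂, G.IsUnbalanced B C₁ ∧ G.IsUnbalanced B C₂ ∧ Disjoint C₁ C₂ ∧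
    (∃ v, G.vertsOf C₁ ∩ G.vertsOf C₂ = {v}) ∧ X = C₁ ∪ C₂

/-- Two vertex-disjoint unbalanced cycles together with a minimal path joining them. -/
def IsLooseHandcuff (G : Graph V α) (B : Set (Set α)) (X : Set α) : Prop :=
  ∃ C₁ C₂ x y Z P, G.IsUnbalanced B C₁ ∧ G.IsUnbalanced B C₂ ∧
    Disjoint (G.vertsOf C₁) (G.vertsOf C₂) ∧ G.IsPath x y Z P ∧
    Z ∩ G.vertsOf C₁ = {x} ∧ Z ∩ G.vertsOf C₂ = {y} ∧ X = C₁ ∪ C₂ ∪ P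

/-- Two vertex-disjoint unbalanced cycles. -/
def IsBracelet (G : Graph V α) (B : Set (Set α)) (X : Set α) : Prop :=
  ∃ C₁ C₂, G.IsUnbalanced B C₁ ∧ G.IsUnbalanced B C₂ ∧
    Disjoint (G.vertsOf C₁) (G.vertsOf C₂) ∧ X = C₁ ∪ C₂

/-- `X` is a circuit of the frame matroid `F(G, B)`. -/
def IsFrameCircuit (G : Graph V α) (B : Set (Set α)) (X : Set α) : Prop :=
  X ∈ B ∨ G.IsUnbalancedTheta B X ∨ G.IsTightHandcuff B X ∨ G.IsLooseHandcuff B X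

/-- `X` is a circuit of the lift matroid `L(G, B)`. -/
def IsLiftCircuit (G : Graph V α) (B : Set (Set α)) (X : Set α) : Prop :=
  X ∈ B ∨ G.IsUnbalancedTheta B X ∨ G.IsTightHandcuff B X ∨ G.IsBracelet B X

/-- `I` is an independent set of the frame matroid `F(G, B)`. -/
def IsFrameIndep (G : Graph V α) (B : Set (Set α)) (I : Set α) : Prop :=
  I ⊆ E(G) ∧ ∀ X, G.IsFrameCircuit B X → ¬ X ⊆ I

/-- `I` is an independent set of the lift matroid `L(G, B)`. -/
def IsLiftIndep (G : Graph V α) (B : Set (Set α)) (I : Set α) : Prop :=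
  I ⊆ E(G) ∧ ∀ X, G.IsLiftCircuit B X → ¬ X ⊆ I

/-- A broken handcuff at one vertex `v` of `G`: the union of an unbalanced cycle `C` of `G`, an
unbalanced cycle `C'` of `Gv v`, and a `v`-`C`-path of `G`, that is, a path that starts at `v` and
meets `C` exactly in its last vertex (a trivial path if `v` lies on `C`). -/
def IsBrokenHandcuffOne (G : Graph V α) (B : Set (Set α)) (Gv : V → Graph W α)
    (Bv : V → Set (Set α)) (X : Set α) : Prop :=
  ∃ v ∈ V(G), ∃ C C' y Z P, G.IsUnbalanced B C ∧ (Gv v).IsUnbalanced (Bv v) C' ∧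
    G.IsPath v y Z P ∧ Z ∩ G.vertsOf C = {y} ∧ X = C ∪ C' ∪ P

/-- A broken handcuff at two vertices `v ≠ w` of `G`: the union of an unbalanced cycle of `Gv v`, an
unbalanced cycle of `Gv w`, and a `v`-`w`-path of `G`. -/
def IsBrokenHandcuffTwo (G : Graph V α) (Gv : V → Graph W α) (Bv : V → Set (Set α))
    (X : Set α) : Prop :=
  ∃ v ∈ V(G), ∃ w ∈ V(G), v ≠ w ∧ ∃ C C' Z P, (Gv v).IsUnbalanced (Bv v) C ∧
    (Gv w).IsUnbalanced (Bv w) C' ∧ G.IsPath v w Z P ∧ X = C ∪ C' ∪ P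

end Graph

namespace Matroid

variable {α : Type*}

open scoped Graph

/-! ### Connectivity of matroids -/

/-- The components of a matroid: the classes of the relation "equal, or contained in a common
circuit" on the ground set. -/
def components (M : Matroid α) : Set (Set α) :=
  {K | ∃ e ∈ M.E, K = {f ∈ M.E | f = e ∨ ∃ C, M.IsCircuit C ∧ e ∈ C ∧ f ∈ C}}

/-- A matroid is connected if any two distinct elements lie in a common circuit. -/
def IsConnected (M : Matroid α) : Prop :=
  ∀ e ∈ M.E, ∀ f ∈ M.E, e ≠ f → ∃ C, M.IsCircuit C ∧ e ∈ C ∧ f ∈ C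

/-! ### Quasi-graphic matroids -/

/-- `G` is a framework for the matroid `M`. -/
structure IsFramework {V : Type*} (M : Matroid α) (G : Graph V α) : Prop where
  finite_vertexSet : V(G).Finite
  edgeSet_eq : E(G) = M.E
  eRk_le : ∀ H ∈ G.components, M.eRk E(H) ≤ V(H).encard
  closure_subset : ∀ v ∈ V(G),
    M.closure E(G.deleteVerts {v}) ⊆ E(G.deleteVerts {v}) ∪ G.loopSet v
  circuit_components : ∀ C, M.IsCircuit C → (G.edgeInduce C).components.encard ≤ 2

/-- A matroid is quasi-graphic if it has a framework. -/
def IsQuasiGraphic (M : Matroid α) : Prop :=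
  ∃ (V : Type) (G : Graph V α), M.IsFramework G

/-! ### Biased graphic matroids -/

/-- The cycles of `G` that are circuits of `M`. -/
def balancedCycles {V : Type*} (M : Matroid α) (G : Graph V α) : Set (Set α) :=
  {C | M.IsCircuit C ∧ G.IsCycle C}

/-- `M` is biased graphic with graph `G`: with `B` the set of cycles of `G` that are circuits
of `M`, every independent set of `L(G, B)` is independent in `M`, every independent set of `M` is
independent in `F(G, B)`, and every component of `M` is contained in a component of `G`. -/
structure IsBiasedGraphicWith {V : Type*} (M : Matroid α) (G : Graph V α) : Prop where
  finite_vertexSet : V(G).Finite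
  edgeSet_eq : E(G) = M.E
  indep_of_lift : ∀ I, G.IsLiftIndep (M.balancedCycles G) I → M.Indep I
  frame_of_indep : ∀ I, M.Indep I → G.IsFrameIndep (M.balancedCycles G) I
  component_subset : ∀ K ∈ M.components, ∃ H ∈ G.components, K ⊆ E(H)

/-- A matroid is biased graphic if it is biased graphic with some graph. -/
def IsBiasedGraphic (M : Matroid α) : Prop :=
  ∃ (V : Type) (G : Graph V α), M.IsBiasedGraphicWith G

/-! ### Broken handcuff matroids -/

/-- `M` is the broken handcuff matroid given by the biased graph `(G, B)` and the family of biased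
graphs `(Gv v, Bv v)`, `v ∈ V(G)`, whose edge sets are pairwise disjoint and disjoint from `E(G)`. -/
structure IsBrokenHandcuffWith {V W : Type*} (M : Matroid α) (G : Graph V α) (B : Set (Set α))
    (Gv : V → Graph W α) (Bv : V → Set (Set α)) : Prop where
  finite_vertexSet : V(G).Finite
  finite_vertexSet_v : ∀ v ∈ V(G), V(Gv v).Finite
  isBiased : G.IsBiased B
  isBiased_v : ∀ v ∈ V(G), (Gv v).IsBiased (Bv v)
  disjoint : ∀ v ∈ V(G), Disjoint E(G) E(Gv v)
  pairwise_disjoint : ∀ v ∈ V(G), ∀ w ∈ V(G), v ≠ w → Disjoint E(Gv v) E(Gv w)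
  ground_eq : M.E = E(G) ∪ ⋃ v ∈ V(G), E(Gv v)
  isCircuit_iff : ∀ X, M.IsCircuit X ↔
    G.IsFrameCircuit B X ∨ (∃ v ∈ V(G), (Gv v).IsLiftCircuit (Bv v) X) ∨
      G.IsBrokenHandcuffOne B Gv Bv X ∨ G.IsBrokenHandcuffTwo Gv Bv X

/-- A matroid is a broken handcuff matroid if it is given by some biased graph and some family of
biased graphs indexed by its vertices. -/
def IsBrokenHandcuff (M : Matroid α) : Prop :=
  ∃ (V W : Type) (G : Graph V α) (B : Set (Set α)) (Gv : V → Graph W α) (Bv : V → Set (Set α)),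
    M.IsBrokenHandcuffWith G B Gv Bv

end Matroid

/-! Fix a graph `G` for `M` and its balanced cycles. Two counts control the rank. A set of edges
without frame circuits has at most as many edges as vertices (`ncard_le_of_frameFree`). A connected
vertex set `S` that carries an unbalanced cycle has a spanning unicyclic subgraph, which is
independent in the lift matroid. So the edges inside such an `S` have rank exactly `|S|`
(`natRk_inside`). Unbalanced thetas and tight handcuffs are circuits of `M`, and every circuit that
is neither of these nor a balanced cycle lies in a loose handcuff `C₁ ∪ C₂ ∪ P` (`isCircuit_cases`)
and contains both cycles. The only open question is which edges of `P` it contains.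

If no cycle is unbalanced, every circuit is a cycle and `G` is a framework. Suppose there is an
unbalanced cycle but no joint, that is, no vertex `z` separates an edge (possibly a loop at `z`)
from another vertex. Then deleting a vertex keeps the rest connected, so for rank reasons no circuit
has a pendant edge. A circuit in a loose handcuff therefore contains all of `P` or none of it, and
`G` is again a framework (`isFramework_of_no_joint`).

Suppose there is a joint. Removing an edge `e` of `P` cuts the handcuff into two connected
unbalanced pieces with vertex sets `S` and `T`, and `e` lies in the circuit exactly when the insides
of `S` and `T` are skew. By submodularity this does not change when `S` and `T` grow, as long as an
edge joins the smaller sets (`sep_mono`). Growing and shrinking the two sets transfers the question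
to the two sides of a joint in the block of `e` (`sep_iff_of_insep`), so the answer depends on `e`
alone (`sep_iff_isLiftEdge`). The edges with the answer "not skew" form a set `L` that is closed
under cycles, and the circuits in loose handcuffs are the sets `C₁ ∪ C₂ ∪ P \ L` (`isCircuit_iff`).
Contracting the components of `L` gives the frame part of a broken handcuff matroid, and the
components themselves are its lift parts (`isBrokenHandcuff_of_isBlockContraction`). -/

open Set
open scoped Graph

namespace Graph

variable {V α : Type*} {G : Graph V α} {x y z u v w a b : V} {e f : α} {S T U X Y Z : Set V}
  {P Q C I J : Set α}

/-! ### Edges inside a set of vertices, ends of sets of edges -/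

/-- The set of edges with both ends in `S`. -/
def inside (G : Graph V α) (S : Set V) : Set α :=
  {e | ∃ x ∈ S, ∃ y ∈ S, G.IsLink e x y}

theorem inside_mono (h : S ⊆ T) : G.inside S ⊆ G.inside T :=
  fun _ ⟨x, hx, y, hy, hl⟩ => ⟨x, h hx, y, h hy, hl⟩

theorem inside_subset_edgeSet : G.inside S ⊆ E(G) := fun _ ⟨_, _, _, _, hl⟩ => hl.edge_mem

theorem mem_of_mem_inside (h : e ∈ G.inside S) (hx : G.Inc e x) : x ∈ S := by
  obtain ⟨a, ha, b, hb, hl⟩ := h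
  obtain rfl | rfl := hx.eq_or_eq_of_isLink hl <;> assumption

theorem IsLink.mem_inside (h : G.IsLink e x y) (hx : x ∈ S) (hy : y ∈ S) : e ∈ G.inside S :=
  ⟨x, hx, y, hy, h⟩

theorem vertsOf_mono (h : P ⊆ Q) : G.vertsOf P ⊆ G.vertsOf Q :=
  fun _ ⟨e, he, hi⟩ => ⟨e, h he, hi⟩

theorem vertsOf_union : G.vertsOf (P ∪ Q) = G.vertsOf P ∪ G.vertsOf Q := by
  ext x
  constructor
  · rintro ⟨e, he | he, hi⟩
    exacts [Or.inl ⟨e, he, hi⟩, Or.inr ⟨e, he, hi⟩]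
  · rintro (⟨e, he, hi⟩ | ⟨e, he, hi⟩)
    exacts [⟨e, Or.inl he, hi⟩, ⟨e, Or.inr he, hi⟩]

theorem vertsOf_subset_vertexSet : G.vertsOf P ⊆ V(G) := fun _ ⟨_, _, hi⟩ => hi.vertex_mem

theorem vertsOf_subset_of_subset_inside (h : P ⊆ G.inside S) : G.vertsOf P ⊆ S :=
  fun _ ⟨_, he, hi⟩ => mem_of_mem_inside (h he) hi

theorem subset_inside_vertsOf (h : P ⊆ E(G)) : P ⊆ G.inside (G.vertsOf P) := by
  intro e he
  obtain ⟨x, y, hl⟩ := exists_isLink_of_mem_edgeSet (h he)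
  exact hl.mem_inside ⟨e, he, hl.inc_left⟩ ⟨e, he, hl.inc_right⟩

theorem IsLink.left_mem_vertsOf (h : G.IsLink e x y) (he : e ∈ P) : x ∈ G.vertsOf P :=
  ⟨e, he, h.inc_left⟩

theorem IsLink.right_mem_vertsOf (h : G.IsLink e x y) (he : e ∈ P) : y ∈ G.vertsOf P :=
  ⟨e, he, h.inc_right⟩

/-! ### Paths -/

theorem IsPath.left_mem (h : G.IsPath x y Z P) : x ∈ Z := by
  cases h <;> simp

theorem IsPath.right_mem (h : G.IsPath x y Z P) : y ∈ Z := by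
  induction h with
  | nil => simp
  | cons _ _ _ _ _ _ _ _ _ ih => exact Or.inr ih

theorem IsPath.subset_vertexSet (h : G.IsPath x y Z P) : Z ⊆ V(G) := by
  induction h with
  | nil x hx => simpa using hx
  | cons x y z e X P he hP hx ih => exact insert_subset he.left_mem ih

theorem IsPath.subset_inside (h : G.IsPath x y Z P) : P ⊆ G.inside Z := by
  induction h with
  | nil x hx => simp
  | cons x y z e X P he hP hx ih =>
    exact insert_subset (he.mem_inside (mem_insert _ _) (Or.inr hP.left_mem))
      (ih.trans (inside_mono (subset_insert _ _)))

theorem IsPath.subset_edgeSet (h : G.IsPath x y Z P) : P ⊆ E(G) :=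
  h.subset_inside.trans inside_subset_edgeSet

theorem IsPath.vertsOf_subset (h : G.IsPath x y Z P) : G.vertsOf P ⊆ Z :=
  vertsOf_subset_of_subset_inside h.subset_inside

theorem IsPath.finite (h : G.IsPath x y Z P) : Z.Finite ∧ P.Finite := by
  induction h with
  | nil => simp
  | cons _ _ _ _ _ _ _ _ _ ih => exact ⟨ih.1.insert _, ih.2.insert _⟩

theorem notMem_of_inc_notMem (h : P ⊆ G.inside Z) (hi : G.Inc e x) (hx : x ∉ Z) : e ∉ P :=
  fun he => hx (mem_of_mem_inside (h he) hi)

theorem IsPath.ncard (h : G.IsPath x y Z P) : Z.ncard = P.ncard + 1 := by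
  induction h with
  | nil => simp
  | cons x y z e X P he hP hx ih =>
    rw [ncard_insert_of_notMem hx hP.finite.1, ih,
      ncard_insert_of_notMem (notMem_of_inc_notMem hP.subset_inside he.inc_left hx) hP.finite.2]

theorem IsPath.eq_nil (h : G.IsPath x x Z P) : Z = {x} ∧ P = ∅ := by
  cases h with
  | nil => simp
  | cons _ _ _ _ _ _ _ hP hx => exact absurd hP.right_mem hx

theorem IsPath.nonempty_of_ne (h : G.IsPath x y Z P) (hxy : x ≠ y) : P.Nonempty := by
  cases h with
  | nil => exact absurd rfl hxy
  | cons _ _ _ e _ _ _ _ _ => exact insert_nonempty _ _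

theorem IsPath.vertsOf_eq (h : G.IsPath x y Z P) (hne : P.Nonempty) : G.vertsOf P = Z := by
  induction h with
  | nil => simp at hne
  | cons x y z e X P he hP hx ih =>
    refine Subset.antisymm (hP.cons _ _ _ _ _ _ he hx).vertsOf_subset ?_
    refine insert_subset (he.left_mem_vertsOf (mem_insert _ _)) ?_
    rcases P.eq_empty_or_nonempty with rfl | hne'
    · obtain rfl : y = z := by
        by_contra hyz
        exact (hP.nonempty_of_ne hyz).ne_empty rfl
      rw [hP.eq_nil.1]
      exact singleton_subset_iff.2 (he.right_mem_vertsOf (mem_insert e _))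
    · rw [← ih hne']
      exact vertsOf_mono (subset_insert _ _)

theorem IsPath.append (h : G.IsPath x y Y P) (h' : G.IsPath y z Z Q) (hd : Y ∩ Z ⊆ {y}) :
    G.IsPath x z (Y ∪ Z) (P ∪ Q) := by
  induction h with
  | nil x hx =>
    rwa [empty_union, singleton_union, insert_eq_of_mem h'.left_mem]
  | cons x y w e X P he hP hx ih =>
    rw [insert_union, insert_union]
    refine (ih h' ((inter_subset_inter_left _ (subset_insert _ _)).trans hd)).cons _ _ _ _ _ _ he ?_
    rintro (h1 | h1)
    · exact hx h1
    · have : x = w := hd ⟨mem_insert _ _, h1⟩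
      exact hx (this ▸ hP.right_mem)

theorem IsLink.isPath (h : G.IsLink e x y) (hxy : x ≠ y) : G.IsPath x y {x, y} {e} := by
  have := (IsPath.nil (G := G) y h.right_mem).cons _ _ _ _ _ _ h (by simpa using hxy)
  rwa [insert_empty_eq] at this

theorem IsPath.reverse (h : G.IsPath x y Z P) : G.IsPath y x Z P := by
  induction h with
  | nil x hx => exact .nil x hx
  | cons x y z e X P he hP hx ih =>
    have hxy : y ≠ x := fun h => hx (h ▸ hP.left_mem)
    have := ih.append (he.symm.isPath hxy) (by
      rintro t ⟨ht, rfl | rfl⟩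
      · rfl
      · exact absurd ht hx)
    rw [union_singleton] at this
    convert this using 1
    ext t
    have := hP.left_mem
    simp only [mem_insert_iff, mem_union, mem_singleton_iff]
    constructor
    · rintro (h | h) <;> simp [h]
    · rintro (h | rfl | h) <;> simp [*]

/-- A path can be split at any of its vertices. -/
theorem IsPath.split (h : G.IsPath x y Z P) (ha : a ∈ Z) :
    ∃ Z₁ P₁ Z₂ P₂, G.IsPath x a Z₁ P₁ ∧ G.IsPath a y Z₂ P₂ ∧ Z₁ ∩ Z₂ = {a} ∧ Z = Z₁ ∪ Z₂ ∧
      P = P₁ ∪ P₂ ∧ Disjoint P₁ P₂ := by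
  induction h with
  | nil x hx =>
    obtain rfl : a = x := ha
    exact ⟨{a}, ∅, {a}, ∅, .nil _ hx, .nil _ hx, by simp, by simp, by simp, by simp⟩
  | cons x y z e X P he hP hx ih =>
    by_cases hax : a = x
    · subst hax
      refine ⟨{a}, ∅, _, _, .nil _ he.left_mem, hP.cons _ _ _ _ _ _ he hx, by simp, by simp,
        by simp, by simp⟩
    · obtain ⟨Z₁, P₁, Z₂, P₂, h1, h2, h3, rfl, rfl, h6⟩ := ih (ha.resolve_left hax)
      rw [mem_union, not_or] at hx
      refine ⟨_, _, Z₂, P₂, h1.cons _ _ _ _ _ _ he hx.1, h2, ?_, by rw [insert_union],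
        by rw [insert_union], ?_⟩
      · rw [insert_inter_of_notMem hx.2, h3]
      · rw [disjoint_insert_left]
        exact ⟨notMem_of_inc_notMem h2.subset_inside he.inc_left hx.2, h6⟩

/-- A path can be split at any of its edges. -/
theorem IsPath.splitEdge (h : G.IsPath x y Z P) (hf : f ∈ P) :
    ∃ s t Z₁ P₁ Z₂ P₂, G.IsPath x s Z₁ P₁ ∧ G.IsLink f s t ∧ G.IsPath t y Z₂ P₂ ∧
      Disjoint Z₁ Z₂ ∧ Z = Z₁ ∪ Z₂ ∧ P = insert f (P₁ ∪ P₂) ∧ f ∉ P₁ ∧ f ∉ P₂ := by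
  induction h with
  | nil x hx => simp at hf
  | cons x y z e X P he hP hx ih =>
    by_cases hfe : f = e
    · subst hfe
      refine ⟨x, y, {x}, ∅, _, _, .nil _ he.left_mem, he, hP, by simpa using hx, by simp, by simp,
        by simp, notMem_of_inc_notMem hP.subset_inside he.inc_left hx⟩
    · obtain ⟨s, t, Z₁, P₁, Z₂, P₂, h1, h2, h3, h4, rfl, rfl, h7, h8⟩ :=
        ih (hf.resolve_left hfe)
      rw [mem_union, not_or] at hx
      refine ⟨s, t, _, _, Z₂, P₂, h1.cons _ _ _ _ _ _ he hx.1, h2, h3, ?_, by rw [insert_union],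
        by rw [insert_union, insert_comm], by simp [hfe, h7], h8⟩
      rw [disjoint_insert_left]
      exact ⟨hx.2, h4⟩

/-! ### Reachability -/

/-- `b` can be reached from `a` by edges in `X` with all ends in `U`. -/
def Reach (G : Graph V α) (X : Set α) (U : Set V) : V → V → Prop :=
  Relation.ReflTransGen fun a b => ∃ e ∈ X, G.IsLink e a b ∧ a ∈ U ∧ b ∈ U

theorem Reach.refl : G.Reach P U a a := Relation.ReflTransGen.refl

theorem IsLink.reach (h : G.IsLink e a b) (he : e ∈ P) (ha : a ∈ U) (hb : b ∈ U) :
    G.Reach P U a b := Relation.ReflTransGen.single ⟨e, he, h, ha, hb⟩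

theorem Reach.trans {c : V} (h : G.Reach P U a b) (h' : G.Reach P U b c) : G.Reach P U a c :=
  Relation.ReflTransGen.trans h h'

theorem Reach.symm (h : G.Reach P U a b) : G.Reach P U b a := by
  induction h with
  | refl => exact .refl
  | tail _ hbc ih =>
    obtain ⟨e, he, hl, hb, hc⟩ := hbc
    exact (hl.symm.reach he hc hb).trans ih

theorem Reach.mono (h : G.Reach P U a b) (hP : P ⊆ Q) (hU : U ⊆ T) : G.Reach Q T a b := by
  induction h with
  | refl => exact .refl
  | tail _ hbc ih =>
    obtain ⟨e, he, hl, h1, h2⟩ := hbc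
    exact ih.trans (hl.reach (hP he) (hU h1) (hU h2))

theorem Reach.mem (h : G.Reach P U a b) (ha : a ∈ U) : b ∈ U := by
  induction h with
  | refl => exact ha
  | tail _ hbc _ => exact hbc.choose_spec.2.2.2

/-- Reachability is witnessed by a path. -/
theorem Reach.exists_isPath (h : G.Reach P U a b) (ha : a ∈ U) (haV : a ∈ V(G)) :
    ∃ Z Q, G.IsPath a b Z Q ∧ Z ⊆ U ∧ Q ⊆ P := by
  replace h := h.symm
  induction h with
  | refl => exact ⟨{b}, ∅, .nil _ haV, by simpa using ha, by simp⟩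
  | @tail c d h1 h2 ih =>
    obtain ⟨e, he, hl, hc, hd⟩ := h2
    obtain ⟨Z, Q, hp, hZ, hQ⟩ := ih hc hl.left_mem
    by_cases hdZ : d ∈ Z
    · obtain ⟨Z₁, P₁, Z₂, P₂, -, h2, -, rfl, rfl, -⟩ := hp.split hdZ
      exact ⟨Z₂, P₂, h2, subset_union_right.trans hZ, subset_union_right.trans hQ⟩
    · exact ⟨_, _, hp.cons _ _ _ _ _ _ hl.symm hdZ, insert_subset hd hZ, insert_subset he hQ⟩

theorem IsPath.reach_left (h : G.IsPath x y Z P) (ha : a ∈ Z) : G.Reach P Z x a := by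
  induction h with
  | nil x hx => rw [mem_singleton_iff.1 ha]; exact .refl
  | cons x y z e X P he hP hx ih =>
    rcases ha with rfl | ha
    · exact .refl
    · exact (he.reach (mem_insert _ _) (mem_insert _ _) (Or.inr hP.left_mem)).trans
        ((ih ha).mono (subset_insert _ _) (subset_insert _ _))

theorem IsPath.reach (h : G.IsPath x y Z P) (ha : a ∈ Z) (hb : b ∈ Z) : G.Reach P Z a b :=
  (h.reach_left ha).symm.trans (h.reach_left hb)

/-- If a set of vertices closed under the edges of `P` inside `U` contains `a`, then it contains
everything that is reachable from `a`. -/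
theorem Reach.mem_of_closed (h : G.Reach P U a b) (ha : a ∈ S)
    (hS : ∀ e ∈ P, ∀ s t, G.IsLink e s t → s ∈ S → s ∈ U → t ∈ U → t ∈ S) : b ∈ S := by
  induction h with
  | refl => exact ha
  | tail _ hbc ih =>
    obtain ⟨e, he, hl, h1, h2⟩ := hbc
    exact hS e he _ _ hl ih h1 h2

/-- A walk from inside `S` to outside of `S` uses an edge that leaves `S`. -/
theorem Reach.exists_exit (h : G.Reach P U a b) (ha : a ∈ S) (hb : b ∉ S) :
    ∃ e ∈ P, ∃ s t, G.IsLink e s t ∧ s ∈ S ∧ t ∉ S ∧ s ∈ U ∧ t ∈ U := by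
  by_contra! hcon
  refine hb (h.mem_of_closed ha fun e he s t hl hs hsU htU => ?_)
  by_contra ht
  exact hcon e he s t hl hs ht hsU htU

/-- `S` is connected by the edges in `P` inside `S`. -/
def ConnVia (G : Graph V α) (P : Set α) (S : Set V) : Prop :=
  ∀ ⦃a⦄, a ∈ S → ∀ ⦃b⦄, b ∈ S → G.Reach P S a b

theorem ConnVia.of_reach_left (h : ∀ b ∈ S, G.Reach P S a b) : G.ConnVia P S :=
  fun _ hb _ hc => (h _ hb).symm.trans (h _ hc)

theorem ConnVia.mono (h : G.ConnVia P S) (hP : P ⊆ Q) : G.ConnVia Q S :=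
  fun _ ha _ hb => (h ha hb).mono hP Subset.rfl

theorem ConnVia.union (h : G.ConnVia P S) (h' : G.ConnVia Q T) (ha : a ∈ S) (ha' : a ∈ T) :
    G.ConnVia (P ∪ Q) (S ∪ T) := by
  refine .of_reach_left (a := a) fun b hb => ?_
  rcases hb with hb | hb
  · exact (h ha hb).mono subset_union_left subset_union_left
  · exact (h' ha' hb).mono subset_union_right subset_union_right

theorem IsPath.connVia (h : G.IsPath x y Z P) : G.ConnVia P Z := fun _ ha _ hb => h.reach ha hb

theorem ConnVia.insert_edge (h : G.ConnVia P S) (h' : G.ConnVia Q T) (he : G.IsLink e a b)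
    (ha : a ∈ S) (hb : b ∈ T) : G.ConnVia (insert e (P ∪ Q)) (S ∪ T) := by
  have hP : P ⊆ insert e (P ∪ Q) := subset_union_left.trans (subset_insert _ _)
  have hQ : Q ⊆ insert e (P ∪ Q) := subset_union_right.trans (subset_insert _ _)
  refine .of_reach_left (a := a) fun c hc => ?_
  rcases hc with hc | hc
  · exact (h ha hc).mono hP subset_union_left
  · exact (he.reach (mem_insert _ _) (Or.inl ha) (Or.inr hb)).trans
      ((h' hb hc).mono hQ subset_union_right)

end Graph

namespace Graph

variable {V α : Type*} {G : Graph V α} {x y z u v w a b : V} {e f : α} {S T U X Y Z : Set V}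
  {P Q C D I J : Set α}

/-! ### Cycles -/

/-- A cycle, as a closed path that starts at a prescribed vertex. -/
theorem IsCycle.rotate (h : G.IsCycle C) (hv : v ∈ G.vertsOf C) :
    ∃ y Z P e, G.IsPath v y Z P ∧ e ∉ P ∧ G.IsLink e y v ∧ C = insert e P ∧ Z = G.vertsOf C := by
  obtain ⟨x, y, Z, P, e, hP, heP, hl, rfl⟩ := h
  have hZ : ∀ {v y Z P e}, G.IsPath v y Z P → G.IsLink e y v → Z = G.vertsOf (insert e P) := by
    intro v y Z P e hP hl
    apply Subset.antisymm
    · rcases P.eq_empty_or_nonempty with rfl | hne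
      · obtain rfl : v = y := by
          by_contra hyz
          exact (hP.nonempty_of_ne hyz).ne_empty rfl
        rw [hP.eq_nil.1]
        exact singleton_subset_iff.2 (hl.left_mem_vertsOf (mem_insert e _))
      · rw [← hP.vertsOf_eq hne]
        exact vertsOf_mono (subset_insert _ _)
    · exact vertsOf_subset_of_subset_inside
        (insert_subset (hl.mem_inside hP.right_mem hP.left_mem) hP.subset_inside)
  rw [← hZ hP hl] at hv
  obtain ⟨Z₁, P₁, Z₂, P₂, h1, h2, h3, rfl, rfl, h6⟩ := hP.split hv
  rw [mem_union, not_or] at heP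
  by_cases hxv : x = v
  · subst hxv
    obtain ⟨rfl, rfl⟩ := h1.eq_nil
    rw [empty_union] at *
    exact ⟨y, Z₂, P₂, e, h2, heP.2, hl, rfl, hZ h2 hl⟩
  -- The last edge `g` before `v` becomes the closing edge of the new closed path, and the old
  -- closing edge `e` becomes an inner edge.
  · cases h1.reverse with
    | nil => exact absurd rfl hxv
    | cons _ u _ g Z₃ P₃ hg hP₃ hvZ =>
      have h23 : Z₂ ∩ Z₃ = ∅ := by
        rw [← disjoint_iff_inter_eq_empty, Set.disjoint_left]
        intro t ht ht'
        obtain rfl : t = v := h3.subset ⟨Or.inr ht', ht⟩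
        exact hvZ ht'
      have hxZ : x ∉ Z₂ := fun hx => by
        have : x ∈ Z₂ ∩ Z₃ := ⟨hx, hP₃.right_mem⟩
        rw [h23] at this
        exact this
      have hyZ : y ∉ Z₃ := fun hy => by
        have : y ∈ Z₂ ∩ Z₃ := ⟨h2.right_mem, hy⟩
        rw [h23] at this
        exact this
      have hp := h2.append (hP₃.reverse.cons _ _ _ _ _ _ hl hyZ) (by
        rintro t ⟨ht, rfl | ht'⟩
        · rfl
        · have : t ∈ Z₂ ∩ Z₃ := ⟨ht, ht'⟩
          rw [h23] at this
          exact this.elim)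
      have hgP₃ : g ∉ P₃ := notMem_of_inc_notMem hP₃.subset_inside hg.inc_left hvZ
      have hgP₂ : g ∉ P₂ := fun hh => h6.notMem_of_mem_right hh (mem_insert _ _)
      have hge : g ≠ e := fun hh => heP.1 (hh ▸ mem_insert _ _)
      refine ⟨u, _, _, g, hp, ?_, hg.symm, ?_, ?_⟩
      · simp [hgP₂, hgP₃, hge]
      · ext t
        simp only [mem_insert_iff, mem_union]
        tauto
      · rw [hZ hp hg.symm]
        congr 1
        ext t
        simp only [mem_insert_iff, mem_union]
        tauto

theorem IsCycle.subset_edgeSet (h : G.IsCycle C) : C ⊆ E(G) := by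
  obtain ⟨x, y, Z, P, e, hP, heP, hl, rfl⟩ := h
  exact insert_subset hl.edge_mem hP.subset_edgeSet

theorem IsCycle.finite (h : G.IsCycle C) : C.Finite := by
  obtain ⟨x, y, Z, P, e, hP, heP, hl, rfl⟩ := h
  exact hP.finite.2.insert _

theorem IsCycle.nonempty (h : G.IsCycle C) : C.Nonempty := by
  obtain ⟨x, y, Z, P, e, hP, heP, hl, rfl⟩ := h
  exact insert_nonempty _ _

theorem vertsOf_nonempty (hC : C ⊆ E(G)) (hne : C.Nonempty) : (G.vertsOf C).Nonempty := by
  obtain ⟨e, he⟩ := hne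
  obtain ⟨x, y, hl⟩ := exists_isLink_of_mem_edgeSet (hC he)
  exact ⟨x, e, he, hl.inc_left⟩

theorem IsCycle.vertsOf_nonempty (h : G.IsCycle C) : (G.vertsOf C).Nonempty :=
  Graph.vertsOf_nonempty h.subset_edgeSet h.nonempty

theorem IsCycle.subset_inside (h : G.IsCycle C) : C ⊆ G.inside (G.vertsOf C) :=
  subset_inside_vertsOf h.subset_edgeSet

theorem IsCycle.connVia (h : G.IsCycle C) : G.ConnVia C (G.vertsOf C) := by
  obtain ⟨v, hv⟩ := h.vertsOf_nonempty
  obtain ⟨y, Z, P, e, hP, heP, hl, rfl, rfl⟩ := h.rotate hv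
  exact hP.connVia.mono (subset_insert _ _)

theorem IsCycle.vertsOf_finite (h : G.IsCycle C) : (G.vertsOf C).Finite := by
  obtain ⟨v, hv⟩ := h.vertsOf_nonempty
  obtain ⟨y, Z, P, e, hP, heP, hl, rfl, rfl⟩ := h.rotate hv
  exact hP.finite.1

theorem IsCycle.ncard (h : G.IsCycle C) : (G.vertsOf C).ncard = C.ncard := by
  obtain ⟨v, hv⟩ := h.vertsOf_nonempty
  obtain ⟨y, Z, P, e, hP, heP, hl, rfl, rfl⟩ := h.rotate hv
  rw [hP.ncard, ncard_insert_of_notMem heP hP.finite.2]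

/-- No edge of a cycle is pendant. -/
theorem IsCycle.exists_ne_inc (h : G.IsCycle C) (he : e ∈ C) (hl : G.IsLink e v w) (hvw : v ≠ w) :
    ∃ f ∈ C, f ≠ e ∧ G.Inc f v := by
  obtain ⟨y, Z, P, g, hP, hgP, hg, rfl, -⟩ := h.rotate (hl.left_mem_vertsOf he)
  by_cases heg : e = g
  · subst heg
    cases hP with
    | nil => exact absurd (hl.right_unique hg) (Ne.symm hvw)
    | cons _ u _ f Z₃ P₃ hf hP₃ hvZ =>
      exact ⟨f, by simp, fun hh => hgP (hh ▸ mem_insert _ _), hf.inc_left⟩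
  · exact ⟨g, mem_insert _ _, Ne.symm heg, hg.inc_right⟩

/-- Deleting an edge from a cycle leaves two paths that start at a prescribed vertex. -/
theorem IsCycle.sdiff_singleton (h : G.IsCycle C) (hv : v ∈ G.vertsOf C) (he : e ∈ C) :
    ∃ s t Z₁ P₁ Z₂ P₂, G.IsPath v s Z₁ P₁ ∧ G.IsPath v t Z₂ P₂ ∧ Z₁ ∩ Z₂ = {v} ∧
      G.vertsOf C = Z₁ ∪ Z₂ ∧ C \ {e} = P₁ ∪ P₂ ∧ G.IsLink e s t := by
  obtain ⟨y, Z, P, g, hP, hgP, hg, rfl, hZ⟩ := h.rotate hv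
  rw [← hZ]
  have hvV := vertsOf_subset_vertexSet hv
  by_cases heg : e = g
  · subst heg
    refine ⟨y, v, Z, P, {v}, ∅, hP, .nil _ hvV, by simp [hP.left_mem], ?_, ?_, hg⟩
    · rw [union_eq_self_of_subset_right (by simpa using hP.left_mem)]
    · simp [hgP]
  · have heP := he.resolve_left heg
    obtain ⟨s, t, Z₁, P₁, Z₂, P₂, h1, h2, h3, h4, rfl, rfl, h7, h8⟩ := hP.splitEdge heP
    have hvZ : v ∉ Z₂ := h4.notMem_of_mem_left h1.left_mem
    refine ⟨s, t, Z₁, P₁, _, _, h1, h3.reverse.cons _ _ _ _ _ _ hg.symm hvZ, ?_, ?_, ?_, h2⟩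
    · rw [inter_insert_of_mem h1.left_mem, h4.inter_eq, insert_empty_eq]
    · rw [union_insert, insert_eq_of_mem (mem_union_left _ h1.left_mem)]
    · ext t
      simp only [mem_sdiff, mem_insert_iff, mem_union, mem_singleton_iff]
      constructor
      · tauto
      · rintro (h | rfl | h)
        · exact ⟨by tauto, fun hh => h7 (hh ▸ h)⟩
        · exact ⟨by tauto, fun hh => heg hh.symm⟩
        · exact ⟨by tauto, fun hh => h8 (hh ▸ h)⟩

/-- A path contains no cycle. -/
theorem IsPath.not_isCycle (h : G.IsPath x y Z P) (hCP : C ⊆ P) : ¬ G.IsCycle C := by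
  intro hC
  induction h with
  | nil => exact hC.nonempty.ne_empty (subset_empty_iff.1 hCP)
  | cons x y z e X P he hP hx ih =>
    by_cases heC : e ∈ C
    · have hxy : x ≠ y := fun h => hx (h ▸ hP.left_mem)
      obtain ⟨f, hf, hfe, hi⟩ := hC.exists_ne_inc heC he hxy
      exact notMem_of_inc_notMem hP.subset_inside hi hx ((hCP hf).resolve_left hfe)
    · exact ih fun f hf => (hCP hf).resolve_left fun hh => heC (hh ▸ hf)

/-- No cycle is properly contained in another cycle. -/
theorem IsCycle.eq_of_subset (h : G.IsCycle C) (h' : G.IsCycle D) (hDC : D ⊆ C) : D = C := by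
  refine hDC.antisymm fun e he => ?_
  by_contra heD
  -- `C` without `e` is a path and contains no cycle, so `D` cannot miss `e`.
  obtain ⟨v, hv⟩ := h.vertsOf_nonempty
  obtain ⟨s, t, Z₁, P₁, Z₂, P₂, h1, h2, h3, -, h5, -⟩ := h.sdiff_singleton hv he
  refine (h1.reverse.append h2 h3.le).not_isCycle ?_ h'
  rw [← h5]
  exact subset_sdiff_singleton hDC heD

/-- A cycle minus one of its vertices is connected. -/
theorem IsCycle.reach_sdiff (h : G.IsCycle C) (ha : a ∈ G.vertsOf C) (hb : b ∈ G.vertsOf C)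
    (hav : a ≠ v) (hbv : b ≠ v) : G.Reach C (G.vertsOf C \ {v}) a b := by
  by_cases hv : v ∈ G.vertsOf C
  · obtain ⟨y, Z, P, g, hP, hgP, hg, rfl, hZ⟩ := h.rotate hv
    rw [← hZ] at ha hb ⊢
    cases hP with
    | nil => exact absurd ha hav
    | cons _ u _ f Z₃ P₃ hf hP₃ hvZ =>
      refine (hP₃.reach (ha.resolve_left hav) (hb.resolve_left hbv)).mono
        ((subset_insert _ _).trans (subset_insert _ _)) ?_
      rw [insert_sdiff_self_of_notMem hvZ]
  · rw [sdiff_singleton_eq_self hv]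
    exact h.connVia ha hb

/-- A path together with an edge between its ends is a cycle. -/
theorem IsPath.isCycle (h : G.IsPath x y Z P) (he : G.IsLink e y x) (heP : e ∉ P) :
    G.IsCycle (insert e P) := ⟨x, y, Z, P, e, h, heP, he, rfl⟩

/-- Two internally disjoint paths with the same ends form a cycle. -/
theorem IsPath.isCycle_union (h : G.IsPath u v X P) (h' : G.IsPath u v Y Q) (huv : u ≠ v)
    (hXY : X ∩ Y = {u, v}) (hPQ : Disjoint P Q) : G.IsCycle (P ∪ Q) := by
  cases h' with
  | nil => exact absurd rfl huv
  | cons _ y _ e X₁ P₁ he hP₁ hu =>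
    have hp := h.append hP₁.reverse (by
      rintro t ⟨ht, ht'⟩
      have : t ∈ ({u, v} : Set V) := hXY ▸ ⟨ht, Or.inr ht'⟩
      exact this.resolve_left fun hh => hu (hh ▸ ht'))
    have heP : e ∉ P := fun hh => disjoint_left.1 hPQ hh (mem_insert _ _)
    have := hp.isCycle he.symm (by
      rintro (h | h)
      exacts [heP h, notMem_of_inc_notMem hP₁.subset_inside he.inc_left hu h])
    rwa [union_insert]

theorem isCycle_loop (h : G.IsLink e x x) : G.IsCycle {e} := by
  have := (IsPath.nil (G := G) x h.left_mem).isCycle h (notMem_empty e)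
  rwa [insert_empty_eq] at this

theorem IsTheta.isCycle₁₂ {P₁ P₂ P₃ : Set α} (h : G.IsTheta P₁ P₂ P₃) : G.IsCycle (P₁ ∪ P₂) := by
  obtain ⟨u, v, X₁, X₂, X₃, huv, h1, h2, h3, h12, h13, h23, d12, d13, d23⟩ := h
  exact h1.isCycle_union h2 huv h12 d12

/-- Together with `IsTheta.perm₂₁₃` this generates all reorderings, so facts about thetas need a
proof for one choice of paths only. -/
theorem IsTheta.perm₁₃₂ {P₁ P₂ P₃ : Set α} (h : G.IsTheta P₁ P₂ P₃) : G.IsTheta P₁ P₃ P₂ := by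
  obtain ⟨u, v, X₁, X₂, X₃, huv, h1, h2, h3, h12, h13, h23, d12, d13, d23⟩ := h
  exact ⟨u, v, X₁, X₃, X₂, huv, h1, h3, h2, h13, h12, by rw [inter_comm, h23], d13, d12, d23.symm⟩

theorem IsTheta.perm₂₁₃ {P₁ P₂ P₃ : Set α} (h : G.IsTheta P₁ P₂ P₃) : G.IsTheta P₂ P₁ P₃ := by
  obtain ⟨u, v, X₁, X₂, X₃, huv, h1, h2, h3, h12, h13, h23, d12, d13, d23⟩ := h
  exact ⟨u, v, X₂, X₁, X₃, huv, h2, h1, h3, by rw [inter_comm, h12], h23, h13, d12.symm, d23, d13⟩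

theorem IsTheta.nonempty₁ {P₁ P₂ P₃ : Set α} (h : G.IsTheta P₁ P₂ P₃) : P₁.Nonempty := by
  obtain ⟨u, v, X₁, X₂, X₃, huv, h1, -⟩ := h
  exact h1.nonempty_of_ne huv

theorem IsTheta.disjoint₁₂ {P₁ P₂ P₃ : Set α} (h : G.IsTheta P₁ P₂ P₃) : Disjoint P₁ P₂ := by
  obtain ⟨u, v, X₁, X₂, X₃, huv, h1, h2, h3, h12, h13, h23, d12, d13, d23⟩ := h
  exact d12

/-! ### Growing a connected set of edges by pendant edges -/

/-- `G.Grow I H₀ U₀ H U`: starting from the edge set `H₀` with vertex set `U₀`, successively adding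
edges of `I` that join an old vertex to a new vertex yields the edge set `H` with vertex set `U`. -/
inductive Grow (G : Graph V α) (I H₀ : Set α) (U₀ : Set V) : Set α → Set V → Prop
  | base : Grow G I H₀ U₀ H₀ U₀
  | step (H : Set α) (U : Set V) (e : α) (u v : V) (h : Grow G I H₀ U₀ H U) (he : e ∈ I)
      (hl : G.IsLink e u v) (hu : u ∈ U) (hv : v ∉ U) : Grow G I H₀ U₀ (insert e H) (insert v U)

section Grow

variable {H H₀ : Set α} {U₀ : Set V}

theorem Grow.subset_inside (h : G.Grow I H₀ U₀ H U) (h₀ : H₀ ⊆ G.inside U₀) : H ⊆ G.inside U := by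
  induction h with
  | base => exact h₀
  | step H U e u v h he hl hu hv ih =>
    exact insert_subset (hl.mem_inside (Or.inr hu) (mem_insert _ _))
      (ih.trans (inside_mono (subset_insert _ _)))

theorem Grow.subset_union (h : G.Grow I H₀ U₀ H U) : H ⊆ H₀ ∪ I := by
  induction h with
  | base => exact subset_union_left
  | step H U e u v h he hl hu hv ih => exact insert_subset (Or.inr he) ih

theorem Grow.base_subset (h : G.Grow I H₀ U₀ H U) : H₀ ⊆ H ∧ U₀ ⊆ U := by
  induction h with
  | base => exact ⟨Subset.rfl, Subset.rfl⟩
  | step H U e u v h he hl hu hv ih =>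
    exact ⟨ih.1.trans (subset_insert _ _), ih.2.trans (subset_insert _ _)⟩

theorem Grow.subset_vertexSet (h : G.Grow I H₀ U₀ H U) : U ⊆ U₀ ∪ G.vertsOf I := by
  induction h with
  | base => exact subset_union_left
  | step H U e u v h he hl hu hv ih =>
    exact insert_subset (Or.inr (hl.right_mem_vertsOf he)) ih

theorem Grow.connVia (h : G.Grow I H₀ U₀ H U) (h₀ : G.ConnVia H₀ U₀) : G.ConnVia H U := by
  induction h with
  | base => exact h₀
  | step H U e u v h he hl hu hv ih =>
    refine .of_reach_left (a := u) ?_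
    rintro b (rfl | hb)
    · exact hl.reach (mem_insert _ _) (Or.inr hu) (mem_insert _ _)
    · exact (ih hu hb).mono (subset_insert _ _) (subset_insert _ _)

/-- Each step adds one edge and one vertex, so the difference of the two numbers is invariant; it is
written additively to avoid truncated subtraction. -/
theorem Grow.ncard (h : G.Grow I H₀ U₀ H U) (h₀ : H₀ ⊆ G.inside U₀) (hH : H₀.Finite)
    (hU : U₀.Finite) : H.Finite ∧ U.Finite ∧ H.ncard + U₀.ncard = U.ncard + H₀.ncard := by
  induction h with
  | base => exact ⟨hH, hU, add_comm _ _⟩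
  | step H U e u v h he hl hu hv ih =>
    refine ⟨ih.1.insert _, ih.2.1.insert _, ?_⟩
    rw [ncard_insert_of_notMem hv ih.2.1, ncard_insert_of_notMem
      (notMem_of_inc_notMem (h.subset_inside h₀) hl.inc_right hv) ih.1]
    have := ih.2.2
    omega

/-- A maximal growth is not left by any edge of `I`. -/
theorem exists_maximal_grow (I H₀ : Set α) (U₀ : Set V) (hfin : (U₀ ∪ G.vertsOf I).Finite) :
    ∃ H U, G.Grow I H₀ U₀ H U ∧ ∀ e ∈ I, ∀ u v, G.IsLink e u v → u ∈ U → v ∈ U := by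
  have hf : {U | ∃ H, G.Grow I H₀ U₀ H U}.Finite :=
    hfin.finite_subsets.subset fun U ⟨H, h⟩ => h.subset_vertexSet
  obtain ⟨U, ⟨⟨H, hH⟩, hmax⟩⟩ := hf.exists_maximal ⟨U₀, H₀, .base⟩
  refine ⟨H, U, hH, fun e he u v hl hu => ?_⟩
  by_contra hv
  exact hv (hmax ⟨_, hH.step _ _ _ _ _ he hl hu hv⟩ (subset_insert _ _) (mem_insert _ _))

end Grow

end Graph

namespace Graph

variable {V α : Type*} {G : Graph V α} {x y z u v w a b : V} {e f : α} {S T U X Y Z : Set V}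
  {P Q C D I J H : Set α} {B : Set (Set α)}

/-! ### Sets of edges without frame circuits -/

theorem inside_empty : G.inside ∅ = ∅ := by
  ext e; simp [inside]

/-- If no edge of `I` leaves `T`, then the edges of `I` that are not inside `T` avoid `T`. -/
theorem sdiff_inside_subset (hI : I ⊆ G.inside U)
    (hcl : ∀ e ∈ I, ∀ u v, G.IsLink e u v → u ∈ T → v ∈ T) :
    I \ G.inside T ⊆ G.inside (U \ T) := by
  rintro e ⟨he, heT⟩
  obtain ⟨s, hs, t, ht, hl⟩ := hI he
  have hsT : s ∉ T := fun h => heT (hl.mem_inside h (hcl e he _ _ hl h))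
  have htT : t ∉ T := fun h => heT (hl.mem_inside (hcl e he _ _ hl.symm h) h)
  exact hl.mem_inside ⟨hs, hsT⟩ ⟨ht, htT⟩

/-- A forest has fewer edges than vertices. -/
theorem ncard_lt_of_acyclic (hI : I ⊆ G.inside U) (hfin : I.Finite) (hU : U.Finite)
    (hne : U.Nonempty) (hac : ∀ C, G.IsCycle C → ¬ C ⊆ I) : I.ncard < U.ncard := by
  induction hn : U.ncard using Nat.strong_induction_on generalizing U I with
  | _ n ih =>
  subst hn
  obtain ⟨x, hx⟩ := hne
  have hsub : {x} ∪ G.vertsOf I ⊆ U :=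
    union_subset (by simpa using hx) (vertsOf_subset_of_subset_inside hI)
  -- A spanning tree of the component of `x`: it has one edge fewer than vertices, and any other
  -- edge of `I` inside `U₁` would close a cycle. The induction goes on with the remaining vertices.
  obtain ⟨H, U₁, hg, hcl⟩ := exists_maximal_grow I ∅ {x} (hU.subset hsub)
  have hHI : H ⊆ I := by simpa using hg.subset_union
  have hU₁ : U₁ ⊆ U := hg.subset_vertexSet.trans hsub
  have hHU : H ⊆ G.inside U₁ := hg.subset_inside (empty_subset _)
  have hcard := (hg.ncard (empty_subset _) finite_empty (finite_singleton x)).2.2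
  rw [ncard_singleton, ncard_empty] at hcard
  have hin : I ∩ G.inside U₁ ⊆ H := by
    rintro e ⟨heI, s, hs, t, ht, hl⟩
    by_contra heH
    have hconn := hg.connVia (by
      rintro a rfl b rfl
      exact .refl)
    obtain ⟨Z, Q, hp, -, hQ⟩ := (hconn hs ht).exists_isPath hs hl.left_mem
    exact hac _ (hp.isCycle hl.symm fun h => heH (hQ h)) (insert_subset heI (hQ.trans hHI))
  have h2 := sdiff_inside_subset hI hcl
  have hxU₁ : x ∈ U₁ := hg.base_subset.2 rfl
  have hsplit := ncard_inter_add_ncard_sdiff_eq_ncard I (G.inside U₁) hfin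
  have hsplitU := ncard_sdiff_add_ncard_of_subset hU₁ hU
  have h1 : (I ∩ G.inside U₁).ncard ≤ H.ncard := ncard_le_ncard hin (hfin.subset hHI)
  have hpos : 0 < U₁.ncard := (ncard_pos (hU.subset hU₁)).2 ⟨x, hxU₁⟩
  rcases (U \ U₁).eq_empty_or_nonempty with hem | hne
  · rw [hem, inside_empty, subset_empty_iff] at h2
    rw [h2, ncard_empty] at hsplit
    omega
  · have := ih (U \ U₁).ncard (by omega) h2 (hfin.subset sdiff_subset) (hU.subset sdiff_subset) hne
      (fun C hC hCI => hac C hC (hCI.trans sdiff_subset)) rfl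
    omega

section Ear

variable (hB : ∀ D ∈ B, ¬ D ⊆ I) (hC : G.IsCycle C) (hCI : C ⊆ I)
include hB hC hCI

/-- The ends of the ear split `C` into two paths. The three paths form a theta in `I`, and no cycle
in `I` is balanced. -/
theorem exists_theta_of_ear (hp : G.IsPath a b Z P) (hPI : P ⊆ I) (hab : a ≠ b)
    (hZ : Z ∩ G.vertsOf C = {a, b}) (hPC : Disjoint P C) : ∃ X ⊆ I, G.IsFrameCircuit B X := by
  have ha : a ∈ G.vertsOf C := (hZ.superset (mem_insert _ _)).2
  have hb : b ∈ G.vertsOf C := (hZ.superset (mem_insert_of_mem _ rfl)).2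
  obtain ⟨y, Z', P', g, hP', hgP', hg, rfl, hZ'⟩ := hC.rotate ha
  rw [← hZ'] at hb hZ
  obtain ⟨Z₁, P₁, Z₂, P₂, h1, h2, h3, rfl, rfl, h6⟩ := hP'.split hb
  have haZ₂ : a ∉ Z₂ := fun h => hab (h3.subset ⟨h1.left_mem, h⟩)
  have h2' := h2.reverse.cons _ _ _ _ _ _ hg.symm haZ₂
  rw [mem_union, not_or] at hgP'
  have hth : G.IsTheta P P₁ (insert g P₂) := by
    refine ⟨a, b, Z, Z₁, _, hab, hp, h1, h2', ?_, ?_, ?_, ?_, ?_, ?_⟩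
    · apply Subset.antisymm
      · rw [← hZ]
        exact inter_subset_inter_right _ subset_union_left
      · rintro t (rfl | rfl)
        exacts [⟨hp.left_mem, h1.left_mem⟩, ⟨hp.right_mem, h1.right_mem⟩]
    · apply Subset.antisymm
      · rw [← hZ]
        refine inter_subset_inter_right _ (insert_subset (Or.inl h1.left_mem) subset_union_right)
      · rintro t (rfl | rfl)
        exacts [⟨hp.left_mem, h2'.left_mem⟩, ⟨hp.right_mem, h2'.right_mem⟩]
    · rw [inter_insert_of_mem h1.left_mem, h3]
    · exact hPC.mono_right (subset_union_left.trans (subset_insert _ _))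
    · exact hPC.mono_right (insert_subset_insert subset_union_right)
    · rw [disjoint_insert_right]
      exact ⟨hgP'.1, h6⟩
  have hP₁ : P₁ ⊆ I := (subset_union_left.trans (subset_insert _ _)).trans hCI
  have hP₂ : insert g P₂ ⊆ I := (insert_subset_insert subset_union_right).trans hCI
  refine ⟨P ∪ P₁ ∪ insert g P₂, union_subset (union_subset hPI hP₁) hP₂, Or.inr (Or.inl
    ⟨P, P₁, _, hth, fun h => hB _ h ?_, fun h => hB _ h ?_, fun h => hB _ h ?_, rfl⟩)⟩
  exacts [union_subset hPI hP₁, union_subset hPI hP₂, union_subset hP₁ hP₂]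

/-- The handcuff is tight if the path is trivial and loose otherwise. -/
theorem exists_handcuff_of_lollipop (hD : G.IsCycle D) (hDI : D ⊆ I) (hp : G.IsPath y a Z P)
    (hPI : P ⊆ I) (hZC : Z ∩ G.vertsOf C = {a}) (hZD : Z ∩ G.vertsOf D = {y})
    (hDC : G.vertsOf D ∩ G.vertsOf C ⊆ {a}) (hdisj : Disjoint D C) :
    ∃ X ⊆ I, G.IsFrameCircuit B X := by
  have hCB : G.IsUnbalanced B C := ⟨hC, fun h => hB _ h hCI⟩
  have hDB : G.IsUnbalanced B D := ⟨hD, fun h => hB _ h hDI⟩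
  have haC := (hZC.superset rfl).2
  have hyD := (hZD.superset rfl).2
  by_cases hya : y = a
  · subst hya
    exact ⟨D ∪ C, union_subset hDI hCI, Or.inr (Or.inr (Or.inl ⟨D, C, hDB, hCB, hdisj,
      ⟨y, hDC.antisymm (singleton_subset_iff.2 ⟨hyD, haC⟩)⟩, rfl⟩))⟩
  · refine ⟨D ∪ C ∪ P, union_subset (union_subset hDI hCI) hPI, Or.inr (Or.inr (Or.inr
      ⟨D, C, y, a, Z, P, hDB, hCB, ?_, hp, hZD, hZC, rfl⟩))⟩
    rw [Set.disjoint_left]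
    intro t htD htC
    obtain rfl : t = a := hDC ⟨htD, htC⟩
    exact hya (hZD.subset ⟨hp.right_mem, htD⟩).symm

/-- A unicyclic graph together with an ear or a lollipop contains a frame circuit. -/
theorem Grow.exists_frameCircuit (h : G.Grow I C (G.vertsOf C) H U) :
    (∀ a b Z P, G.IsPath a b Z P → P ⊆ I → a ≠ b → Z ∩ U = {a, b} → Disjoint P H →
      ∃ X ⊆ I, G.IsFrameCircuit B X) ∧
    ∀ D y a Z P, G.IsCycle D → D ⊆ I → G.IsPath y a Z P → P ⊆ I → Z ∩ U = {a} →
      Z ∩ G.vertsOf D = {y} → G.vertsOf D ∩ U ⊆ {a} → Disjoint D H →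
      ∃ X ⊆ I, G.IsFrameCircuit B X := by
  induction h with
  | base =>
    exact ⟨fun a b Z P h1 h2 h3 h4 h5 => exists_theta_of_ear hB hC hCI h1 h2 h3 h4 h5,
      fun D y a Z P h1 h2 h3 h4 h5 h6 h7 h8 =>
        exists_handcuff_of_lollipop hB hC hCI h1 h2 h3 h4 h5 h6 h7 h8⟩
  | step H U e u v h he hl hu hv ih =>
    have huv : u ≠ v := fun h => hv (h ▸ hu)
    have heH : e ∉ H := notMem_of_inc_notMem (h.subset_inside hC.subset_inside) hl.inc_right hv
    -- An ear that starts at the new vertex `v` is prolonged by `e`. The result is an ear from `u`,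
    -- unless the ear ended at `u`: then it closes up to a cycle, a lollipop with trivial path at
    -- `u`.
    have key : ∀ b Z P, G.IsPath v b Z P → P ⊆ I → v ≠ b → Z ∩ insert v U = {v, b} →
        Disjoint P (insert e H) → ∃ X ⊆ I, G.IsFrameCircuit B X := by
      intro b Z P hp hPI hvb hZ hd
      rw [disjoint_insert_right] at hd
      have hbU : b ∈ U := ((hZ.superset (mem_insert_of_mem _ rfl)).2).resolve_left (Ne.symm hvb)
      have hZU : ∀ t ∈ Z, t ∈ U → t = b := fun t ht htU =>
        (hZ.subset ⟨ht, Or.inr htU⟩).resolve_left fun hh => hv (hh ▸ htU)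
      by_cases hbu : b = u
      · subst hbu
        have hD := hp.isCycle hl hd.1
        have hDZ : G.vertsOf (insert e P) ⊆ Z := vertsOf_subset_of_subset_inside
          (insert_subset (hl.mem_inside hp.right_mem hp.left_mem) hp.subset_inside)
        refine ih.2 _ b b {b} ∅ hD (insert_subset he hPI) (.nil _ hl.left_mem) (empty_subset _)
          (by simpa using hu) ?_ (fun t ht => hZU t (hDZ ht.1) ht.2) ?_
        · simpa using hl.left_mem_vertsOf (mem_insert e P)
        · rw [disjoint_insert_left]
          exact ⟨heH, hd.2⟩
      · have huZ : u ∉ Z := fun h => hbu (hZU u h hu).symm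
        refine ih.1 _ _ _ _ (hp.cons _ _ _ _ _ _ hl huZ) (insert_subset he hPI) (Ne.symm hbu) ?_ ?_
        · apply Subset.antisymm
          · rintro t ⟨rfl | ht, htU⟩
            · simp
            · simp [hZU t ht htU]
          · rintro t (rfl | rfl)
            exacts [⟨mem_insert _ _, hu⟩, ⟨Or.inr hp.right_mem, hbU⟩]
        · rw [disjoint_insert_left]
          exact ⟨heH, hd.2⟩
    refine ⟨fun a b Z P hp hPI hab hZ hd => ?_, fun D y a Z P hD hDI hp hPI hZ hZD hDU hd => ?_⟩
    · by_cases hav : a = v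
      · subst hav
        exact key b Z P hp hPI hab hZ hd
      by_cases hbv : b = v
      · subst hbv
        exact key a Z P hp.reverse hPI (Ne.symm hab) (by rw [hZ, pair_comm]) hd
      refine ih.1 a b Z P hp hPI hab ?_ (hd.mono_right (subset_insert _ _))
      rw [← hZ, inter_insert_of_notMem]
      intro hvZ
      rcases hZ.subset ⟨hvZ, mem_insert _ _⟩ with h | h
      exacts [hav h.symm, hbv h.symm]
    · rw [disjoint_insert_right] at hd
      -- A lollipop attached at `v` becomes one attached at `u` when its path is prolonged by `e`.
      by_cases hav : a = v
      · subst hav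
        have hZU : ∀ t ∈ Z, t ∉ U := fun t ht htU => by
          obtain rfl : t = a := hZ.subset ⟨ht, Or.inr htU⟩
          exact hv htU
        have huD : u ∉ G.vertsOf D := fun h => huv (hDU ⟨h, Or.inr hu⟩)
        have hp' := hp.append (hl.symm.isPath (Ne.symm huv)) (by
          rintro t ⟨ht, rfl | rfl⟩
          · rfl
          · exact absurd hu (hZU _ ht))
        refine ih.2 D y u _ _ hD hDI hp' (union_subset hPI (by simpa using he)) ?_ ?_ ?_ hd.2
        · apply Subset.antisymm
          · rintro t ⟨ht | rfl | rfl, htU⟩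
            exacts [absurd htU (hZU _ ht), absurd htU hv, rfl]
          · rintro t rfl
            exact ⟨Or.inr (by simp), hu⟩
        · apply Subset.antisymm
          · rintro t ⟨ht | rfl | rfl, htD⟩
            exacts [hZD.subset ⟨ht, htD⟩, hZD.subset ⟨hp.right_mem, htD⟩, absurd htD huD]
          · rw [← hZD]
            exact inter_subset_inter_left _ subset_union_left
        · rintro t ⟨htD, htU⟩
          obtain rfl : t = a := hDU ⟨htD, Or.inr htU⟩
          exact absurd htU hv
      · refine ih.2 D y a Z P hD hDI hp hPI ?_ hZD
          ((inter_subset_inter_right _ (subset_insert _ _)).trans hDU) hd.2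
        rw [← hZ, inter_insert_of_notMem]
        exact fun hvZ => hav (hZ.subset ⟨hvZ, mem_insert _ _⟩).symm

end Ear

/-- A set of edges without frame circuits has at most as many elements as vertices. -/
theorem ncard_le_of_frameFree (hI : I ⊆ G.inside U) (hfin : I.Finite) (hU : U.Finite)
    (hfree : ∀ X, G.IsFrameCircuit B X → ¬ X ⊆ I) : I.ncard ≤ U.ncard := by
  induction hn : U.ncard using Nat.strong_induction_on generalizing U I with
  | _ n ih =>
  subst hn
  by_cases hac : ∀ C, G.IsCycle C → ¬ C ⊆ I
  · rcases U.eq_empty_or_nonempty with rfl | hne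
    · rw [inside_empty, subset_empty_iff] at hI
      simp [hI]
    · exact (ncard_lt_of_acyclic hI hfin hU hne hac).le
  push Not at hac
  obtain ⟨C, hC, hCI⟩ := hac
  have hB : ∀ D ∈ B, ¬ D ⊆ I := fun D hD => hfree D (Or.inl hD)
  have hsub : G.vertsOf C ∪ G.vertsOf I ⊆ U := union_subset
    ((vertsOf_mono hCI).trans (vertsOf_subset_of_subset_inside hI))
    (vertsOf_subset_of_subset_inside hI)
  -- `H` is a spanning unicyclic subgraph of the component of `C`, with as many edges as vertices.
  -- Any other edge of `I` inside `U₁` would be an ear or, if it is a loop, a lollipop with trivial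
  -- path.
  obtain ⟨H, U₁, hg, hcl⟩ := exists_maximal_grow I C (G.vertsOf C) (hU.subset hsub)
  have hHI : H ⊆ I := hg.subset_union.trans (union_subset hCI Subset.rfl)
  have hU₁ : U₁ ⊆ U := hg.subset_vertexSet.trans hsub
  have hHU : H ⊆ G.inside U₁ := hg.subset_inside hC.subset_inside
  have hcard := (hg.ncard hC.subset_inside hC.finite hC.vertsOf_finite).2.2
  rw [hC.ncard] at hcard
  have hear := hg.exists_frameCircuit hB hC hCI
  have hin : I ∩ G.inside U₁ ⊆ H := by
    rintro e ⟨heI, s, hs, t, ht, hl⟩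
    by_contra heH
    suffices ∃ X ⊆ I, G.IsFrameCircuit B X by
      obtain ⟨X, hX, hX'⟩ := this
      exact hfree X hX' hX
    by_cases hst : s = t
    · subst hst
      refine hear.2 {e} s s {s} ∅ (isCycle_loop hl) (by simpa using heI) (.nil _ hl.left_mem)
        (empty_subset _) (by simpa using hs) ?_ ?_ (by simpa using heH)
      · simpa using hl.left_mem_vertsOf (mem_singleton e)
      · rintro t ⟨ht, -⟩
        exact vertsOf_subset_of_subset_inside (singleton_subset_iff.2
          (hl.mem_inside (S := {s}) rfl rfl)) ht
    · refine hear.1 s t _ _ (hl.isPath hst) (by simpa using heI) hst ?_ (by simpa using heH)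
      exact inter_eq_left.2 (insert_subset hs (by simpa using ht))
  have h2 := sdiff_inside_subset hI hcl
  have hsplit := ncard_inter_add_ncard_sdiff_eq_ncard I (G.inside U₁) hfin
  have hsplitU := ncard_sdiff_add_ncard_of_subset hU₁ hU
  have h1 : (I ∩ G.inside U₁).ncard ≤ H.ncard := ncard_le_ncard hin (hfin.subset hHI)
  have hpos : 0 < U₁.ncard := by
    obtain ⟨x, hx⟩ := hC.vertsOf_nonempty
    exact (ncard_pos (hU.subset hU₁)).2 ⟨x, hg.base_subset.2 hx⟩
  have := ih (U \ U₁).ncard (by omega) h2 (hfin.subset sdiff_subset) (hU.subset sdiff_subset)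
    (fun X hX hXI => hfree X hX (hXI.trans sdiff_subset)) rfl
  omega

end Graph

namespace Graph

variable {V α : Type*} {G : Graph V α} {x y z u v w a b : V} {e f : α} {S T U X Y Z : Set V}
  {P Q C D I J H : Set α} {B : Set (Set α)}

/-! ### Independence in the lift matroid -/

/-- Consequently an edge that lies in no cycle can be added to a lift-independent set freely. -/
theorem IsLiftCircuit.exists_isCycle (hB : ∀ C ∈ B, G.IsCycle C) (hP : G.IsLiftCircuit B P)
    (he : e ∈ P) : ∃ C ⊆ P, G.IsCycle C ∧ e ∈ C := by
  rcases hP with h | ⟨P₁, P₂, P₃, h, -, -, -, rfl⟩ | ⟨C₁, C₂, h₁, h₂, -, -, rfl⟩ |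
    ⟨C₁, C₂, h₁, h₂, -, rfl⟩
  · exact ⟨P, Subset.rfl, hB _ h, he⟩
  · rcases he with he | he
    · exact ⟨_, subset_union_left, h.isCycle₁₂, he⟩
    · refine ⟨_, ?_, h.perm₁₃₂.isCycle₁₂, Or.inr he⟩
      exact union_subset_union_left _ subset_union_left
  all_goals
    rcases he with he | he
    · exact ⟨C₁, subset_union_left, h₁.1, he⟩
    · exact ⟨C₂, subset_union_right, h₂.1, he⟩

theorem IsLiftIndep.insert_pendant (hB : ∀ C ∈ B, G.IsCycle C) (hI : G.IsLiftIndep B I)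
    (hIU : I ⊆ G.inside U) (hl : G.IsLink e u v) (huv : u ≠ v) (hv : v ∉ U) :
    G.IsLiftIndep B (insert e I) := by
  refine ⟨insert_subset hl.edge_mem hI.1, fun X hX hXI => ?_⟩
  by_cases heX : e ∈ X
  · obtain ⟨C, hCX, hC, heC⟩ := hX.exists_isCycle hB heX
    obtain ⟨f, hf, hfe, hi⟩ := hC.exists_ne_inc heC hl.symm (Ne.symm huv)
    exact notMem_of_inc_notMem hIU hi hv ((hXI (hCX hf)).resolve_left hfe)
  · exact hI.2 X hX ((subset_insert_iff_of_notMem heX).1 hXI)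

theorem IsLiftIndep.mono (hI : G.IsLiftIndep B I) (hJ : J ⊆ I) : G.IsLiftIndep B J :=
  ⟨hJ.trans hI.1, fun X hX hXJ => hI.2 X hX (hXJ.trans hJ)⟩

/-- The path is built from its attached end `x` outwards, so each new edge is pendant. -/
theorem IsLiftIndep.union_path (hB : ∀ C ∈ B, G.IsCycle C) (hI : G.IsLiftIndep B I)
    (hIU : I ⊆ G.inside U) (hP : G.IsPath y x Z P) (hZ : Z ∩ U ⊆ {x}) :
    G.IsLiftIndep B (I ∪ P) := by
  induction hP with
  | nil => simpa using hI
  | cons y w x e Z P hl hP hy ih =>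
    have := ih ((inter_subset_inter_left _ (subset_insert _ _)).trans hZ)
    rw [union_insert]
    refine this.insert_pendant (U := U ∪ Z) hB ?_ hl.symm (fun hh => hy (hh ▸ hP.left_mem)) ?_
    · exact union_subset (hIU.trans (inside_mono subset_union_left))
        (hP.subset_inside.trans (inside_mono subset_union_right))
    · rintro (h | h)
      · obtain rfl : y = x := hZ ⟨mem_insert _ _, h⟩
        exact hy hP.right_mem
      · exact hy h

/-- A lift circuit inside `C` is a balanced cycle or contains two different cycles, whereas `C`
contains no cycle but itself. -/
theorem IsUnbalanced.isLiftIndep (hB : ∀ C ∈ B, G.IsCycle C) (hC : G.IsUnbalanced B C) :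
    G.IsLiftIndep B C := by
  refine ⟨hC.1.subset_edgeSet, fun X hX hXC => ?_⟩
  rcases hX with h | ⟨P₁, P₂, P₃, h, -, -, -, rfl⟩ | ⟨C₁, C₂, h₁, h₂, hd, -, rfl⟩ |
    ⟨C₁, C₂, h₁, h₂, hd, rfl⟩
  · exact hC.2 (hC.1.eq_of_subset (hB _ h) hXC ▸ h)
  · have h1 := hC.1.eq_of_subset h.isCycle₁₂ (subset_union_left.trans hXC)
    obtain ⟨e, he⟩ := h.perm₁₃₂.perm₂₁₃.nonempty₁
    have heC : e ∈ C := hXC (Or.inr he)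
    rw [← h1] at heC
    rcases heC with h' | h'
    · exact disjoint_left.1 h.perm₁₃₂.disjoint₁₂ h' he
    · exact disjoint_left.1 h.perm₂₁₃.perm₁₃₂.disjoint₁₂ h' he
  · obtain rfl := hC.1.eq_of_subset h₁.1 (subset_union_left.trans hXC)
    obtain rfl := hC.1.eq_of_subset h₂.1 (subset_union_right.trans hXC)
    exact h₁.1.nonempty.ne_empty (disjoint_self.1 hd)
  · obtain rfl := hC.1.eq_of_subset h₁.1 (subset_union_left.trans hXC)
    obtain rfl := hC.1.eq_of_subset h₂.1 (subset_union_right.trans hXC)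
    exact h₁.1.vertsOf_nonempty.ne_empty (disjoint_self.1 hd)

theorem Grow.isLiftIndep {H₀ : Set α} {U₀ : Set V} (h : G.Grow I H₀ U₀ H U)
    (hB : ∀ C ∈ B, G.IsCycle C) (h₀ : H₀ ⊆ G.inside U₀) (hH₀ : G.IsLiftIndep B H₀) :
    G.IsLiftIndep B H := by
  induction h with
  | base => exact hH₀
  | step H U e u v h he hl hu hv ih =>
    exact ih.insert_pendant hB (h.subset_inside h₀) hl (fun hh => hv (hh ▸ hu)) hv

/-- A cycle opened at `e` consists of two paths that start at `v`, and each of them can be attached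
by pendant edges. -/
theorem IsLiftIndep.union_isCycle_sdiff (hB : ∀ C ∈ B, G.IsCycle C) (hI : G.IsLiftIndep B I)
    (hIU : I ⊆ G.inside U) (hC : G.IsCycle C) (hv : v ∈ G.vertsOf C)
    (hCU : G.vertsOf C ∩ U ⊆ {v}) (he : e ∈ C) : G.IsLiftIndep B (I ∪ C \ {e}) := by
  obtain ⟨s, t, Z₁, P₁, Z₂, P₂, h1, h2, h3, h4, h5, -⟩ := hC.sdiff_singleton hv he
  rw [h5, ← union_assoc]
  rw [h4] at hCU
  refine (hI.union_path hB hIU h1.reverse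
    ((inter_subset_inter_left _ subset_union_left).trans hCU)).union_path (U := U ∪ Z₁) hB ?_
      h2.reverse ?_
  · exact union_subset (hIU.trans (inside_mono subset_union_left))
      (h1.subset_inside.trans (inside_mono subset_union_right))
  · rintro r ⟨hr, hr' | hr'⟩
    exacts [hCU ⟨Or.inr hr, hr'⟩, h3.subset ⟨hr', hr⟩]

/-- What remains is the unbalanced cycle `P₂ ∪ P₃` with the two halves of `P₁` hanging from it. -/
theorem IsTheta.isLiftIndep {P₁ P₂ P₃ : Set α} (h : G.IsTheta P₁ P₂ P₃)
    (hB : ∀ C ∈ B, G.IsCycle C) (h23 : P₂ ∪ P₃ ∉ B) (he : e ∈ P₁) :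
    G.IsLiftIndep B (P₂ ∪ P₃ ∪ P₁ \ {e}) := by
  have hC : G.IsUnbalanced B (P₂ ∪ P₃) := ⟨h.perm₂₁₃.perm₁₃₂.isCycle₁₂, h23⟩
  obtain ⟨u, v, X₁, X₂, X₃, huv, h1, h2, h3, h12, h13, h23, d12, d13, d23⟩ := h
  obtain ⟨s, t, Z₁, Q₁, Z₂, Q₂, k1, k2, k3, k4, rfl, rfl, k7, k8⟩ := h1.splitEdge he
  have hs : insert e (Q₁ ∪ Q₂) \ {e} = Q₁ ∪ Q₂ := by
    rw [insert_sdiff_self_of_notMem]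
    simp [k7, k8]
  have hU : ∀ r ∈ Z₁ ∪ Z₂, r ∈ X₂ ∪ X₃ → r = u ∨ r = v := by
    rintro r hr (hr' | hr')
    exacts [h12.subset ⟨hr, hr'⟩, h13.subset ⟨hr, hr'⟩]
  have h23U : P₂ ∪ P₃ ⊆ G.inside (X₂ ∪ X₃) :=
    union_subset (h2.subset_inside.trans (inside_mono subset_union_left))
      (h3.subset_inside.trans (inside_mono subset_union_right))
  rw [hs, ← union_assoc]
  refine ((hC.isLiftIndep hB).union_path hB h23U k1.reverse ?_).union_path
    (U := X₂ ∪ X₃ ∪ Z₁) hB ?_ k3 ?_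
  · rintro r ⟨hr, hr'⟩
    rcases hU r (Or.inl hr) hr' with rfl | rfl
    exacts [rfl, absurd k3.right_mem (disjoint_left.1 k4 hr)]
  · exact union_subset (h23U.trans (inside_mono subset_union_left))
      (k1.subset_inside.trans (inside_mono subset_union_right))
  · rintro r ⟨hr, hr' | hr'⟩
    · rcases hU r (Or.inr hr) hr' with rfl | rfl
      exacts [absurd hr (disjoint_left.1 k4 k1.left_mem), rfl]
    · exact absurd hr (disjoint_left.1 k4 hr')

/-- Two vertex-disjoint unbalanced cycles with a minimal path joining them. -/
structure IsLoose (G : Graph V α) (B : Set (Set α)) (C₁ C₂ : Set α) (x y : V) (Z : Set V)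
    (P : Set α) : Prop where
  unb₁ : G.IsUnbalanced B C₁
  unb₂ : G.IsUnbalanced B C₂
  disj : Disjoint (G.vertsOf C₁) (G.vertsOf C₂)
  isPath : G.IsPath x y Z P
  inter₁ : Z ∩ G.vertsOf C₁ = {x}
  inter₂ : Z ∩ G.vertsOf C₂ = {y}

section Loose

variable {C₁ C₂ : Set α}

theorem IsLoose.symm (h : G.IsLoose B C₁ C₂ x y Z P) : G.IsLoose B C₂ C₁ y x Z P :=
  ⟨h.unb₂, h.unb₁, h.disj.symm, h.isPath.reverse, h.inter₂, h.inter₁⟩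

theorem IsLoose.isFrameCircuit (h : G.IsLoose B C₁ C₂ x y Z P) :
    G.IsFrameCircuit B (C₁ ∪ C₂ ∪ P) :=
  Or.inr (Or.inr (Or.inr ⟨C₁, C₂, x, y, Z, P, h.unb₁, h.unb₂, h.disj, h.isPath, h.inter₁,
    h.inter₂, rfl⟩))

theorem IsLoose.mem_left (h : G.IsLoose B C₁ C₂ x y Z P) : x ∈ G.vertsOf C₁ :=
  (h.inter₁.superset rfl).2

theorem IsLoose.isLiftIndep (h : G.IsLoose B C₁ C₂ x y Z P) (hB : ∀ C ∈ B, G.IsCycle C)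
    (he : e ∈ C₁) : G.IsLiftIndep B (C₂ ∪ P ∪ C₁ \ {e}) := by
  refine ((h.unb₂.isLiftIndep hB).union_path hB h.unb₂.1.subset_inside h.isPath
    h.inter₂.le).union_isCycle_sdiff (v := x) (U := G.vertsOf C₂ ∪ Z) hB ?_ h.unb₁.1 h.mem_left ?_ he
  · exact union_subset (h.unb₂.1.subset_inside.trans (inside_mono subset_union_left))
      (h.isPath.subset_inside.trans (inside_mono subset_union_right))
  · rintro r ⟨hr, hr' | hr'⟩
    exacts [absurd hr' (disjoint_left.1 h.disj hr), h.inter₁.subset ⟨hr', hr⟩]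

end Loose

/-- `S` contains all vertices of some unbalanced cycle. -/
def Unb (G : Graph V α) (B : Set (Set α)) (S : Set V) : Prop :=
  ∃ C, G.IsUnbalanced B C ∧ G.vertsOf C ⊆ S

theorem Unb.mono (h : G.Unb B S) (hST : S ⊆ T) : G.Unb B T :=
  ⟨h.choose, h.choose_spec.1, h.choose_spec.2.trans hST⟩

end Graph

namespace Matroid

variable {V α : Type*} {M : Matroid α} {G : Graph V α} {x y u v : V} {e f : α} {S T U Z : Set V}
  {C D I J P X Y : Set α}

/-! ### Rank as a natural number -/

/-- The rank of a set in a finite matroid, as a natural number. -/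
noncomputable def natRk (M : Matroid α) (X : Set α) : ℕ := (M.eRk X).toNat

theorem natRk_closure (X : Set α) : M.natRk (M.closure X) = M.natRk X := by
  rw [natRk, eRk_closure_eq, natRk]

theorem natRk_insert_of_mem_closure (he : e ∈ M.closure X) : M.natRk (insert e X) = M.natRk X := by
  rw [← natRk_closure, closure_insert_eq_of_mem_closure he, natRk_closure]

section Rank

variable [M.Finite]

theorem cast_natRk (X : Set α) : (M.natRk X : ℕ∞) = M.eRk X :=
  ENat.natCast_toNat (eRk_ne_top_iff.2 (M.isRkFinite_set X))

theorem natRk_mono (h : X ⊆ Y) : M.natRk X ≤ M.natRk Y := by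
  have := M.eRk_mono h
  rw [← cast_natRk, ← cast_natRk] at this
  exact_mod_cast this

theorem natRk_inter_add_union_le (X Y : Set α) :
    M.natRk (X ∩ Y) + M.natRk (X ∪ Y) ≤ M.natRk X + M.natRk Y := by
  have := M.eRk_inter_add_eRk_union_le X Y
  simp only [← cast_natRk] at this
  exact_mod_cast this

theorem Indep.natRk_eq (hI : M.Indep I) : M.natRk I = I.ncard := by
  have := hI.eRk_eq_encard
  rw [← cast_natRk, ← hI.finite.cast_ncard_eq] at this
  exact_mod_cast this

theorem Indep.ncard_le_natRk (hI : M.Indep I) (hIX : I ⊆ X) : I.ncard ≤ M.natRk X :=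
  hI.natRk_eq ▸ natRk_mono hIX

theorem exists_indep_ncard_eq_natRk (X : Set α) : ∃ I ⊆ X, M.Indep I ∧ I.ncard = M.natRk X := by
  obtain ⟨I, hI⟩ := M.exists_isBasis' X
  refine ⟨I, hI.subset, hI.indep, ?_⟩
  have := hI.encard_eq_eRk
  rw [← cast_natRk, ← hI.indep.finite.cast_ncard_eq] at this
  exact_mod_cast this

theorem indep_of_ncard_le_natRk (hX : X.Finite) (h : X.ncard ≤ M.natRk X) : M.Indep X := by
  refine (M.isRkFinite_set X).indep_of_encard_le_eRk ?_
  rw [← cast_natRk, ← hX.cast_ncard_eq]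
  exact_mod_cast h

theorem closure_eq_of_natRk_le (hXY : X ⊆ Y) (h : M.natRk Y ≤ M.natRk X) :
    M.closure X = M.closure Y := by
  refine (M.isRkFinite_set X).closure_eq_closure_of_subset_of_eRk_ge_eRk hXY ?_
  rw [← cast_natRk, ← cast_natRk]
  exact_mod_cast h

theorem mem_closure_of_natRk_insert_le (he : e ∈ M.E) (h : M.natRk (insert e X) ≤ M.natRk X) :
    e ∈ M.closure X := by
  rw [closure_eq_of_natRk_le (subset_insert e X) h]
  exact M.mem_closure_of_mem' (mem_insert _ _) he

theorem Dep.natRk_lt (hX : M.Dep X) : M.natRk X < X.ncard := by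
  by_contra! h
  exact hX.not_indep (indep_of_ncard_le_natRk (M.set_finite X hX.subset_ground) h)

end Rank

/-! ### Biased graphic matroids -/

theorem isCycle_of_mem_balancedCycles : ∀ C ∈ M.balancedCycles G, G.IsCycle C := fun _ hC => hC.2

namespace IsBiasedGraphicWith

variable (h : M.IsBiasedGraphicWith G)
include h

theorem dep_of_isFrameCircuit (hX : G.IsFrameCircuit (M.balancedCycles G) X) : ¬ M.Indep X :=
  fun hI => (h.frame_of_indep X hI).2 X hX Subset.rfl

theorem finite_of_subset_vertexSet (hS : S ⊆ V(G)) : S.Finite := h.finite_vertexSet.subset hS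

/-- Independent sets of `M` contain no frame circuit, so `ncard_le_of_frameFree` bounds them. -/
theorem natRk_le [M.Finite] (hX : X ⊆ G.inside S) (hS : S.Finite) : M.natRk X ≤ S.ncard := by
  obtain ⟨I, hIX, hI, hcard⟩ := M.exists_indep_ncard_eq_natRk X
  rw [← hcard]
  exact Graph.ncard_le_of_frameFree (hIX.trans hX) hI.finite hS (h.frame_of_indep I hI).2

/-- Growing the unbalanced cycle by pendant edges until all of `S` is reached gives a unicyclic set,
which is lift-independent and hence independent in `M`. -/
theorem le_natRk [M.Finite] (hS : S.Finite) (hP : G.ConnVia P S)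
    (hC : G.IsUnbalanced (M.balancedCycles G) C) (hCP : C ⊆ P) (hCS : G.vertsOf C ⊆ S) :
    S.ncard ≤ M.natRk (P ∩ G.inside S) := by
  have hB := isCycle_of_mem_balancedCycles (M := M) (G := G)
  have hCi : C ⊆ P ∩ G.inside S :=
    subset_inter hCP (hC.1.subset_inside.trans (Graph.inside_mono hCS))
  have hsub : G.vertsOf C ∪ G.vertsOf (P ∩ G.inside S) ⊆ S :=
    union_subset hCS (Graph.vertsOf_subset_of_subset_inside inter_subset_right)
  obtain ⟨H, U, hg, hcl⟩ := Graph.exists_maximal_grow (G := G) (P ∩ G.inside S) C (G.vertsOf C)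
    (hS.subset hsub)
  have hcard := hg.ncard hC.1.subset_inside hC.1.finite hC.1.vertsOf_finite
  rw [hC.1.ncard] at hcard
  have hSU : S ⊆ U := by
    obtain ⟨c, hc⟩ := hC.1.vertsOf_nonempty
    intro b hb
    by_contra hbU
    obtain ⟨e, he, s, t, hl, hs, ht, hsS, htS⟩ :=
      (hP (hCS hc) hb).exists_exit (hg.base_subset.2 hc) hbU
    exact ht (hcl e ⟨he, hl.mem_inside hsS htS⟩ _ _ hl hs)
  have hH : M.Indep H :=
    h.indep_of_lift _ (hg.isLiftIndep hB hC.1.subset_inside (hC.isLiftIndep hB))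
  have h1 := hH.ncard_le_natRk (hg.subset_union.trans (union_subset hCi Subset.rfl))
  have h2 := ncard_le_ncard hSU hcard.2.1
  omega

theorem natRk_inside [M.Finite] (hS : S.Finite) (hconn : G.ConnVia E(G) S)
    (hu : G.Unb (M.balancedCycles G) S) : M.natRk (G.inside S) = S.ncard := by
  obtain ⟨C, hC, hCS⟩ := hu
  refine (h.natRk_le Subset.rfl hS).antisymm ?_
  exact (h.le_natRk hS hconn hC hC.1.subset_edgeSet hCS).trans (natRk_mono inter_subset_right)

/-- The balanced cycles satisfy the theta property. -/
theorem isBiased : G.IsBiased (M.balancedCycles G) := by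
  refine ⟨isCycle_of_mem_balancedCycles, fun P₁ P₂ P₃ hth h12 h13 => ?_⟩
  by_contra h23
  obtain ⟨e, he⟩ := hth.nonempty₁
  have hne : P₁ ∪ P₂ ≠ P₁ ∪ P₃ := by
    intro hh
    obtain ⟨f, hf⟩ := hth.perm₂₁₃.nonempty₁
    rcases hh.subset (Or.inr hf) with h' | h'
    · exact disjoint_left.1 hth.disjoint₁₂ h' hf
    · exact disjoint_left.1 hth.perm₂₁₃.perm₁₃₂.disjoint₁₂ hf h'
  -- Eliminating `e` from the two balanced cycles leaves a circuit in the theta minus `e`. If `P₂ ∪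
  -- P₃` is unbalanced, that set is lift-independent.
  obtain ⟨D, hDs, hD⟩ := h12.1.elimination h13.1 hne e
  refine hD.not_indep ((h.indep_of_lift _ (hth.isLiftIndep isCycle_of_mem_balancedCycles h23 he)).subset
    (hDs.trans ?_))
  rintro f ⟨(hf | hf) | (hf | hf), hfe⟩
  exacts [Or.inr ⟨hf, hfe⟩, Or.inl (Or.inl hf), Or.inr ⟨hf, hfe⟩, Or.inl (Or.inr hf)]

/-- Dependence comes from the frame side of the definition, minimality from the lift side. This
settles the circuits that the frame and lift matroids have in common. -/
theorem isCircuit_of_forall (hX : G.IsFrameCircuit (M.balancedCycles G) X) (hXE : X ⊆ E(G))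
    (hI : ∀ e ∈ X, G.IsLiftIndep (M.balancedCycles G) (X \ {e})) : M.IsCircuit X := by
  rw [isCircuit_iff_dep_forall_sdiff_singleton_indep]
  exact ⟨⟨h.dep_of_isFrameCircuit hX, h.edgeSet_eq ▸ hXE⟩, fun e he => h.indep_of_lift _ (hI e he)⟩

theorem isCircuit_of_isUnbalancedTheta (hX : G.IsUnbalancedTheta (M.balancedCycles G) X) :
    M.IsCircuit X := by
  have hX' := hX
  obtain ⟨P₁, P₂, P₃, hth, h12, h13, h23, rfl⟩ := hX
  have hB := isCycle_of_mem_balancedCycles (M := M) (G := G)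
  refine h.isCircuit_of_forall (Or.inr (Or.inl hX')) (union_subset hth.isCycle₁₂.subset_edgeSet
    (subset_union_right.trans hth.perm₁₃₂.isCycle₁₂.subset_edgeSet)) ?_
  rintro e ((he | he) | he)
  · refine (hth.isLiftIndep hB h23 he).mono ?_
    rintro f ⟨(hf | hf) | hf, hfe⟩
    exacts [Or.inr ⟨hf, hfe⟩, Or.inl (Or.inl hf), Or.inl (Or.inr hf)]
  · refine (hth.perm₂₁₃.isLiftIndep hB h13 he).mono ?_
    rintro f ⟨(hf | hf) | hf, hfe⟩
    exacts [Or.inl (Or.inl hf), Or.inr ⟨hf, hfe⟩, Or.inl (Or.inr hf)]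
  · refine (hth.perm₁₃₂.perm₂₁₃.isLiftIndep hB h12 he).mono ?_
    rintro f ⟨(hf | hf) | hf, hfe⟩
    exacts [Or.inl (Or.inl hf), Or.inl (Or.inr hf), Or.inr ⟨hf, hfe⟩]

theorem isCircuit_of_isTightHandcuff (hX : G.IsTightHandcuff (M.balancedCycles G) X) :
    M.IsCircuit X := by
  have hX' := hX
  obtain ⟨C₁, C₂, h₁, h₂, hd, ⟨v, hv⟩, rfl⟩ := hX
  have hB := isCycle_of_mem_balancedCycles (M := M) (G := G)
  have hvm := hv.superset rfl
  refine h.isCircuit_of_forall (Or.inr (Or.inr (Or.inl hX')))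
    (union_subset h₁.1.subset_edgeSet h₂.1.subset_edgeSet) ?_
  rintro e (he | he)
  · refine ((h₂.isLiftIndep hB).union_isCycle_sdiff hB h₂.1.subset_inside h₁.1 hvm.1
      hv.subset he).mono ?_
    rintro f ⟨hf | hf, hfe⟩
    exacts [Or.inr ⟨hf, hfe⟩, Or.inl hf]
  · refine ((h₁.isLiftIndep hB).union_isCycle_sdiff hB h₁.1.subset_inside h₂.1 hvm.2
      (by rw [inter_comm]; exact hv.subset) he).mono ?_
    rintro f ⟨hf | hf, hfe⟩
    exacts [Or.inl hf, Or.inr ⟨hf, hfe⟩]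

/-- Every circuit is a balanced cycle, an unbalanced theta, a tight handcuff, or is contained in a
loose handcuff. -/
theorem isCircuit_cases [M.Finite] (hconn : G.ConnVia E(G) (G.vertsOf E(G)))
    (hu : ∃ C, G.IsUnbalanced (M.balancedCycles G) C) (hD : M.IsCircuit D) :
    D ∈ M.balancedCycles G ∨ G.IsUnbalancedTheta (M.balancedCycles G) D ∨
      G.IsTightHandcuff (M.balancedCycles G) D ∨
      ∃ C₁ C₂ x y Z P, G.IsLoose (M.balancedCycles G) C₁ C₂ x y Z P ∧ D ⊆ C₁ ∪ C₂ ∪ P := by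
  by_contra hcon
  -- The circuits of the listed types suffice to bound the rank. A maximal set `I ⊇ D` without them
  -- has at most as many edges as `G` has non-isolated vertices, and it spans `M`, whose rank is at
  -- least that number. Hence `I` is independent, although it contains `D`.
  let 𝒳 : Set α → Prop := fun D => M.IsCircuit D ∧ (D ∈ M.balancedCycles G ∨
    G.IsUnbalancedTheta (M.balancedCycles G) D ∨ G.IsTightHandcuff (M.balancedCycles G) D ∨
      ∃ C₁ C₂ x y Z P, G.IsLoose (M.balancedCycles G) C₁ C₂ x y Z P ∧ D ⊆ C₁ ∪ C₂ ∪ P)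
  have hE : E(G) = M.E := h.edgeSet_eq
  have hfinE : E(G).Finite := hE ▸ M.ground_finite
  have hU : (G.vertsOf E(G)).Finite := h.finite_of_subset_vertexSet Graph.vertsOf_subset_vertexSet
  obtain ⟨I, hDI, hI, hmax⟩ := (hfinE.finite_subsets.subset
    (fun I (hI : I ⊆ E(G) ∧ ∀ X, 𝒳 X → ¬ X ⊆ I) => hI.1)).exists_le_maximal
      (show D ∈ {I | I ⊆ E(G) ∧ ∀ X, 𝒳 X → ¬ X ⊆ I} from ⟨hE ▸ hD.subset_ground, fun X hX hXD =>
        hcon (hX.1.eq_of_subset_isCircuit hD hXD ▸ hX.2)⟩)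
  -- A loose handcuff need not be a circuit, but it is dependent, and any circuit in it is listed.
  have hfree : ∀ X, G.IsFrameCircuit (M.balancedCycles G) X → ¬ X ⊆ I := by
    intro X hX hXI
    have hdep : M.Dep X := ⟨h.dep_of_isFrameCircuit hX, hE ▸ hXI.trans hI.1⟩
    rcases hX with hX | hX | hX | ⟨C₁, C₂, x, y, Z, P, h1, h2, h3, h4, h5, h6, rfl⟩
    · exact hI.2 X ⟨hX.1, Or.inl hX⟩ hXI
    · exact hI.2 X ⟨h.isCircuit_of_isUnbalancedTheta hX, Or.inr (Or.inl hX)⟩ hXI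
    · exact hI.2 X ⟨h.isCircuit_of_isTightHandcuff hX, Or.inr (Or.inr (Or.inl hX))⟩ hXI
    · obtain ⟨C, hCs, hC⟩ := hdep.exists_isCircuit_subset
      exact hI.2 C ⟨hC, Or.inr (Or.inr (Or.inr ⟨C₁, C₂, x, y, Z, P, ⟨h1, h2, h3, h4, h5, h6⟩, hCs⟩))⟩
        (hCs.trans hXI)
  have hIfin := hfinE.subset hI.1
  have hcard := Graph.ncard_le_of_frameFree (hI.1.trans (Graph.subset_inside_vertsOf Subset.rfl))
    hIfin hU hfree
  have hspan : M.E ⊆ M.closure I := by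
    intro e he
    by_cases heI : e ∈ I
    · exact M.mem_closure_of_mem' heI he
    -- By maximality, every further edge completes a listed circuit with edges of `I`.
    have : ¬ (insert e I ⊆ E(G) ∧ ∀ X, 𝒳 X → ¬ X ⊆ insert e I) := fun hh =>
      heI (hmax hh (subset_insert _ _) (mem_insert _ _))
    have hins : insert e I ⊆ E(G) := insert_subset (hE ▸ he) hI.1
    push Not at this
    obtain ⟨X, hX, hXI⟩ := this hins
    have heX : e ∈ X := by
      by_contra heX
      exact hI.2 X hX ((subset_insert_iff_of_notMem heX).1 hXI)
    refine M.closure_subset_closure ?_ (hX.1.mem_closure_sdiff_singleton_of_mem heX)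
    rintro f ⟨hf, hfe⟩
    exact (hXI hf).resolve_left hfe
  obtain ⟨C, hC⟩ := hu
  have hle := h.le_natRk hU hconn hC hC.1.subset_edgeSet (Graph.vertsOf_mono hC.1.subset_edgeSet)
  have h2 : M.natRk (E(G) ∩ G.inside (G.vertsOf E(G))) ≤ M.natRk I := by
    rw [← natRk_closure I]
    exact natRk_mono (inter_subset_left.trans (hE ▸ hspan))
  exact hD.not_indep ((indep_of_ncard_le_natRk hIfin (hcard.trans (hle.trans h2))).subset hDI)

end IsBiasedGraphicWith

end Matroid

namespace Graph

variable {V α : Type*} {G : Graph V α} {x y z u v w a b c₁ c₂ : V} {e f : α} {S T U X Y Z : Set V}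
  {P Q C D I J H W : Set α} {B : Set (Set α)}

theorem Reach.inside (h : G.Reach P U a b) : G.Reach (P ∩ G.inside U) U a b := by
  induction h with
  | refl => exact .refl
  | tail _ hbc ih =>
    obtain ⟨e, he, hl, h1, h2⟩ := hbc
    exact ih.trans (hl.reach ⟨he, hl.mem_inside h1 h2⟩ h1 h2)

theorem ConnVia.inside (h : G.ConnVia E(G) S) : G.ConnVia (G.inside S) S :=
  fun _ ha _ hb => (h ha hb).inside.mono inter_subset_right Subset.rfl

theorem IsLiftCircuit.mem_or_exists_isUnbalanced (hP : G.IsLiftCircuit B P) :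
    P ∈ B ∨ ∃ C ⊆ P, G.IsUnbalanced B C := by
  rcases hP with h | ⟨P₁, P₂, P₃, h, h', -, -, rfl⟩ | ⟨C₁, C₂, h₁, -, -, -, rfl⟩ |
    ⟨C₁, C₂, h₁, -, -, rfl⟩
  · exact Or.inl h
  · exact Or.inr ⟨_, subset_union_left, h.isCycle₁₂, h'⟩
  · exact Or.inr ⟨_, subset_union_left, h₁⟩
  · exact Or.inr ⟨_, subset_union_left, h₁⟩

/-! ### Sets of edges without pendant edges, components -/

/-- No edge of `D` is pendant. -/
def PendantFree (G : Graph V α) (D : Set α) : Prop :=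
  ∀ e ∈ D, ∀ v w, G.IsLink e v w → v ≠ w → ∃ f ∈ D, f ≠ e ∧ G.Inc f v

/-- The edge of `P` at the free end `y` would be pendant in `D`, so it is not in `D`; the path is
peeled off from that end. -/
theorem PendantFree.subset_of_subset_union (hD : G.PendantFree D) (hDW : D ⊆ W ∪ P)
    (hW : W ⊆ G.inside U) (hP : G.IsPath y x Z P) (hZ : Z ∩ U ⊆ {x}) : D ⊆ W := by
  induction hP with
  | nil => simpa using hDW
  | cons y w x e Z P he hP hy ih =>
    refine ih (fun f hf => ?_) ((inter_subset_inter_left _ (subset_insert _ _)).trans hZ)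
    rcases hDW hf with h | rfl | h
    · exact Or.inl h
    · exfalso
      obtain ⟨g, hg, hgf, hi⟩ := hD f hf y w he fun hh => hy (hh ▸ hP.left_mem)
      rcases hDW hg with h | rfl | h
      · obtain rfl : y = x := hZ ⟨mem_insert _ _, mem_of_mem_inside (hW h) hi⟩
        exact hy hP.right_mem
      · exact hgf rfl
      · exact hy (mem_of_mem_inside (hP.subset_inside h) hi)
    · exact Or.inr h

/-- A pendant-free subset of a loose handcuff contains all of the path or none of it. -/
theorem IsLoose.subset_of_pendantFree {C₁ C₂ : Set α} (h : G.IsLoose B C₁ C₂ x y Z P)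
    (hD : G.PendantFree D) (hDs : D ⊆ C₁ ∪ C₂ ∪ P) : P ⊆ D ∨ D ⊆ C₁ ∪ C₂ := by
  by_cases hPD : P ⊆ D
  · exact Or.inl hPD
  right
  obtain ⟨e, he, heD⟩ := not_subset.1 hPD
  obtain ⟨hC₁, hC₂, hdisj, hP, h1, h2⟩ := h
  -- An edge missing from `D` cuts `P` into two paths, each attached at one end only, and neither
  -- has an edge in `D`.
  obtain ⟨s, t, Z₁, P₁, Z₂, P₂, k1, -, k3, k4, rfl, rfl, -, -⟩ := hP.splitEdge he
  have hC : C₁ ∪ C₂ ⊆ G.inside (G.vertsOf C₁ ∪ G.vertsOf C₂) := union_subset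
    (hC₁.1.subset_inside.trans (inside_mono subset_union_left))
    (hC₂.1.subset_inside.trans (inside_mono subset_union_right))
  refine hD.subset_of_subset_union (hD.subset_of_subset_union (W := C₁ ∪ C₂ ∪ P₂)
    (U := G.vertsOf C₁ ∪ G.vertsOf C₂ ∪ Z₂) ?_ ?_ k1.reverse ?_) hC k3 ?_
  · intro f hf
    rcases hDs hf with hf' | rfl | hf' | hf'
    exacts [Or.inl (Or.inl hf'), absurd hf heD, Or.inr hf', Or.inl (Or.inr hf')]
  · exact union_subset (hC.trans (inside_mono subset_union_left))
      (k3.subset_inside.trans (inside_mono subset_union_right))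
  · rintro r ⟨hr, (hr' | hr') | hr'⟩
    · exact h1.subset ⟨Or.inl hr, hr'⟩
    · obtain rfl : r = y := h2.subset ⟨Or.inl hr, hr'⟩
      exact absurd k3.right_mem (disjoint_left.1 k4 hr)
    · exact absurd hr' (disjoint_left.1 k4 hr)
  · rintro r ⟨hr, hr' | hr'⟩
    · obtain rfl : r = x := h1.subset ⟨Or.inr hr, hr'⟩
      exact absurd hr (disjoint_left.1 k4 k1.left_mem)
    · exact h2.subset ⟨Or.inr hr, hr'⟩

theorem IsCycle.pendantFree (h : G.IsCycle C) : G.PendantFree C :=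
  fun _ he _ _ hl hvw => h.exists_ne_inc he hl hvw

theorem encard_components_edgeInduce_le
    (h : ∀ v ∈ G.vertsOf D, G.Reach D univ v c₁ ∨ G.Reach D univ v c₂) :
    (G.edgeInduce D).components.encard ≤ 2 := by
  have hadj : ∀ {a b}, G.Reach D univ a b → Relation.ReflTransGen (G.edgeInduce D).Adj a b := by
    intro a b hab
    induction hab with
    | refl => exact .refl
    | tail _ hbc ih =>
      obtain ⟨e, he, hl, -, -⟩ := hbc
      exact ih.tail ⟨e, ⟨⟨he, hl⟩, hl.left_mem_vertsOf he, hl.right_mem_vertsOf he⟩⟩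
  have hset : ∀ {a b}, G.Reach D univ a b → {y | Relation.ReflTransGen (G.edgeInduce D).Adj a y} =
      {y | Relation.ReflTransGen (G.edgeInduce D).Adj b y} := by
    intro a b hab
    ext y
    exact ⟨fun h => (hadj hab.symm).trans h, fun h => (hadj hab).trans h⟩
  have hsub : (G.edgeInduce D).components ⊆
      {(G.edgeInduce D).induce {y | Relation.ReflTransGen (G.edgeInduce D).Adj c₁ y},
        (G.edgeInduce D).induce {y | Relation.ReflTransGen (G.edgeInduce D).Adj c₂ y}} := by
    rintro H ⟨x, hx, rfl⟩
    rcases h x hx with h | h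
    · rw [hset h]
      exact mem_insert _ _
    · rw [hset h]
      exact mem_insert_of_mem _ rfl
  exact (encard_le_encard hsub).trans (by
    refine (encard_insert_le _ _).trans ?_
    rw [encard_singleton]
    norm_num)

theorem IsCycle.encard_components_le (h : G.IsCycle C) :
    (G.edgeInduce C).components.encard ≤ 2 := by
  obtain ⟨c, hc⟩ := h.vertsOf_nonempty
  exact encard_components_edgeInduce_le (c₁ := c) (c₂ := c) fun v hv =>
    Or.inl ((h.connVia hv hc).mono Subset.rfl (subset_univ _))

/-- The set of vertices that can be reached from `w` after deleting `z`. -/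
def compAt (G : Graph V α) (z w : V) : Set V :=
  {u | G.Reach E(G) (G.vertsOf E(G) \ {z}) w u}

/-- `z` separates some edge of `G` from `w`. -/
structure IsJoint (G : Graph V α) (z w : V) : Prop where
  left_mem : z ∈ G.vertsOf E(G)
  right_mem : w ∈ G.vertsOf E(G)
  ne : w ≠ z
  nonempty : (G.inside (G.vertsOf E(G) \ G.compAt z w)).Nonempty

theorem mem_compAt_self : w ∈ G.compAt z w := Reach.refl

theorem compAt_subset (hw : w ∈ G.vertsOf E(G)) (hwz : w ≠ z) :
    G.compAt z w ⊆ G.vertsOf E(G) \ {z} := fun _ hu => Reach.mem hu ⟨hw, hwz⟩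

theorem mem_compAt_of_isLink (he : G.IsLink e u v) (hu : u ∈ G.compAt z w) (huz : u ≠ z)
    (hvz : v ≠ z) : v ∈ G.compAt z w :=
  Reach.trans hu (he.reach he.edge_mem ⟨he.left_mem_vertsOf he.edge_mem, huz⟩
    ⟨he.right_mem_vertsOf he.edge_mem, hvz⟩)

theorem connVia_reach_set : G.ConnVia P {u | G.Reach P U w u} := by
  refine .of_reach_left (a := w) fun b hb => ?_
  have hb : G.Reach P U w b := hb
  induction hb with
  | refl => exact .refl
  | tail h1 hbc ih =>
    obtain ⟨e, he, hl, h2, h3⟩ := hbc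
    exact (ih h1).trans (hl.reach he h1 (h1.trans (hl.reach he h2 h3)))

theorem connVia_compAt : G.ConnVia E(G) (G.compAt z w) := connVia_reach_set

/-- The component can be left only through `z`. Hence an edge at a vertex `u ≠ z` outside of it has
both ends outside, which makes `z` a joint. -/
theorem compAt_eq_of_not_isJoint (hj : ¬ G.IsJoint z w) (hz : z ∈ G.vertsOf E(G))
    (hw : w ∈ G.vertsOf E(G)) (hwz : w ≠ z) : G.compAt z w = G.vertsOf E(G) \ {z} := by
  refine (compAt_subset hw hwz).antisymm ?_
  rintro u ⟨⟨e, he, u', hl⟩, huz⟩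
  by_contra hu
  refine hj ⟨hz, hw, hwz, e, hl.mem_inside ⟨hl.left_mem_vertsOf he, hu⟩
    ⟨hl.right_mem_vertsOf he, fun hu' => hu ?_⟩⟩
  exact mem_compAt_of_isLink hl.symm hu' (compAt_subset hw hwz hu').2 huz

end Graph

/-! ### Frameworks: graphs without unbalanced cycles or without joints -/

namespace Matroid

variable {V α : Type*} {M : Matroid α} {G : Graph V α} {x y u v w : V} {e f : α} {S T U Z : Set V}
  {C D I J P X Y K : Set α}

namespace IsBiasedGraphicWith

variable (h : M.IsBiasedGraphicWith G)
include h

/-- If every circuit is pendant-free and has at most two components, then `G` is a framework. -/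
theorem isFramework [M.Finite] (hpend : ∀ D, M.IsCircuit D → G.PendantFree D)
    (hcomp : ∀ D, M.IsCircuit D → (G.edgeInduce D).components.encard ≤ 2) : M.IsFramework G := by
  refine ⟨h.finite_vertexSet, h.edgeSet_eq, ?_, ?_, hcomp⟩
  · rintro H ⟨x, hx, rfl⟩
    have hV : {y | Relation.ReflTransGen G.Adj x y} ⊆ V(G) := by
      intro y hy
      induction hy with
      | refl => exact hx
      | tail _ hbc _ => exact hbc.right_mem
    have hfin := h.finite_of_subset_vertexSet hV
    have hE : E(G.induce {y | Relation.ReflTransGen G.Adj x y}) ⊆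
        G.inside {y | Relation.ReflTransGen G.Adj x y} := by
      rintro e ⟨s, t, hl, hs, ht⟩
      exact hl.mem_inside hs ht
    have := h.natRk_le hE hfin
    change _ ≤ {y | Relation.ReflTransGen G.Adj x y}.encard
    rw [← cast_natRk, ← hfin.cast_ncard_eq]
    exact_mod_cast this
  · intro v hv e he
    by_cases hev : e ∈ E(G.deleteVerts {v})
    · exact Or.inl hev
    right
    obtain ⟨D, hDs, hD, heD⟩ := exists_isCircuit_of_mem_closure he hev
    obtain ⟨s, t, hl⟩ := Graph.exists_isLink_of_mem_edgeSet (h.edgeSet_eq ▸ hD.subset_ground heD)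
    -- If `e` were not a loop, the circuit `D` would have a second edge at `v`, but its other edges
    -- belong to `G` minus `v`.
    have key : ∀ w, G.IsLink e v w → G.IsLoopAt e v := by
      intro w hl
      by_contra hloop
      have hvw : v ≠ w := fun hh => hloop (by rw [← hh] at hl; exact hl)
      obtain ⟨f, hf, hfe, hi⟩ := hpend D hD e heD v w hl hvw
      have hf' := (hDs hf).resolve_left hfe
      rw [Graph.edgeSet_deleteVerts] at hf'
      obtain ⟨a, b, hab, ha, hb⟩ := hf'
      rcases hi.eq_or_eq_of_isLink hab with rfl | rfl
      exacts [ha rfl, hb rfl]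
    rw [Graph.edgeSet_deleteVerts] at hev
    by_cases hs : s = v
    · subst hs
      exact key _ hl
    by_cases ht : t = v
    · subst ht
      exact key _ hl.symm
    exact absurd ⟨s, t, hl, hs, ht⟩ hev

/-- A circuit is a balanced cycle or contains an unbalanced cycle. -/
theorem mem_balancedCycles_or_exists (hD : M.IsCircuit D) :
    D ∈ M.balancedCycles G ∨ ∃ C ⊆ D, G.IsUnbalanced (M.balancedCycles G) C := by
  have hli : ¬ G.IsLiftIndep (M.balancedCycles G) D := fun hI =>
    hD.not_indep (h.indep_of_lift _ hI)
  have : ∃ X, G.IsLiftCircuit (M.balancedCycles G) X ∧ X ⊆ D := by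
    by_contra! hcon
    exact hli ⟨h.edgeSet_eq ▸ hD.subset_ground, hcon⟩
  obtain ⟨X, hX, hXD⟩ := this
  rcases hX.mem_or_exists_isUnbalanced with hX | ⟨C, hCX, hC⟩
  · exact Or.inl (hX.1.eq_of_subset_isCircuit hD hXD ▸ hX)
  · exact Or.inr ⟨C, hCX.trans hXD, hC⟩

theorem isFramework_of_balanced [M.Finite]
    (hb : ¬ ∃ C, G.IsUnbalanced (M.balancedCycles G) C) : M.IsFramework G := by
  have : ∀ D, M.IsCircuit D → G.IsCycle D := fun D hD =>
    ((h.mem_balancedCycles_or_exists hD).resolve_right fun ⟨C, _, hC⟩ => hb ⟨C, hC⟩).2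
  exact h.isFramework (fun D hD => (this D hD).pendantFree)
    fun D hD => (this D hD).encard_components_le

/-- A pendant edge at a connected unbalanced set is not spanned by that set. -/
theorem notMem_closure_inside [M.Finite] (hS : S.Finite) (hconn : G.ConnVia E(G) S)
    (hu : G.Unb (M.balancedCycles G) S) (hl : G.IsLink e v w) (hw : w ∈ S) (hv : v ∉ S) :
    e ∉ M.closure (G.inside S) := by
  intro he
  obtain ⟨C, hC, hCS⟩ := hu
  have h1 : G.ConnVia (insert e (G.inside S)) (insert v S) := by
    have hc : G.ConnVia (∅ : Set α) {v} := by
      rintro a rfl b rfl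
      exact .refl
    have := hconn.inside.insert_edge hc hl.symm hw rfl
    rwa [union_empty, union_singleton] at this
  have h2 := h.le_natRk (hS.insert v) h1 hC
    ((hC.1.subset_inside.trans (Graph.inside_mono hCS)).trans (subset_insert _ _))
    (hCS.trans (subset_insert _ _))
  -- Adding `e` reaches the new vertex `v`, so the rank rises from at most `|S|` to at least `|S| +
  -- 1`.
  have h3 := h2.trans (natRk_mono inter_subset_left)
  rw [natRk_insert_of_mem_closure he, ncard_insert_of_notMem hv hS] at h3
  have := h.natRk_le (Subset.refl (G.inside S)) hS
  omega

/-- Opening one cycle of a loose handcuff leaves a lift-independent set, so no circuit in the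
handcuff omits an edge of a cycle. -/
theorem subset_of_isLoose {C₁ C₂ : Set α} (hL : G.IsLoose (M.balancedCycles G) C₁ C₂ x y Z P)
    (hD : M.IsCircuit D) (hDs : D ⊆ C₁ ∪ C₂ ∪ P) : C₁ ⊆ D := by
  intro e he
  by_contra heD
  refine hD.not_indep ((h.indep_of_lift _ (hL.isLiftIndep isCycle_of_mem_balancedCycles he)).subset
    fun f hf => ?_)
  rcases hDs hf with (hf' | hf') | hf'
  · exact Or.inr ⟨hf', fun hh => heD (hh ▸ hf)⟩
  · exact Or.inl (Or.inl hf')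
  · exact Or.inl (Or.inr hf')

/-- Suppose that `e` is pendant at `v` in a circuit `D`. Without joints, the vertices other than `v`
stay connected. They also carry an unbalanced cycle in `D`, since a cycle cannot use the pendant
edge. But `D` without `e` lies inside them and spans `e`, against `notMem_closure_inside`. So
circuits are pendant-free, and one in a loose handcuff takes all of the path or none of it: it has
one or two components. -/
theorem isFramework_of_no_joint [M.Finite] (hconn : G.ConnVia E(G) (G.vertsOf E(G)))
    (hu : ∃ C, G.IsUnbalanced (M.balancedCycles G) C) (hj : ∀ z w, ¬ G.IsJoint z w) :
    M.IsFramework G := by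
  have hpend : ∀ D, M.IsCircuit D → G.PendantFree D := by
    intro D hD e he v w hl hvw
    rcases h.mem_balancedCycles_or_exists hD with hDB | ⟨C, hCD, hC⟩
    · exact hDB.2.exists_ne_inc he hl hvw
    by_contra! hcon
    have hv := hl.left_mem_vertsOf hl.edge_mem
    have hw := hl.right_mem_vertsOf hl.edge_mem
    have hK := Graph.compAt_eq_of_not_isJoint (hj v w) hv hw (Ne.symm hvw)
    have hKc := Graph.connVia_compAt (G := G) (z := v) (w := w)
    rw [hK] at hKc
    have hDE : D ⊆ E(G) := h.edgeSet_eq ▸ hD.subset_ground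
    have hDK : D \ {e} ⊆ G.inside (G.vertsOf E(G) \ {v}) := by
      rintro f ⟨hf, hfe⟩
      obtain ⟨s, t, hst⟩ := Graph.exists_isLink_of_mem_edgeSet (hDE hf)
      refine hst.mem_inside ⟨hst.left_mem_vertsOf (hDE hf), ?_⟩
        ⟨hst.right_mem_vertsOf (hDE hf), ?_⟩
      · rintro rfl
        exact hcon f hf hfe hst.inc_left
      · rintro rfl
        exact hcon f hf hfe hst.inc_right
    have heC : e ∉ C := by
      intro heC
      obtain ⟨f, hf, hfe, hi⟩ := hC.1.exists_ne_inc heC hl hvw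
      exact hcon f (hCD hf) hfe hi
    refine h.notMem_closure_inside ?_ hKc ⟨C, hC, ?_⟩ hl ⟨hw, Ne.symm hvw⟩ (by simp)
      (M.closure_subset_closure hDK (hD.mem_closure_sdiff_singleton_of_mem he))
    · exact h.finite_of_subset_vertexSet (sdiff_subset.trans Graph.vertsOf_subset_vertexSet)
    · exact Graph.vertsOf_subset_of_subset_inside ((subset_sdiff_singleton hCD heC).trans hDK)
  refine h.isFramework hpend fun D hD => ?_
  have hcyc : ∀ {C}, G.IsCycle C → C ⊆ D → ∀ v ∈ G.vertsOf C, ∀ c ∈ G.vertsOf C,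
      G.Reach D univ v c := fun hC hCD v hv c hc => (hC.connVia hv hc).mono hCD (subset_univ _)
  rcases h.isCircuit_cases hconn hu hD with hDB | ⟨P₁, P₂, P₃, hth, -, -, -, rfl⟩ |
    ⟨C₁, C₂, h₁, h₂, -, -, rfl⟩ | ⟨C₁, C₂, x, y, Z, P, hL, hDs⟩
  · exact hDB.2.encard_components_le
  · obtain ⟨c, hc⟩ := Graph.vertsOf_nonempty
      (subset_union_left.trans hth.isCycle₁₂.subset_edgeSet) hth.nonempty₁
    refine Graph.encard_components_edgeInduce_le (c₁ := c) (c₂ := c) fun v hv => Or.inl ?_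
    rw [Graph.vertsOf_union] at hv
    rcases hv with hv | hv
    · exact hcyc hth.isCycle₁₂ subset_union_left v hv c (Graph.vertsOf_mono subset_union_left hc)
    · refine hcyc hth.perm₁₃₂.isCycle₁₂ (union_subset_union_left _ subset_union_left) v ?_ c
        (Graph.vertsOf_mono subset_union_left hc)
      exact Graph.vertsOf_mono subset_union_right hv
  · obtain ⟨c₁, hc₁⟩ := h₁.1.vertsOf_nonempty
    obtain ⟨c₂, hc₂⟩ := h₂.1.vertsOf_nonempty
    refine Graph.encard_components_edgeInduce_le (c₁ := c₁) (c₂ := c₂) fun v hv => ?_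
    rw [Graph.vertsOf_union] at hv
    rcases hv with hv | hv
    exacts [Or.inl (hcyc h₁.1 subset_union_left v hv c₁ hc₁),
      Or.inr (hcyc h₂.1 subset_union_right v hv c₂ hc₂)]
  · have h₁ := h.subset_of_isLoose hL hD hDs
    have h₂ := h.subset_of_isLoose hL.symm hD (by rwa [union_comm C₂ C₁])
    refine Graph.encard_components_edgeInduce_le (c₁ := x) (c₂ := y) fun v hv => ?_
    have hv12 : v ∈ G.vertsOf (C₁ ∪ C₂) → G.Reach D univ v x ∨ G.Reach D univ v y := by
      rw [Graph.vertsOf_union]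
      rintro (hv | hv)
      exacts [Or.inl (hcyc hL.unb₁.1 h₁ v hv x hL.mem_left),
        Or.inr (hcyc hL.unb₂.1 h₂ v hv y hL.symm.mem_left)]
    rcases hL.subset_of_pendantFree (hpend D hD) hDs with hPD | hDC
    · have := Graph.vertsOf_mono hDs hv
      rw [Graph.vertsOf_union] at this
      rcases this with hv' | hv'
      · exact hv12 hv'
      · exact Or.inl ((hL.isPath.reach (hL.isPath.vertsOf_subset hv') hL.isPath.left_mem).mono hPD
          (subset_univ _))
    · exact hv12 (Graph.vertsOf_mono hDC hv)

end IsBiasedGraphicWith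

end Matroid

/-! ### Joints and the blocks that contain them -/

namespace Graph

variable {V α : Type*} {G : Graph V α} {x y z u v w a b c₁ c₂ : V} {e f : α} {S T U X Y Z : Set V}
  {P Q C D I J H W : Set α} {B : Set (Set α)}

/-- Deleting from a connected set one of the components of the complement of a connected subset
leaves a connected set. -/
theorem ConnVia.sdiff_reach_set (hU : G.ConnVia P U) (hS : G.ConnVia P S) (hSU : S ⊆ U)
    (hne : S.Nonempty) (hyU : y ∈ U) (hyS : y ∉ S) :
    G.ConnVia P (U \ {u | G.Reach P (U \ S) y u}) := by
  obtain ⟨s₀, hs₀⟩ := hne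
  set T := {u | G.Reach P (U \ S) y u} with hT
  have hTsub : T ⊆ U \ S := fun u hu => Reach.mem hu ⟨hyU, hyS⟩
  have hST : S ⊆ U \ T := fun s hs => ⟨hSU hs, fun h => (hTsub h).2 hs⟩
  refine .of_reach_left (a := s₀) fun u hu => ?_
  by_contra hcon
  -- A walk in `U` from `S` to `u` would have to leave the union of `T` and the part reached outside
  -- `T`. No edge does so, because `T` can be left only into `S`.
  obtain ⟨e, he, s, t, hl, hs, ht, hsU, htU⟩ :=
    (hU (hSU hs₀) hu.1).exists_exit (S := {r | r ∈ U \ T ∧ G.Reach P (U \ T) s₀ r} ∪ T)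
      (Or.inl ⟨hST hs₀, .refl⟩) (by rintro (h | h); exacts [hcon h.2, hu.2 h])
  have htT : t ∉ T := fun h => ht (Or.inr h)
  rcases hs with hs | hs
  · exact ht (Or.inl ⟨⟨htU, htT⟩, hs.2.trans (hl.reach he hs.1 ⟨htU, htT⟩)⟩)
  · have htS : t ∉ S := fun h => ht (Or.inl ⟨hST h, (hS hs₀ h).mono Subset.rfl hST⟩)
    exact htT (Reach.trans hs (hl.reach he (hTsub hs) ⟨htU, htS⟩))

theorem compAt_eq_of_mem (hu : u ∈ G.compAt z w) : G.compAt z u = G.compAt z w := by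
  ext t
  exact ⟨fun h => Reach.trans hu h, fun h => Reach.trans (Reach.symm hu) h⟩

/-- No vertex other than `a` and `b` separates `a` from `b`. -/
def Insep (G : Graph V α) (a b : V) : Prop :=
  ∀ v, v ≠ a → v ≠ b → G.Reach E(G) (G.vertsOf E(G) \ {v}) a b

theorem IsJoint.of_mem (hj : G.IsJoint z w) (hu : u ∈ G.compAt z w) : G.IsJoint z u := by
  have := compAt_subset hj.right_mem hj.ne hu
  exact ⟨hj.left_mem, this.1, this.2, by rw [compAt_eq_of_mem hu]; exact hj.nonempty⟩

theorem exists_isLink_compAt (hconn : G.ConnVia E(G) (G.vertsOf E(G))) (hz : z ∈ G.vertsOf E(G))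
    (hw : w ∈ G.vertsOf E(G)) (hwz : w ≠ z) : ∃ e, ∃ s ∈ G.compAt z w, G.IsLink e s z := by
  have hz' : z ∉ G.compAt z w := fun hh => (compAt_subset hw hwz hh).2 rfl
  obtain ⟨e, he, s, t, hl, hs, ht, hsU, htU⟩ :=
    (hconn hw hz).exists_exit (S := G.compAt z w) mem_compAt_self hz'
  have : t = z := by
    by_contra htz
    exact ht (mem_compAt_of_isLink hl hs (compAt_subset hw hwz hs).2 htz)
  exact ⟨e, s, hs, this ▸ hl⟩

/-- Every nonloop edge shares a block with some joint. -/
theorem exists_isJoint_insep (hfin : (G.vertsOf E(G)).Finite)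
    (hconn : G.ConnVia E(G) (G.vertsOf E(G))) (hj : ∃ z w, G.IsJoint z w) (he : G.IsLink e x y)
    (hxy : x ≠ y) :
    ∃ z w, G.IsJoint z w ∧ (w = x ∨ w = y) ∧ G.Insep x z ∧ G.Insep y z := by
  have hx := he.left_mem_vertsOf he.edge_mem
  have hy := he.right_mem_vertsOf he.edge_mem
  -- Any joint `z` will do, with `w` an end of the edge other than `z`. If `w` is not in the
  -- component of the given `w₀`, then an edge from that component to `z` is separated from `w`.
  have hne : ∃ p : V × V, G.IsJoint p.1 p.2 ∧ (p.2 = x ∨ p.2 = y) := by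
    obtain ⟨z, w₀, hj⟩ := hj
    obtain ⟨w, hw, hwz⟩ : ∃ w, (w = x ∨ w = y) ∧ w ≠ z := by
      by_cases hxz : x = z
      · exact ⟨y, Or.inr rfl, fun h => hxy (hxz.trans h.symm)⟩
      · exact ⟨x, Or.inl rfl, hxz⟩
    have hwU : w ∈ G.vertsOf E(G) := by
      rcases hw with rfl | rfl <;> assumption
    refine ⟨(z, w), ?_, hw⟩
    by_cases hmem : w ∈ G.compAt z w₀
    · exact hj.of_mem hmem
    obtain ⟨g, s, hs, hl⟩ := exists_isLink_compAt hconn hj.left_mem hj.right_mem hj.ne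
    refine ⟨hj.left_mem, hwU, hwz, g, hl.mem_inside
      ⟨hl.left_mem_vertsOf hl.edge_mem, fun hh => ?_⟩ ⟨hj.left_mem, fun hh => ?_⟩⟩
    · exact hmem (Reach.trans hs (Reach.symm hh))
    · exact (compAt_subset hwU hwz hh).2 rfl
  -- Take a joint with smallest component at the edge. If some `v` separated an end `s` of the edge
  -- from `z`, then `v` would be a joint with a strictly smaller component at `s`.
  obtain ⟨⟨z, w⟩, ⟨hj, hw⟩, hmin⟩ : ∃ p : V × V, (G.IsJoint p.1 p.2 ∧ (p.2 = x ∨ p.2 = y)) ∧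
      ∀ q : V × V, G.IsJoint q.1 q.2 ∧ (q.2 = x ∨ q.2 = y) →
        (G.compAt p.1 p.2).ncard ≤ (G.compAt q.1 q.2).ncard := by
    classical
    obtain ⟨p, hp⟩ := hne
    obtain ⟨q, hq, hqmin⟩ := WellFounded.has_min
      (measure fun p : V × V => (G.compAt p.1 p.2).ncard).wf
      {p | G.IsJoint p.1 p.2 ∧ (p.2 = x ∨ p.2 = y)} ⟨p, hp⟩
    exact ⟨q, hq, fun r hr => not_lt.1 (hqmin r hr)⟩
  have hwU := hj.right_mem
  have hKU := compAt_subset hwU hj.ne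
  have key : ∀ s, (s = x ∨ s = y) → G.Insep s z := by
    intro s hs v hvs hvz
    by_contra hsep
    have hsz : s ≠ z := by
      rintro rfl
      exact hsep .refl
    have hsU : s ∈ G.vertsOf E(G) := by rcases hs with rfl | rfl <;> assumption
    have hvU : v ∈ G.vertsOf E(G) := by
      by_contra hv
      rw [sdiff_singleton_eq_self hv] at hsep
      exact hsep (hconn hsU hj.left_mem)
    have hsK : s ∈ G.compAt z w := by
      have hlws : w = s ∨ G.IsLink e w s := by
        rcases hs with rfl | rfl <;> rcases hw with rfl | rfl
        exacts [Or.inl rfl, Or.inr he.symm, Or.inr he, Or.inl rfl]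
      rcases hlws with rfl | hlws
      · exact mem_compAt_self
      · exact mem_compAt_of_isLink hlws mem_compAt_self hj.ne hsz
    have hzv : z ∉ G.compAt v s := hsep
    have hsubU := compAt_subset hsU hvs.symm
    have hsub : G.compAt v s ⊆ G.compAt z w := by
      intro u hu
      refine Reach.trans hsK ((connVia_compAt (G := G) (z := v) (w := s) mem_compAt_self hu).mono
        Subset.rfl ?_)
      exact fun r hr => ⟨(hsubU hr).1, fun hrz => hzv (hrz ▸ hr)⟩
    -- Otherwise `s` reaches `z` through its component without meeting `v`.
    have hvK : v ∈ G.compAt z w := by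
      by_contra hvK
      obtain ⟨g, p, hp, hl⟩ := exists_isLink_compAt hconn hj.left_mem hsU hsz
      rw [compAt_eq_of_mem hsK] at hp
      refine hsep (((connVia_compAt (G := G) (z := z) (w := w) hsK hp).mono Subset.rfl ?_).trans
        (hl.reach hl.edge_mem ⟨hl.left_mem_vertsOf hl.edge_mem, ?_⟩ ⟨hj.left_mem, hvz.symm⟩))
      · exact fun r hr => ⟨(hKU hr).1, fun hrv => hvK (hrv ▸ hr)⟩
      · exact fun hrv => hvK (hrv ▸ hp)
    have hjv : G.IsJoint v s := ⟨hvU, hsU, hvs.symm,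
      hj.nonempty.mono (inside_mono (sdiff_subset_sdiff_right hsub))⟩
    have hlt : (G.compAt v s).ncard < (G.compAt z w).ncard := by
      refine ncard_lt_ncard ⟨hsub, fun hh => (hsubU (hh hvK)).2 rfl⟩ ?_
      exact hfin.subset (hKU.trans sdiff_subset)
    exact absurd (hmin (v, s) ⟨hjv, hs⟩) (not_le.2 hlt)
  exact ⟨z, w, hj, hw, key x (Or.inl rfl), key y (Or.inr rfl)⟩

end Graph

/-! ### Skewness of two vertex sets and the type of an edge -/

namespace Matroid

variable {V α : Type*} {M : Matroid α} {G : Graph V α} {x y z u v w : V} {e f : α}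
  {S T S' T' U Z : Set V} {C D I J P X Y K : Set α}

/-- A circuit is not spread over two skew sets. -/
theorem IsCircuit.subset_or_subset [M.Finite] (hD : M.IsCircuit D) (hDXY : D ⊆ X ∪ Y)
    (hd : Disjoint X Y) (hr : M.natRk X + M.natRk Y ≤ M.natRk (X ∪ Y)) : D ⊆ X ∨ D ⊆ Y := by
  by_contra! hcon
  obtain ⟨hX, hY⟩ := hcon
  have hDX : M.Indep (D ∩ X) := hD.ssubset_indep
    ⟨inter_subset_left, fun hh => hX (hh.trans inter_subset_right)⟩
  have hDY : M.Indep (D ∩ Y) := hD.ssubset_indep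
    ⟨inter_subset_left, fun hh => hY (hh.trans inter_subset_right)⟩
  -- Both parts of `D` are independent. Submodularity, applied twice, shows that skewness forces the
  -- rank of `D` up to `|D|`, impossible for a circuit.
  have h1 := natRk_inter_add_union_le (M := M) (X ∪ D ∩ Y) Y
  have h1' : M.natRk (D ∩ Y) ≤ M.natRk ((X ∪ D ∩ Y) ∩ Y) :=
    natRk_mono (subset_inter subset_union_right inter_subset_right)
  have h1'' : M.natRk (X ∪ Y) ≤ M.natRk (X ∪ D ∩ Y ∪ Y) :=
    natRk_mono (union_subset_union_left _ subset_union_left)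
  have h2 := natRk_inter_add_union_le (M := M) D X
  have h2' : M.natRk (D ∪ X) = M.natRk (X ∪ D ∩ Y) := by
    congr 1
    ext f
    have := @hDXY f
    simp only [mem_union, mem_inter_iff] at *
    tauto
  rw [hDX.natRk_eq] at h2
  rw [hDY.natRk_eq] at h1'
  have hlt := hD.dep.natRk_lt
  have hfin := M.set_finite D hD.subset_ground
  have hcard := ncard_inter_add_ncard_sdiff_eq_ncard D X hfin
  have hsd : D \ X = D ∩ Y := by
    ext f
    have h3 := @hDXY f
    have h4 := @disjoint_left.1 hd f
    simp only [mem_sdiff, mem_inter_iff, mem_union] at *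
    tauto
  rw [hsd] at hcard
  omega

/-- The edges inside `S` and the edges inside `T` are not skew, provided that `S` and `T` are
connected and unbalanced. -/
def Sep (M : Matroid α) (G : Graph V α) (S T : Set V) : Prop :=
  M.natRk (G.inside S ∪ G.inside T) < S.ncard + T.ncard

theorem Sep.symm (h : M.Sep G S T) : M.Sep G T S := by
  unfold Sep at *
  rw [union_comm, add_comm]
  exact h

theorem sep_comm : M.Sep G S T ↔ M.Sep G T S := ⟨Sep.symm, Sep.symm⟩

/-- The edges that lie in a lift-type block of the biased graphic matroid `M`. -/
def IsLiftEdge (M : Matroid α) (G : Graph V α) (e : α) : Prop :=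
  ∃ x w z, G.IsLink e x w ∧ x ≠ w ∧ G.Insep x z ∧ G.Insep w z ∧ G.IsJoint z w ∧
    G.Unb (M.balancedCycles G) (G.compAt z w) ∧
    M.Sep G (G.vertsOf E(G) \ G.compAt z w) (G.compAt z w)

/-- If one edge of a cycle lies in a lift-type block, then all of its edges do. -/
theorem IsLiftEdge.of_isCycle (he : M.IsLiftEdge G e) (hC : G.IsCycle C) (heC : e ∈ C)
    (hfC : f ∈ C) : M.IsLiftEdge G f := by
  obtain ⟨x, w, z, hl, hxw, hxz, hwz, hj, hK, hsep⟩ := he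
  have hCU : G.vertsOf C ⊆ G.vertsOf E(G) := Graph.vertsOf_mono hC.subset_edgeSet
  have hxC := hl.left_mem_vertsOf heC
  have hwC := hl.right_mem_vertsOf heC
  have hreach : ∀ {v s t}, s ∈ G.vertsOf C → t ∈ G.vertsOf C → s ≠ v → t ≠ v →
      G.Reach E(G) (G.vertsOf E(G) \ {v}) s t := fun hs ht hsv htv =>
    (hC.reach_sdiff hs ht hsv htv).mono hC.subset_edgeSet (sdiff_subset_sdiff_left hCU)
  -- A cycle stays connected when a vertex `v` is deleted, so `t` still reaches one of `x` and `w`,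
  -- and from there `z`.
  have hins : ∀ t ∈ G.vertsOf C, G.Insep t z := by
    intro t ht v hvt hvz
    by_cases hvx : v = x
    · have hvw : v ≠ w := fun h => hxw (hvx.symm.trans h)
      exact (hreach ht hwC hvt.symm hvw.symm).trans (hwz v hvw hvz)
    · exact (hreach ht hxC hvt.symm (Ne.symm hvx)).trans (hxz v hvx hvz)
  obtain ⟨s, t, hst⟩ := Graph.exists_isLink_of_mem_edgeSet (hC.subset_edgeSet hfC)
  have hne : s ≠ t := by
    rintro rfl
    have := hC.eq_of_subset (Graph.isCycle_loop hst) (by simpa using hfC)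
    rw [← this] at heC
    obtain rfl : e = f := heC
    rcases hl.eq_and_eq_or_eq_and_eq hst with ⟨rfl, rfl⟩ | ⟨rfl, rfl⟩ <;> exact hxw rfl
  -- The joint `z` and its component are kept; only the representative `w` moves, to an end of `f`
  -- other than `z`.
  have key : ∀ s t, G.IsLink f s t → s ≠ t → t ≠ z → M.IsLiftEdge G f := by
    intro s t hst hne htz
    have hs := hst.left_mem_vertsOf hfC
    have ht := hst.right_mem_vertsOf hfC
    have htK : t ∈ G.compAt z w := hreach hwC ht hj.ne htz
    refine ⟨s, t, z, hst, hne, hins s hs, hins t ht, hj.of_mem htK, ?_⟩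
    rw [Graph.compAt_eq_of_mem htK]
    exact ⟨hK, hsep⟩
  by_cases htz : t = z
  · exact key t s hst.symm hne.symm fun h => hne (h.trans htz.symm)
  · exact key s t hst hne htz

namespace IsBiasedGraphicWith

variable (h : M.IsBiasedGraphicWith G)
include h

theorem finite_vertsOf : (G.vertsOf E(G)).Finite :=
  h.finite_of_subset_vertexSet Graph.vertsOf_subset_vertexSet

/-- The edge joins `S` and `T` into one connected set, for which a single unbalanced cycle is enough
to give full rank. -/
theorem le_natRk_insert [M.Finite] (hS : S.Finite) (hT : T.Finite) (hd : Disjoint S T)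
    (hSc : G.ConnVia E(G) S) (hTc : G.ConnVia E(G) T) (hSu : G.Unb (M.balancedCycles G) S)
    (he : G.IsLink e x y) (hx : x ∈ S) (hy : y ∈ T) :
    S.ncard + T.ncard ≤ M.natRk (insert e (G.inside S ∪ G.inside T)) := by
  obtain ⟨C, hC, hCS⟩ := hSu
  rw [← ncard_union_eq hd hS hT]
  refine (h.le_natRk (hS.union hT) (hSc.inside.insert_edge hTc.inside he hx hy) hC ?_
    (hCS.trans subset_union_left)).trans (natRk_mono inter_subset_left)
  exact ((hC.1.subset_inside.trans (Graph.inside_mono hCS)).trans subset_union_left).trans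
    (subset_insert _ _)

/-- All four insides have full rank, so submodularity carries a rank defect from the small pair to
the large one. Conversely, if the small pair has no defect, its insides already span `e`. Then so do
the large ones, and adding `e` to these gives rank `|S'| + |T'|`. -/
theorem sep_mono [M.Finite] (hS' : S'.Finite) (hT' : T'.Finite) (hd : Disjoint S' T') (hS : S ⊆ S')
    (hT : T ⊆ T') (hSc : G.ConnVia E(G) S) (hTc : G.ConnVia E(G) T) (hSc' : G.ConnVia E(G) S')
    (hTc' : G.ConnVia E(G) T') (hSu : G.Unb (M.balancedCycles G) S)
    (hTu : G.Unb (M.balancedCycles G) T) (he : G.IsLink e x y) (hx : x ∈ S) (hy : y ∈ T) :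
    M.Sep G S T ↔ M.Sep G S' T' := by
  have hSf := hS'.subset hS
  have hTf := hT'.subset hT
  constructor
  · intro hsep
    unfold Sep at *
    have r1 := h.natRk_inside hSf hSc hSu
    have r2 := h.natRk_inside hTf hTc hTu
    have r3 := h.natRk_inside hS' hSc' (hSu.mono hS)
    have r4 := h.natRk_inside hT' hTc' (hTu.mono hT)
    have m1 := natRk_inter_add_union_le (M := M) (G.inside S ∪ G.inside T) (G.inside S')
    have m1' : M.natRk (G.inside S) ≤ M.natRk ((G.inside S ∪ G.inside T) ∩ G.inside S') :=
      natRk_mono (subset_inter subset_union_left (Graph.inside_mono hS))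
    have m1'' : M.natRk (G.inside S' ∪ G.inside T) ≤
        M.natRk (G.inside S ∪ G.inside T ∪ G.inside S') :=
      natRk_mono (union_subset subset_union_right (subset_union_right.trans subset_union_left))
    have m2 := natRk_inter_add_union_le (M := M) (G.inside S' ∪ G.inside T) (G.inside T')
    have m2' : M.natRk (G.inside T) ≤ M.natRk ((G.inside S' ∪ G.inside T) ∩ G.inside T') :=
      natRk_mono (subset_inter subset_union_right (Graph.inside_mono hT))
    have m2'' : M.natRk (G.inside S' ∪ G.inside T') ≤
        M.natRk (G.inside S' ∪ G.inside T ∪ G.inside T') :=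
      natRk_mono (union_subset_union_left _ subset_union_left)
    omega
  · intro hsep
    by_contra hcon
    unfold Sep at *
    have hcl : e ∈ M.closure (G.inside S ∪ G.inside T) := by
      refine mem_closure_of_natRk_insert_le (h.edgeSet_eq ▸ he.edge_mem) ?_
      refine le_trans (h.natRk_le (S := S ∪ T) ?_ (hSf.union hTf)) ?_
      · exact insert_subset (he.mem_inside (Or.inl hx) (Or.inr hy)) (union_subset
          (Graph.inside_mono subset_union_left) (Graph.inside_mono subset_union_right))
      · rw [ncard_union_eq (hd.mono hS hT) hSf hTf]
        exact not_lt.1 hcon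
    have hcl' := M.closure_subset_closure
      (union_subset_union (Graph.inside_mono hS) (Graph.inside_mono hT)) hcl
    have := h.le_natRk_insert hS' hT' hd hSc' hTc' (hSu.mono hS) he (hS hx) (hT hy)
    rw [natRk_insert_of_mem_closure hcl'] at this
    omega

section Connected

variable [M.Finite] (hconn : G.ConnVia E(G) (G.vertsOf E(G)))
  (hu : ∃ C, G.IsUnbalanced (M.balancedCycles G) C) (hM : M.IsConnected)
include hconn hu hM

/-- In a connected matroid both sides of a joint are unbalanced. -/
theorem unb_of_isJoint (hj : G.IsJoint z w) :
    G.Unb (M.balancedCycles G) (G.vertsOf E(G) \ G.compAt z w) := by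
  by_contra hR
  set K := G.compAt z w
  set U := G.vertsOf E(G)
  have hUf : U.Finite := h.finite_vertsOf
  have hKU : K ⊆ U \ {z} := Graph.compAt_subset hj.right_mem hj.ne
  have hzR : z ∈ U \ K := ⟨hj.left_mem, fun hh => (hKU hh).2 rfl⟩
  have hRf : (U \ K).Finite := hUf.subset sdiff_subset
  have hKf : K.Finite := hUf.subset (hKU.trans sdiff_subset)
  -- All cycles inside `U \ K` are balanced, that is, circuits, so an independent set there is a
  -- forest.
  have h1 : M.natRk (G.inside (U \ K)) < (U \ K).ncard := by
    obtain ⟨I, hI, hind, hcard⟩ := M.exists_indep_ncard_eq_natRk (G.inside (U \ K))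
    rw [← hcard]
    refine Graph.ncard_lt_of_acyclic hI hind.finite hRf ⟨z, hzR⟩ fun C hC hCI => hR ⟨C, ⟨hC, ?_⟩, ?_⟩
    · exact fun hCB => hCB.1.not_indep (hind.subset hCI)
    · exact Graph.vertsOf_subset_of_subset_inside (hCI.trans hI)
  -- The remaining edges have their ends in `K` and `z`. The two ranks add up to at most `|U|`,
  -- hence at most the rank of `M`, so no circuit meets both sets.
  have h2 : M.natRk (E(G) \ G.inside (U \ K)) ≤ K.ncard + 1 := by
    refine (h.natRk_le (S := insert z K) ?_ (hKf.insert z)).trans (ncard_insert_le _ _)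
    rintro e ⟨he, hei⟩
    obtain ⟨s, t, hl⟩ := Graph.exists_isLink_of_mem_edgeSet he
    have hs := hl.left_mem_vertsOf he
    have ht := hl.right_mem_vertsOf he
    have key : ∀ s t, G.IsLink e s t → s ∈ K → e ∈ G.inside (insert z K) := by
      intro s t hl hs
      refine hl.mem_inside (Or.inr hs) ?_
      by_cases htz : t = z
      · exact Or.inl htz
      · exact Or.inr (Graph.mem_compAt_of_isLink hl hs (hKU hs).2 htz)
    by_cases hsK : s ∈ K
    · exact key s t hl hsK
    by_cases htK : t ∈ K
    · exact key t s hl.symm htK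
    exact (hei (hl.mem_inside ⟨hs, hsK⟩ ⟨ht, htK⟩)).elim
  have h3 : U.ncard ≤ M.natRk E(G) := by
    obtain ⟨C, hC⟩ := hu
    exact (h.le_natRk hUf hconn hC hC.1.subset_edgeSet
      (Graph.vertsOf_mono hC.1.subset_edgeSet)).trans (natRk_mono inter_subset_left)
  have h4 := ncard_sdiff_add_ncard_of_subset (hKU.trans sdiff_subset) hUf
  obtain ⟨e, he⟩ := hj.nonempty
  obtain ⟨f, hf, hfw⟩ := hj.right_mem
  have hfR : f ∉ G.inside (U \ K) := fun hh =>
    (Graph.mem_of_mem_inside hh hfw).2 Graph.mem_compAt_self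
  have hef : e ≠ f := by
    rintro rfl
    exact hfR he
  obtain ⟨D, hD, heD, hfD⟩ := hM e (h.edgeSet_eq ▸ Graph.inside_subset_edgeSet he) f
    (h.edgeSet_eq ▸ hf) hef
  have hunion : G.inside (U \ K) ∪ E(G) \ G.inside (U \ K) = E(G) :=
    union_sdiff_cancel Graph.inside_subset_edgeSet
  rcases hD.subset_or_subset (X := G.inside (U \ K)) (Y := E(G) \ G.inside (U \ K))
    (by rw [hunion, h.edgeSet_eq]; exact hD.subset_ground) disjoint_sdiff_right
    (by rw [hunion]; omega) with hs | hs
  · exact hfR (hs hfD)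
  · exact (hs heD).2 he

/-- `S` shrinks towards `U \ K` while the answer stays the same. Take an edge from `T` to some `v ∈
S`. If `v ≠ z`, replace `S` by the component `S₁` of `S` minus `v` that contains `z`. As `v` does
not separate `y` from `z`, some edge joins `S₁` to `T`, and `sep_mono` compares both partitions with
the pair `S₁`, `T`. -/
theorem sep_iff_of_insep (hj : G.IsJoint z y) (hyz : G.Insep y z) (hST : S ∪ T = G.vertsOf E(G))
    (hd : Disjoint S T) (hSc : G.ConnVia E(G) S) (hTc : G.ConnVia E(G) T)
    (hTu : G.Unb (M.balancedCycles G) T) (hz : z ∈ S) (hy : y ∈ T) :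
    M.Sep G S T ↔ M.Sep G (G.vertsOf E(G) \ G.compAt z y) (G.compAt z y) := by
  induction hn : S.ncard using Nat.strong_induction_on generalizing S T with
  | _ n ih =>
  subst hn
  have hR := h.unb_of_isJoint hconn hu hM hj
  set U := G.vertsOf E(G)
  set K := G.compAt z y
  have hUf : U.Finite := h.finite_vertsOf
  have hSU : S ⊆ U := hST ▸ subset_union_left
  have hTU : T ⊆ U := hST ▸ subset_union_right
  have hSf := hUf.subset hSU
  have hTf := hUf.subset hTU
  have hKU : K ⊆ U \ {z} := Graph.compAt_subset hj.right_mem hj.ne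
  have hKf : K.Finite := hUf.subset (hKU.trans sdiff_subset)
  have hKc : G.ConnVia E(G) K := Graph.connVia_compAt
  have hzT : z ∉ T := disjoint_left.1 hd hz
  have hTK : T ⊆ K := fun u hu => (hTc hy hu).mono Subset.rfl
    fun r hr => ⟨hTU hr, fun hrz => hzT (hrz ▸ hr)⟩
  have hRS : U \ K ⊆ S := by
    rintro u ⟨huU, huK⟩
    rw [← hST] at huU
    exact huU.resolve_right fun hh => huK (hTK hh)
  have hRc : G.ConnVia E(G) (U \ K) := hconn.sdiff_reach_set (S := {z})
    (by rintro a rfl b rfl; exact .refl) (singleton_subset_iff.2 hj.left_mem) (singleton_nonempty z)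
    hj.right_mem hj.ne
  have hzR : z ∈ U \ K := ⟨hj.left_mem, fun hh => (hKU hh).2 rfl⟩
  obtain ⟨e, he, s, v, hl, hs, hv, hsU, hvU⟩ :=
    (hconn hj.right_mem hj.left_mem).exists_exit (S := T) hy hzT
  have hvS : v ∈ S := by
    have : v ∈ S ∪ T := hST ▸ hvU
    exact this.resolve_right hv
  -- An edge from `T` to `z` itself makes `U \ K` and `T` adjacent, and both partitions are compared
  -- with this pair.
  by_cases hvz : v = z
  · subst hvz
    rw [← h.sep_mono hSf hTf hd hRS Subset.rfl hRc hTc hSc hTc hR hTu hl.symm hzR hs,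
      h.sep_mono (hUf.subset sdiff_subset) hKf disjoint_sdiff_left Subset.rfl hTK hRc hTc hRc hKc
        hR hTu hl.symm hzR hs]
  have hvK : v ∈ K :=
    Graph.mem_compAt_of_isLink hl (hTK hs) (fun hh => hzT (hh ▸ hs)) hvz
  set S₁ := {u | G.Reach E(G) (S \ {v}) z u} with hS₁
  have hzv : z ≠ v := Ne.symm hvz
  have hS₁S : S₁ ⊆ S \ {v} := fun u hu => Graph.Reach.mem hu ⟨hz, hzv⟩
  have hzS₁ : z ∈ S₁ := Graph.Reach.refl
  have hRS₁ : U \ K ⊆ S₁ := fun u hu => (hRc hzR hu).mono Subset.rfl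
    fun r hr => ⟨hRS hr, fun hrv => hr.2 (hrv ▸ hvK)⟩
  have hS₁c : G.ConnVia E(G) S₁ := Graph.connVia_reach_set
  have hS₁f := hSf.subset (hS₁S.trans sdiff_subset)
  have hTvc : G.ConnVia E(G) (T ∪ {v}) := by
    have hc : G.ConnVia E(G) {v} := by
      rintro a rfl b rfl
      exact .refl
    refine (hTc.insert_edge hc hl hs rfl).mono ?_
    rw [union_self]
    exact insert_subset he Subset.rfl
  have hSv : S \ {v} = U \ (T ∪ {v}) := by
    ext r
    have h1 : r ∈ U ↔ r ∈ S ∨ r ∈ T := by rw [← hST]; rfl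
    have h2 := @disjoint_left.1 hd r
    simp only [mem_sdiff, mem_union, mem_singleton_iff, h1]
    tauto
  have hT₁c : G.ConnVia E(G) (U \ S₁) := by
    have := hconn.sdiff_reach_set hTvc (union_subset hTU (singleton_subset_iff.2 hvU))
      ⟨v, Or.inr rfl⟩ hj.left_mem (y := z) (by rintro (hh | hh); exacts [hzT hh, hzv hh])
    rwa [← hSv] at this
  have hTT₁ : T ⊆ U \ S₁ := fun r hr => ⟨hTU hr, fun hh => disjoint_left.1 hd (hS₁S hh).1 hr⟩
  have hyv : v ≠ y := fun hh => hv (hh ▸ hy)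
  -- The edge by which a walk from `z` to `y` avoiding `v` leaves `S₁` ends in `T`, as `S₁` is a
  -- component of `S` minus `v`.
  obtain ⟨g, hg, p, q, hpq, hp, hq, hpU, hqU⟩ :=
    (hyz v hyv hvz).symm.exists_exit (S := S₁) hzS₁ (hTT₁ hy).2
  have hqT : q ∈ T := by
    by_contra hqT
    have hqS : q ∈ S := by
      have : q ∈ S ∪ T := hST ▸ hqU.1
      exact this.resolve_right hqT
    exact hq (Graph.Reach.trans hp (hpq.reach hg (hS₁S hp) ⟨hqS, hqU.2⟩))
  have hS₁u := hR.mono hRS₁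
  have hlt : S₁.ncard < S.ncard :=
    ncard_lt_ncard ⟨hS₁S.trans sdiff_subset, fun hh => (hS₁S (hh hvS)).2 rfl⟩ hSf
  rw [← h.sep_mono hSf hTf hd (hS₁S.trans sdiff_subset) Subset.rfl hS₁c hTc hSc hTc hS₁u hTu hpq hp
    hqT, h.sep_mono hS₁f (hUf.subset sdiff_subset) disjoint_sdiff_right Subset.rfl hTT₁ hS₁c hTc
    hS₁c hT₁c hS₁u hTu hpq hp hqT]
  exact ih S₁.ncard hlt (union_sdiff_cancel ((hS₁S.trans sdiff_subset).trans hSU))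
    disjoint_sdiff_right hS₁c hT₁c (hTu.mono hTT₁) hzS₁ (hTT₁ hy) rfl

/-- By the symmetry of `Sep` the joint may be assumed to lie in `S`. Then `T` lies in the component
at the joint, which is therefore unbalanced. -/
theorem sep_iff_of_isJoint (hST : S ∪ T = G.vertsOf E(G)) (hd : Disjoint S T)
    (hSc : G.ConnVia E(G) S) (hTc : G.ConnVia E(G) T) (hSu : G.Unb (M.balancedCycles G) S)
    (hTu : G.Unb (M.balancedCycles G) T) (he : G.IsLink e x y) (hx : x ∈ S) (hy : y ∈ T)
    (hj : G.IsJoint z w) (hw : w = x ∨ w = y) (hxz : G.Insep x z) (hyz : G.Insep y z) :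
    G.Unb (M.balancedCycles G) (G.compAt z w) ∧
      (M.Sep G S T ↔ M.Sep G (G.vertsOf E(G) \ G.compAt z w) (G.compAt z w)) := by
  have key : ∀ S T x y, S ∪ T = G.vertsOf E(G) → Disjoint S T → G.ConnVia E(G) S →
      G.ConnVia E(G) T → G.Unb (M.balancedCycles G) T → G.IsLink e x y → x ∈ S →
      y ∈ T → (w = x ∨ w = y) → G.Insep y z → z ∈ S → G.Unb (M.balancedCycles G) (G.compAt z w) ∧
      (M.Sep G S T ↔ M.Sep G (G.vertsOf E(G) \ G.compAt z w) (G.compAt z w)) := by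
    intro S T x y hST hd hSc hTc hTu he hx hy hw hyz hz
    have hzT : z ∉ T := disjoint_left.1 hd hz
    have hyK : y ∈ G.compAt z w := by
      rcases hw with rfl | rfl
      · exact Graph.mem_compAt_of_isLink he Graph.mem_compAt_self hj.ne fun hh => hzT (hh ▸ hy)
      · exact Graph.mem_compAt_self
    have hTK : T ⊆ G.compAt z w := fun u hu => Graph.Reach.trans hyK ((hTc hy hu).mono Subset.rfl
      fun r hr => ⟨hST.subset (Or.inr hr), fun hrz => hzT (hrz ▸ hr)⟩)
    have := h.sep_iff_of_insep hconn hu hM (hj.of_mem hyK) hyz hST hd hSc hTc hTu hz hy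
    rw [Graph.compAt_eq_of_mem hyK] at this
    exact ⟨hTu.mono hTK, this⟩
  have hz : z ∈ S ∪ T := hST ▸ hj.left_mem
  rcases hz with hz | hz
  · exact key S T x y hST hd hSc hTc hTu he hx hy hw hyz hz
  · rw [sep_comm (S := S)]
    exact key T S y x (by rw [union_comm, hST]) hd.symm hTc hSc hSu he.symm hy hx hw.symm hxz hz

/-- The type of an edge decides which adjacent connected unbalanced sets are skew. -/
theorem sep_iff_isLiftEdge (hjt : ∃ z w, G.IsJoint z w) (hS : S ⊆ G.vertsOf E(G))
    (hT : T ⊆ G.vertsOf E(G)) (hd : Disjoint S T) (hSc : G.ConnVia E(G) S)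
    (hTc : G.ConnVia E(G) T) (hSu : G.Unb (M.balancedCycles G) S)
    (hTu : G.Unb (M.balancedCycles G) T) (he : G.IsLink e x y) (hx : x ∈ S) (hy : y ∈ T) :
    M.Sep G S T ↔ M.IsLiftEdge G e := by
  have hUf := h.finite_vertsOf
  have hyS : y ∉ S := disjoint_right.1 hd hy
  have hxy : x ≠ y := fun hh => hyS (hh ▸ hx)
  set T' := {u | G.Reach E(G) (G.vertsOf E(G) \ S) y u}
  have hT'sub : T' ⊆ G.vertsOf E(G) \ S := fun u hu => Graph.Reach.mem hu ⟨hT hy, hyS⟩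
  have hTT' : T ⊆ T' := fun u hu => (hTc hy hu).mono Subset.rfl
    fun r hr => ⟨hT hr, disjoint_right.1 hd hr⟩
  have hSS' : S ⊆ G.vertsOf E(G) \ T' := fun u hu => ⟨hS hu, fun hh => (hT'sub hh).2 hu⟩
  have hS'c : G.ConnVia E(G) (G.vertsOf E(G) \ T') :=
    hconn.sdiff_reach_set hSc hS ⟨x, hx⟩ (hT hy) hyS
  have hT'c : G.ConnVia E(G) T' := Graph.connVia_reach_set
  have hT'U := hT'sub.trans sdiff_subset
  rw [h.sep_mono (hUf.subset sdiff_subset) (hUf.subset hT'U) disjoint_sdiff_left hSS' hTT' hSc hTc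
    hS'c hT'c hSu hTu he hx hy]
  have key := fun z w => h.sep_iff_of_isJoint hconn hu hM (z := z) (w := w)
    (sdiff_union_of_subset hT'U) disjoint_sdiff_left hS'c hT'c (hSu.mono hSS') (hTu.mono hTT') he
    (hSS' hx) (hTT' hy)
  constructor
  · intro hsep
    obtain ⟨z, w, hj, hw, hxz, hyz⟩ := Graph.exists_isJoint_insep hUf hconn hjt he hxy
    obtain ⟨hK, hiff⟩ := key z w hj hw hxz hyz
    rcases hw with rfl | rfl
    · exact ⟨y, w, z, he.symm, hxy.symm, hyz, hxz, hj, hK, hiff.1 hsep⟩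
    · exact ⟨x, w, z, he, hxy, hxz, hyz, hj, hK, hiff.1 hsep⟩
  · rintro ⟨p, q, z, hl, -, hpz, hqz, hj, -, hsep⟩
    rcases hl.eq_and_eq_or_eq_and_eq he with ⟨rfl, rfl⟩ | ⟨rfl, rfl⟩
    · exact (key z q hj (Or.inr rfl) hpz hqz).2.2 hsep
    · exact (key z q hj (Or.inl rfl) hqz hpz).2.2 hsep

/-- The circuit contained in a loose handcuff. -/
theorem eq_of_isLoose (hjt : ∃ z w, G.IsJoint z w) {C₁ C₂ : Set α}
    (hL : G.IsLoose (M.balancedCycles G) C₁ C₂ x y Z P) (hD : M.IsCircuit D)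
    (hDs : D ⊆ C₁ ∪ C₂ ∪ P) : D = C₁ ∪ C₂ ∪ P \ {e | M.IsLiftEdge G e} := by
  have hB := isCycle_of_mem_balancedCycles (M := M) (G := G)
  have h₁ := h.subset_of_isLoose hL hD hDs
  have h₂ := h.subset_of_isLoose hL.symm hD (by rwa [union_comm C₂ C₁])
  suffices key : ∀ e ∈ P, (e ∈ D ↔ ¬ M.IsLiftEdge G e) by
    apply Subset.antisymm
    · intro e he
      rcases hDs he with he' | he'
      · exact Or.inl he'
      · exact Or.inr ⟨he', (key e he').1 he⟩
    · exact union_subset (union_subset h₁ h₂) fun e he => (key e he.1).2 he.2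
  intro e he
  obtain ⟨hC₁, hC₂, hdisj, hP, h1, h2⟩ := hL
  have hZU : Z ⊆ G.vertsOf E(G) := by
    rw [← hP.vertsOf_eq ⟨e, he⟩]
    exact Graph.vertsOf_mono hP.subset_edgeSet
  -- Without `e` the handcuff falls into two unicyclic pieces, each independent and spanning the
  -- inside of its vertex set. So `e ∈ D` depends only on the skewness of these insides.
  obtain ⟨s, t, Z₁, P₁, Z₂, P₂, k1, hl, k3, k4, rfl, rfl, -, -⟩ := hP.splitEdge he
  have hx := h1.superset rfl
  have hy := h2.superset rfl
  have hd : Disjoint (G.vertsOf C₁ ∪ Z₁) (G.vertsOf C₂ ∪ Z₂) := by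
    rw [disjoint_union_left, disjoint_union_right, disjoint_union_right]
    refine ⟨⟨hdisj, ?_⟩, ?_, k4⟩
    · rw [Set.disjoint_left]
      intro r hr hr'
      obtain rfl : r = x := h1.subset ⟨Or.inr hr', hr⟩
      exact disjoint_left.1 k4 k1.left_mem hr'
    · rw [Set.disjoint_left]
      intro r hr hr'
      obtain rfl : r = y := h2.subset ⟨Or.inl hr, hr'⟩
      exact disjoint_left.1 k4 hr k3.right_mem
  have hA₁c : G.ConnVia (C₁ ∪ P₁) (G.vertsOf C₁ ∪ Z₁) :=
    hC₁.1.connVia.union k1.connVia hx.2 k1.left_mem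
  have hA₂c : G.ConnVia (C₂ ∪ P₂) (G.vertsOf C₂ ∪ Z₂) :=
    hC₂.1.connVia.union k3.connVia hy.2 k3.right_mem
  have hA₁i : M.Indep (C₁ ∪ P₁) := h.indep_of_lift _ ((hC₁.isLiftIndep hB).union_path hB
    hC₁.1.subset_inside k1.reverse ((inter_subset_inter_left _ subset_union_left).trans h1.le))
  have hA₂i : M.Indep (C₂ ∪ P₂) := h.indep_of_lift _ ((hC₂.isLiftIndep hB).union_path hB
    hC₂.1.subset_inside k3 ((inter_subset_inter_left _ subset_union_right).trans h2.le))
  have hA₁E : C₁ ∪ P₁ ⊆ E(G) := union_subset hC₁.1.subset_edgeSet k1.subset_edgeSet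
  have hA₂E : C₂ ∪ P₂ ⊆ E(G) := union_subset hC₂.1.subset_edgeSet k3.subset_edgeSet
  have hS₁U : G.vertsOf C₁ ∪ Z₁ ⊆ G.vertsOf E(G) :=
    union_subset (Graph.vertsOf_mono hC₁.1.subset_edgeSet) (subset_union_left.trans hZU)
  have hS₂U : G.vertsOf C₂ ∪ Z₂ ⊆ G.vertsOf E(G) :=
    union_subset (Graph.vertsOf_mono hC₂.1.subset_edgeSet) (subset_union_right.trans hZU)
  have hin₁ : C₁ ∪ P₁ ⊆ G.inside (G.vertsOf C₁ ∪ Z₁) :=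
    union_subset (hC₁.1.subset_inside.trans (Graph.inside_mono subset_union_left))
      (k1.subset_inside.trans (Graph.inside_mono subset_union_right))
  have hin₂ : C₂ ∪ P₂ ⊆ G.inside (G.vertsOf C₂ ∪ Z₂) :=
    union_subset (hC₂.1.subset_inside.trans (Graph.inside_mono subset_union_left))
      (k3.subset_inside.trans (Graph.inside_mono subset_union_right))
  have hu₁ : G.Unb (M.balancedCycles G) (G.vertsOf C₁ ∪ Z₁) := ⟨C₁, hC₁, subset_union_left⟩
  have hu₂ : G.Unb (M.balancedCycles G) (G.vertsOf C₂ ∪ Z₂) := ⟨C₂, hC₂, subset_union_left⟩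
  have hf₁ := h.finite_vertsOf.subset hS₁U
  have hf₂ := h.finite_vertsOf.subset hS₂U
  have hsk₁ := Or.inr k1.right_mem (a := s ∈ G.vertsOf C₁)
  have htk₂ := Or.inr k3.left_mem (a := t ∈ G.vertsOf C₂)
  rw [← h.sep_iff_isLiftEdge hconn hu hM hjt hS₁U hS₂U hd (hA₁c.mono hA₁E) (hA₂c.mono hA₂E) hu₁ hu₂
    hl hsk₁ htk₂]
  have hcov : D \ {e} ⊆ (C₁ ∪ P₁) ∪ (C₂ ∪ P₂) := by
    rintro f ⟨hf, hfe⟩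
    rcases hDs hf with (hf' | hf') | rfl | hf' | hf'
    exacts [Or.inl (Or.inl hf'), Or.inr (Or.inl hf'), absurd rfl hfe, Or.inl (Or.inr hf'),
      Or.inr (Or.inr hf')]
  constructor
  -- If `e ∈ D`, the two insides span `e`; since they have full rank together with `e`, they have it
  -- without `e`.
  · intro heD hsep
    have hcl := M.closure_subset_closure (hcov.trans (union_subset_union hin₁ hin₂))
      (hD.mem_closure_sdiff_singleton_of_mem heD)
    have := h.le_natRk_insert hf₁ hf₂ hd (hA₁c.mono hA₁E) (hA₂c.mono hA₂E) hu₁ hl hsk₁ htk₂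
    rw [natRk_insert_of_mem_closure hcl] at this
    exact absurd this (not_le.2 hsep)
  -- If `e ∉ D`, the union of the two pieces contains `D` and is dependent. It has the same closure
  -- as the two insides, which gives the defect.
  · intro hsep
    by_contra heD
    apply hsep
    rw [sdiff_singleton_eq_self heD] at hcov
    have hdep : M.Dep ((C₁ ∪ P₁) ∪ (C₂ ∪ P₂)) :=
      hD.dep.superset hcov (h.edgeSet_eq ▸ union_subset hA₁E hA₂E)
    have r1 := hdep.natRk_lt
    have r2 := ncard_union_le (C₁ ∪ P₁) (C₂ ∪ P₂)
    have r3 := hA₁i.natRk_eq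
    have r4 := hA₂i.natRk_eq
    have r5 := h.natRk_le hin₁ hf₁
    have r6 := h.natRk_le hin₂ hf₂
    have c1 : G.inside (G.vertsOf C₁ ∪ Z₁) ⊆ M.closure (C₁ ∪ P₁) := by
      rw [closure_eq_of_natRk_le hin₁ ((h.natRk_le Subset.rfl hf₁).trans ((h.le_natRk hf₁ hA₁c hC₁
        subset_union_left subset_union_left).trans (natRk_mono inter_subset_left)))]
      exact M.subset_closure _ (h.edgeSet_eq ▸ Graph.inside_subset_edgeSet)
    have c2 : G.inside (G.vertsOf C₂ ∪ Z₂) ⊆ M.closure (C₂ ∪ P₂) := by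
      rw [closure_eq_of_natRk_le hin₂ ((h.natRk_le Subset.rfl hf₂).trans ((h.le_natRk hf₂ hA₂c hC₂
        subset_union_left subset_union_left).trans (natRk_mono inter_subset_left)))]
      exact M.subset_closure _ (h.edgeSet_eq ▸ Graph.inside_subset_edgeSet)
    have r7 : M.natRk (G.inside (G.vertsOf C₁ ∪ Z₁) ∪ G.inside (G.vertsOf C₂ ∪ Z₂)) ≤
        M.natRk ((C₁ ∪ P₁) ∪ (C₂ ∪ P₂)) := by
      rw [← natRk_closure ((C₁ ∪ P₁) ∪ (C₂ ∪ P₂))]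
      exact natRk_mono (union_subset (c1.trans (M.closure_subset_closure subset_union_left))
        (c2.trans (M.closure_subset_closure subset_union_right)))
    unfold Sep
    omega

/-- The circuits of a connected biased graphic matroid whose graph has a joint. -/
theorem isCircuit_iff (hjt : ∃ z w, G.IsJoint z w) : M.IsCircuit D ↔
    D ∈ M.balancedCycles G ∨ G.IsUnbalancedTheta (M.balancedCycles G) D ∨
      G.IsTightHandcuff (M.balancedCycles G) D ∨ ∃ C₁ C₂ x y Z P,
        G.IsLoose (M.balancedCycles G) C₁ C₂ x y Z P ∧
          D = C₁ ∪ C₂ ∪ P \ {e | M.IsLiftEdge G e} := by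
  constructor
  · intro hD
    rcases h.isCircuit_cases hconn hu hD with hD' | hD' | hD' | ⟨C₁, C₂, x, y, Z, P, hL, hDs⟩
    · exact Or.inl hD'
    · exact Or.inr (Or.inl hD')
    · exact Or.inr (Or.inr (Or.inl hD'))
    · exact Or.inr (Or.inr (Or.inr ⟨C₁, C₂, x, y, Z, P, hL,
        h.eq_of_isLoose hconn hu hM hjt hL hD hDs⟩))
  · rintro (hD | hD | hD | ⟨C₁, C₂, x, y, Z, P, hL, rfl⟩)
    · exact hD.1
    · exact h.isCircuit_of_isUnbalancedTheta hD
    · exact h.isCircuit_of_isTightHandcuff hD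
    · have hE : C₁ ∪ C₂ ∪ P ⊆ M.E := by
        rw [← h.edgeSet_eq]
        exact union_subset (union_subset hL.unb₁.1.subset_edgeSet hL.unb₂.1.subset_edgeSet)
          hL.isPath.subset_edgeSet
      obtain ⟨D, hDs, hD⟩ :=
        Dep.exists_isCircuit_subset ⟨h.dep_of_isFrameCircuit hL.isFrameCircuit, hE⟩
      rwa [← h.eq_of_isLoose hconn hu hM hjt hL hD hDs]

end Connected

end IsBiasedGraphicWith

end Matroid

namespace Graph

variable {V V' α : Type*} {G H : Graph V α} {x y z u v w : V} {e f : α} {S U X Y Z : Set V}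
  {P Q C D L : Set α} {B : Set (Set α)} {a b : V'} {Z' : Set V'}

/-! ### Truncating paths, cycles and thetas of subgraphs -/

/-- `u` is the last vertex of the path in `S`; the part from `u` on is kept. -/
theorem IsPath.exists_first (h : G.IsPath x y Z P) (hS : (Z ∩ S).Nonempty) :
    ∃ u ∈ S, ∃ Z₁ P₁, G.IsPath u y Z₁ P₁ ∧ Z₁ ⊆ Z ∧ P₁ ⊆ P ∧ Z₁ ∩ S = {u} := by
  induction h with
  | nil x hx =>
    obtain ⟨t, rfl, ht⟩ := hS
    exact ⟨t, ht, {t}, ∅, .nil t hx, Subset.rfl, Subset.rfl, by simpa using ht⟩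
  | cons x y z e X P he hP hx ih =>
    by_cases hX : (X ∩ S).Nonempty
    · obtain ⟨u, hu, Z₁, P₁, h1, h2, h3, h4⟩ := ih hX
      exact ⟨u, hu, Z₁, P₁, h1, h2.trans (subset_insert _ _), h3.trans (subset_insert _ _), h4⟩
    · rw [not_nonempty_iff_eq_empty] at hX
      have hxS : x ∈ S := by
        obtain ⟨t, rfl | ht, htS⟩ := hS
        · exact htS
        · exact absurd (show t ∈ X ∩ S from ⟨ht, htS⟩) (hX ▸ notMem_empty t)
      exact ⟨x, hxS, _, _, hP.cons _ _ _ _ _ _ he hx, Subset.rfl, Subset.rfl,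
        by rw [insert_inter_of_mem hxS, hX, insert_empty_eq]⟩

/-- A path from `S` to `U` contains a minimal one. -/
theorem IsPath.exists_minimal (h : G.IsPath x y Z P) (hx : x ∈ S) (hy : y ∈ U) :
    ∃ u ∈ S, ∃ v ∈ U, ∃ Z₁ P₁, G.IsPath u v Z₁ P₁ ∧ Z₁ ⊆ Z ∧ P₁ ⊆ P ∧ Z₁ ∩ S = {u} ∧
      Z₁ ∩ U = {v} := by
  obtain ⟨u, hu, Z₁, P₁, h1, h2, h3, h4⟩ := h.exists_first ⟨x, h.left_mem, hx⟩
  obtain ⟨v, hv, Z₂, P₂, k1, k2, k3, k4⟩ := h1.reverse.exists_first ⟨y, h1.right_mem, hy⟩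
  refine ⟨u, hu, v, hv, Z₂, P₂, k1.reverse, k2.trans h2, k3.trans h3, ?_, k4⟩
  exact ((inter_subset_inter_left _ k2).trans h4.le).antisymm
    (singleton_subset_iff.2 ⟨k1.right_mem, hu⟩)

/-- Any edge of `Q` separates the ends of `Q` within `Q`, so `P` cannot omit it. -/
theorem IsPath.eq_of_subset (h : G.IsPath x y Z P) (h' : G.IsPath x y Y Q) (hPQ : P ⊆ Q) :
    P = Q := by
  refine hPQ.antisymm fun e he => ?_
  by_contra heP
  obtain ⟨s, t, Z₁, P₁, Z₂, P₂, h1, hl, h2, hd, rfl, rfl, -⟩ := h'.splitEdge he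
  have := (h.reach h.left_mem h.right_mem).mem_of_closed (S := Z₁) h1.left_mem ?_
  · exact disjoint_left.1 hd this h2.right_mem
  · intro f hf s t hst hs _ _
    rcases hPQ hf with rfl | hf | hf
    · exact absurd hf heP
    · exact mem_of_mem_inside (h1.subset_inside hf) hst.inc_right
    · exact absurd (mem_of_mem_inside (h2.subset_inside hf) hst.inc_left) (disjoint_left.1 hd hs)

theorem IsPath.of_le (h : H.IsPath x y Z P) (hle : H ≤ G) : G.IsPath x y Z P := by
  induction h with
  | nil x hx => exact .nil x (hle.vertexSet_mono hx)
  | cons x y z e X P he hP hx ih => exact ih.cons _ _ _ _ _ _ (he.mono hle) hx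

theorem IsPath.anti (h : G.IsPath x y Z P) (hle : H ≤ G) (hx : x ∈ V(H)) (hP : P ⊆ E(H)) :
    H.IsPath x y Z P := by
  induction h with
  | nil x _ => exact .nil x hx
  | cons x y z e X P he _ hxX ih =>
    have hl := (hle.isLink_iff (hP (mem_insert _ _))).2 he
    exact (ih hl.right_mem ((subset_insert _ _).trans hP)).cons _ _ _ _ _ _ hl hxX

theorem vertsOf_of_le (hle : H ≤ G) (hC : C ⊆ E(H)) : H.vertsOf C = G.vertsOf C := by
  ext x
  exact exists_congr fun e => and_congr_right fun he => hle.inc_congr (hC he)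

theorem isCycle_iff_of_le (hle : H ≤ G) : H.IsCycle C ↔ G.IsCycle C ∧ C ⊆ E(H) := by
  constructor
  · intro h
    refine ⟨?_, h.subset_edgeSet⟩
    obtain ⟨x, y, Z, P, e, hP, heP, hl, rfl⟩ := h
    exact ⟨x, y, Z, P, e, hP.of_le hle, heP, hl.mono hle, rfl⟩
  · rintro ⟨⟨x, y, Z, P, e, hP, heP, hl, rfl⟩, hC⟩
    have hl' := (hle.isLink_iff (hC (mem_insert _ _))).2 hl
    exact ⟨x, y, Z, P, e, hP.anti hle hl'.right_mem ((subset_insert _ _).trans hC), heP, hl', rfl⟩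

theorem IsTheta.of_le {P₁ P₂ P₃ : Set α} (h : H.IsTheta P₁ P₂ P₃) (hle : H ≤ G) :
    G.IsTheta P₁ P₂ P₃ := by
  obtain ⟨u, v, X₁, X₂, X₃, huv, h1, h2, h3, h4⟩ := h
  exact ⟨u, v, X₁, X₂, X₃, huv, h1.of_le hle, h2.of_le hle, h3.of_le hle, h4⟩

theorem IsTheta.subset_edgeSet {P₁ P₂ P₃ : Set α} (h : G.IsTheta P₁ P₂ P₃) :
    P₁ ∪ P₂ ∪ P₃ ⊆ E(G) :=
  union_subset h.isCycle₁₂.subset_edgeSet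
    (subset_union_right.trans h.perm₁₃₂.isCycle₁₂.subset_edgeSet)

theorem IsTheta.anti {P₁ P₂ P₃ : Set α} (h : G.IsTheta P₁ P₂ P₃) (hle : H ≤ G)
    (hP : P₁ ∪ P₂ ∪ P₃ ⊆ E(H)) : H.IsTheta P₁ P₂ P₃ := by
  obtain ⟨u, v, X₁, X₂, X₃, huv, h1, h2, h3, h4⟩ := h
  have hu : u ∈ V(H) := by
    cases h1 with
    | nil => exact absurd rfl huv
    | cons _ y _ e X P he _ _ =>
      exact ((hle.isLink_iff (hP (Or.inl (Or.inl (mem_insert _ _))))).2 he).left_mem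
  exact ⟨u, v, X₁, X₂, X₃, huv, h1.anti hle hu (fun _ h => hP (Or.inl (Or.inl h))),
    h2.anti hle hu (fun _ h => hP (Or.inl (Or.inr h))), h3.anti hle hu (fun _ h => hP (Or.inr h)),
    h4⟩

/-- The balanced cycles that consist of edges in `X`. -/
def restrictCycles (B : Set (Set α)) (X : Set α) : Set (Set α) := {C ∈ B | C ⊆ X}

theorem IsBiased.of_le (h : G.IsBiased B) (hle : H ≤ G) :
    H.IsBiased (restrictCycles B E(H)) where
  isCycle C hC := (isCycle_iff_of_le hle).2 ⟨h.isCycle C hC.1, hC.2⟩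
  theta P₁ P₂ P₃ ht h12 h13 := ⟨h.theta P₁ P₂ P₃ (ht.of_le hle) h12.1 h13.1,
    ht.perm₂₁₃.perm₁₃₂.isCycle₁₂.subset_edgeSet⟩

theorem isUnbalanced_iff_of_le (hle : H ≤ G) :
    H.IsUnbalanced (restrictCycles B E(H)) C ↔ G.IsUnbalanced B C ∧ C ⊆ E(H) := by
  rw [IsUnbalanced, IsUnbalanced, isCycle_iff_of_le hle]
  constructor
  · rintro ⟨⟨h1, h2⟩, h3⟩
    exact ⟨⟨h1, fun h => h3 ⟨h, h2⟩⟩, h2⟩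
  · rintro ⟨⟨h1, h3⟩, h2⟩
    exact ⟨⟨h1, h2⟩, fun h => h3 h.1⟩

/-! ### Contracting the components of a set of edges that is a union of blocks -/

/-- The set `L` of edges is closed under cycles, and the fibers of `q` are the sets of vertices
of the components of `L`. -/
structure IsBlockContraction (G : Graph V α) (L : Set α) (q : V → V') : Prop where
  eq_iff : ∀ x y, q x = q y ↔ G.Reach L univ x y
  subset : ∀ C, G.IsCycle C → ∀ e ∈ C, e ∈ L → C ⊆ L

/-- The graph of the edges outside of `L`, with vertices identified by `q`. -/
def contr (G : Graph V α) (L : Set α) (q : V → V') : Graph V' α := (G.restrict Lᶜ).map q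

/-- The graph of the edges of `L` that lie in the fiber of `q` over `a`. -/
def fiber (G : Graph V α) (L : Set α) (q : V → V') (a : V') : Graph V α :=
  (G.restrict L).induce {x ∈ V(G) | q x = a}

variable {q : V → V'}

theorem contr_isLink :
    (G.contr L q).IsLink e a b ↔ ∃ s t, G.IsLink e s t ∧ e ∉ L ∧ q s = a ∧ q t = b := by
  constructor
  · rintro ⟨s, t, ⟨he, hl⟩, hs, ht⟩
    exact ⟨s, t, hl, he, hs, ht⟩
  · rintro ⟨s, t, hl, he, hs, ht⟩
    exact ⟨s, t, ⟨he, hl⟩, hs, ht⟩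

theorem edgeSet_contr : E(G.contr L q) = E(G) \ L := rfl

theorem IsLink.contr (h : G.IsLink e x y) (he : e ∉ L) : (G.contr L q).IsLink e (q x) (q y) :=
  contr_isLink.2 ⟨x, y, h, he, rfl, rfl⟩

theorem vertsOf_contr (hC : Disjoint C L) : (G.contr L q).vertsOf C = q '' G.vertsOf C := by
  ext a
  constructor
  · rintro ⟨e, he, b, hl⟩
    obtain ⟨s, t, hst, -, rfl, -⟩ := contr_isLink.1 hl
    exact ⟨s, ⟨e, he, hst.inc_left⟩, rfl⟩
  · rintro ⟨s, ⟨e, he, t, hl⟩, rfl⟩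
    exact ⟨e, he, q t, hl.contr (disjoint_left.1 hC he)⟩

theorem fiber_le : G.fiber L q a ≤ G :=
  (induce_le (by exact sep_subset _ _)).trans restrict_le

/-- If `q` is injective on a set of vertices, then a path of the contracted graph whose edges have
all their ends in this set is a path of `G`. -/
theorem IsPath.of_contr (hP : (G.contr L q).IsPath a b Z' P) (hS : InjOn q S)
    (hPS : G.vertsOf P ⊆ S) (hx : x ∈ S) (hxG : x ∈ V(G)) (hy : y ∈ S) (hxa : q x = a)
    (hyb : q y = b) : ∃ Z ⊆ S, G.IsPath x y Z P ∧ q '' Z = Z' := by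
  induction hP generalizing x with
  | nil a ha =>
    obtain rfl := hS hx hy (hxa.trans hyb.symm)
    exact ⟨{x}, singleton_subset_iff.2 hx, .nil x hxG, by rw [image_singleton, hxa]⟩
  | cons a c b e X P he hP ha ih =>
    obtain ⟨s, t, hl, heL, hs, ht⟩ := contr_isLink.1 he
    obtain rfl := hS hx (hPS (hl.left_mem_vertsOf (mem_insert _ _))) (hxa.trans hs.symm)
    obtain ⟨Z, hZ, hQ, rfl⟩ := ih ((vertsOf_mono (subset_insert _ _)).trans hPS)
      (hPS (hl.right_mem_vertsOf (mem_insert _ _))) hl.right_mem ht hyb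
    refine ⟨insert x Z, insert_subset hx hZ, hQ.cons _ _ _ _ _ _ hl fun hh => ha ⟨x, hh, hs⟩, ?_⟩
    rw [image_insert_eq, hs]

namespace IsBlockContraction

variable (h : G.IsBlockContraction L q)
include h

theorem eq_of_isLink (hl : G.IsLink e x y) (he : e ∈ L) : q x = q y :=
  (h.eq_iff x y).2 (hl.reach he trivial trivial)

theorem mem_fiber_iff : e ∈ E(G.fiber L q a) ↔ e ∈ L ∧ ∃ x, G.Inc e x ∧ q x = a := by
  constructor
  · intro he
    obtain ⟨x, y, ⟨⟨heL, hl⟩, hx, hy⟩⟩ := exists_isLink_of_mem_edgeSet he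
    exact ⟨heL, x, hl.inc_left, hx.2⟩
  · rintro ⟨heL, x, ⟨y, hl⟩, hx⟩
    have : (G.fiber L q a).IsLink e x y :=
      ⟨⟨heL, hl⟩, ⟨hl.left_mem, hx⟩, hl.right_mem, (h.eq_of_isLink hl heL).symm.trans hx⟩
    exact this.edge_mem

theorem disjoint_of_isCycle (hC : G.IsCycle C) (he : e ∈ C) (heL : e ∉ L) : Disjoint C L :=
  disjoint_left.2 fun _ hf hfL => heL (h.subset C hC _ hf hfL he)

theorem subset_or_disjoint (hC : G.IsCycle C) : C ⊆ L ∨ Disjoint C L := by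
  by_cases hd : Disjoint C L
  · exact Or.inr hd
  · obtain ⟨e, he, heL⟩ := not_disjoint_iff.1 hd
    exact Or.inl (h.subset C hC e he heL)

theorem exists_isPath (hq : q x = q y) (hx : x ∈ V(G)) :
    ∃ Z P, G.IsPath x y Z P ∧ P ⊆ L ∧ q '' Z = {q x} := by
  obtain ⟨Z, P, hP, -, hPL⟩ := ((h.eq_iff x y).1 hq).exists_isPath trivial hx
  refine ⟨Z, P, hP, hPL, Subset.antisymm ?_ (singleton_subset_iff.2 ⟨x, hP.left_mem, rfl⟩)⟩
  rintro _ ⟨t, ht, rfl⟩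
  exact ((h.eq_iff x t).2 ((hP.reach hP.left_mem ht).mono hPL (subset_univ _))).symm

/-- A path between two vertices of the same component of `L` stays in `L`. -/
theorem isPath_subset (hP : G.IsPath x y Z P) (hq : q x = q y) : P ⊆ L := by
  intro e he
  by_contra heL
  obtain ⟨s, t, Z₁, P₁, Z₂, P₂, h1, hl, h2, hd, rfl, rfl, he1, he2⟩ := hP.splitEdge he
  -- The rest of the path and `L` join the ends of `e`, which yields a cycle through `e ∉ L`. This
  -- cycle avoids `L`, so without `e` it runs within `P₁ ∪ P₂`, which does not connect the two sides
  -- of `e`.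
  have hr : G.Reach (P₁ ∪ P₂ ∪ L) univ s t :=
    (((h1.reach h1.right_mem h1.left_mem).mono (subset_union_left.trans subset_union_left)
      (subset_univ _)).trans (((h.eq_iff x y).1 hq).mono subset_union_right Subset.rfl)).trans
      ((h2.reach h2.right_mem h2.left_mem).mono (subset_union_right.trans subset_union_left)
      (subset_univ _))
  obtain ⟨Y, Q, hQ, -, hQs⟩ := hr.exists_isPath trivial hl.left_mem
  have heQ : e ∉ Q := fun hh => by
    rcases hQs hh with (hh | hh) | hh
    exacts [he1 hh, he2 hh, heL hh]
  have hd' := h.disjoint_of_isCycle (hQ.isCycle hl.symm heQ) (mem_insert _ _) heL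
  have := (hQ.reach hQ.left_mem hQ.right_mem).mem_of_closed (S := Z₁) h1.right_mem ?_
  · exact disjoint_left.1 hd this h2.left_mem
  · intro f hf s t hst hs _ _
    rcases hQs hf with (hf' | hf') | hf'
    · exact mem_of_mem_inside (h1.subset_inside hf') hst.inc_right
    · exact absurd (mem_of_mem_inside (h2.subset_inside hf') hst.inc_left) (disjoint_left.1 hd hs)
    · exact absurd hf' (disjoint_left.1 hd' (Or.inr hf))

theorem eq_of_isPath (hP : G.IsPath x y Z P) (hd : Disjoint P L) (hq : q x = q y) : x = y := by
  by_contra hne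
  obtain ⟨e, he⟩ := hP.nonempty_of_ne hne
  exact disjoint_left.1 hd he (h.isPath_subset hP hq he)

/-- A path in `C` between two identified vertices would lie in `L`. -/
theorem injOn_vertsOf (hC : G.IsCycle C) (hd : Disjoint C L) : InjOn q (G.vertsOf C) := by
  intro x hx y hy hq
  obtain ⟨Z, P, hP, -, hPC⟩ := (hC.connVia hx hy).exists_isPath hx (vertsOf_subset_vertexSet hx)
  exact h.eq_of_isPath hP (hd.mono_left hPC) hq

theorem exists_image_eq (hC : G.IsCycle C) (hCL : C ⊆ L) (hx : x ∈ G.vertsOf C) :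
    q '' G.vertsOf C = {q x} := by
  refine Subset.antisymm ?_ (singleton_subset_iff.2 ⟨x, hx, rfl⟩)
  rintro _ ⟨t, ht, rfl⟩
  exact ((h.eq_iff x t).2 ((hC.connVia hx ht).mono hCL (subset_univ _))).symm

/-- A path of `G` projects to a path of the contracted graph. -/
theorem isPath_contr (hP : G.IsPath x y Z P) :
    (G.contr L q).IsPath (q x) (q y) (q '' Z) (P \ L) := by
  induction hP with
  | nil x hx =>
    rw [image_singleton, empty_sdiff]
    exact .nil _ ⟨x, hx, rfl⟩
  | cons x y z e X P he hP hx ih =>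
    rw [image_insert_eq]
    by_cases heL : e ∈ L
    · rw [insert_sdiff_of_mem _ heL, h.eq_of_isLink he heL,
        insert_eq_of_mem (mem_image_of_mem q hP.left_mem)]
      exact ih
    · rw [insert_sdiff_of_notMem _ heL]
      refine ih.cons _ _ _ _ _ _ (he.contr heL) ?_
      rintro ⟨u, hu, hq⟩
      -- If the path met the component of `x` again at `u`, its part from `x` to `u`, with first
      -- edge `e`, would lie in `L`.
      obtain ⟨Z₁, P₁, Z₂, P₂, h1, -, -, rfl, -⟩ := hP.split hu
      have := h1.cons _ _ _ _ _ _ he fun hh => hx (Or.inl hh)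
      exact heL (h.isPath_subset this hq.symm (mem_insert _ _))

/-- A path of the contracted graph lifts to a path of `G` with given ends. -/
theorem exists_isPath_lift (hP : (G.contr L q).IsPath a b Z' P) (hx : x ∈ V(G)) (hxa : q x = a)
    (hyb : q y = b) : ∃ Z Q, G.IsPath x y Z Q ∧ Q \ L = P ∧ q '' Z = Z' := by
  induction hP generalizing x with
  | nil a ha =>
    obtain ⟨Z, Q, hQ, hQL, hZ⟩ := h.exists_isPath (hxa.trans hyb.symm) hx
    exact ⟨Z, Q, hQ, sdiff_eq_empty.2 hQL, hZ.trans (by rw [hxa])⟩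
  | cons a c b e X P he hP ha ih =>
    obtain ⟨s, t, hl, heL, hs, ht⟩ := contr_isLink.1 he
    obtain ⟨Z, Q, hQ, rfl, rfl⟩ := ih hl.right_mem ht hyb
    obtain ⟨Y, R, hR, hRL, hY⟩ := h.exists_isPath (hxa.trans hs.symm) hx
    rw [hxa] at hY
    have hYZ : ∀ u ∈ Y, u ∉ Z := fun u hu huZ =>
      ha ⟨u, huZ, hY.subset (mem_image_of_mem q hu)⟩
    refine ⟨Y ∪ insert s Z, R ∪ insert e Q, hR.append (hQ.cons _ _ _ _ _ _ hl
      (hYZ s hR.right_mem)) ?_, ?_, ?_⟩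
    · rintro u ⟨hu, rfl | hu'⟩
      · rfl
      · exact absurd hu' (hYZ u hu)
    · rw [union_sdiff_distrib, sdiff_eq_empty.2 hRL, empty_union, insert_sdiff_of_notMem _ heL]
    · rw [image_union, hY, image_insert_eq, hs, singleton_union, insert_eq_of_mem (mem_insert _ _)]

/-- The lifted closed path is a cycle through an edge outside `L`, so it avoids `L`: the lift needed
no detours. -/
theorem isCycle_contr_iff : (G.contr L q).IsCycle C ↔ G.IsCycle C ∧ Disjoint C L := by
  constructor
  · rintro ⟨a, b, Z, P, e, hP, heP, hl, rfl⟩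
    obtain ⟨s, t, hst, heL, rfl, rfl⟩ := contr_isLink.1 hl
    obtain ⟨Y, Q, hQ, rfl, rfl⟩ := h.exists_isPath_lift hP hst.right_mem rfl rfl
    have heQ : e ∉ Q := fun hh => heP ⟨hh, heL⟩
    have hC := hQ.isCycle hst heQ
    have hd := h.disjoint_of_isCycle hC (mem_insert _ _) heL
    rw [sdiff_eq_left.2 (hd.mono_left (subset_insert _ _))]
    exact ⟨hC, hd⟩
  · rintro ⟨⟨x, y, Z, P, e, hP, heP, hl, rfl⟩, hd⟩
    have := h.isPath_contr hP
    rw [sdiff_eq_left.2 (hd.mono_left (subset_insert _ _))] at this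
    exact this.isCycle (hl.contr (disjoint_left.1 hd (mem_insert _ _))) heP

/-- Any two vertices of a theta lie on one of its three cycles. -/
theorem injOn_theta {P₁ P₂ P₃ : Set α} (h12 : G.IsCycle (P₁ ∪ P₂)) (h13 : G.IsCycle (P₁ ∪ P₃))
    (h23 : G.IsCycle (P₂ ∪ P₃)) (hd : Disjoint (P₁ ∪ P₂ ∪ P₃) L) :
    InjOn q (G.vertsOf (P₁ ∪ P₂ ∪ P₃)) := by
  have d12 := h.injOn_vertsOf h12 (hd.mono_left subset_union_left)
  have d13 := h.injOn_vertsOf h13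
    (hd.mono_left (union_subset_union_left _ subset_union_left))
  have d23 := h.injOn_vertsOf h23
    (hd.mono_left (union_subset_union_left _ subset_union_right))
  simp only [vertsOf_union] at d12 d13 d23 ⊢
  rintro x ((hx | hx) | hx) y ((hy | hy) | hy) hq
  · exact d12 (Or.inl hx) (Or.inl hy) hq
  · exact d12 (Or.inl hx) (Or.inr hy) hq
  · exact d13 (Or.inl hx) (Or.inr hy) hq
  · exact d12 (Or.inr hx) (Or.inl hy) hq
  · exact d12 (Or.inr hx) (Or.inr hy) hq
  · exact d23 (Or.inl hx) (Or.inr hy) hq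
  · exact d13 (Or.inr hx) (Or.inl hy) hq
  · exact d23 (Or.inr hx) (Or.inl hy) hq
  · exact d23 (Or.inr hx) (Or.inr hy) hq

theorem isTheta_contr_iff {P₁ P₂ P₃ : Set α} :
    (G.contr L q).IsTheta P₁ P₂ P₃ ↔ G.IsTheta P₁ P₂ P₃ ∧ Disjoint (P₁ ∪ P₂ ∪ P₃) L := by
  constructor
  · intro ht
    have hd : Disjoint (P₁ ∪ P₂ ∪ P₃) L :=
      disjoint_sdiff_left.mono_left (ht.subset_edgeSet.trans edgeSet_contr.le)
    refine ⟨?_, hd⟩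
    have hinj := h.injOn_theta (h.isCycle_contr_iff.1 ht.isCycle₁₂).1
      (h.isCycle_contr_iff.1 ht.perm₁₃₂.isCycle₁₂).1
      (h.isCycle_contr_iff.1 ht.perm₂₁₃.perm₁₃₂.isCycle₁₂).1 hd
    obtain ⟨a, b, X₁, X₂, X₃, hab, h1, h2, h3, h12, h13, h23, hdis⟩ := ht
    have hv : G.vertsOf P₁ ⊆ G.vertsOf (P₁ ∪ P₂ ∪ P₃) :=
      vertsOf_mono (subset_union_left.trans subset_union_left)
    have hX₁ := (h1.vertsOf_eq (h1.nonempty_of_ne hab)).symm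
    rw [vertsOf_contr (hd.mono_left (subset_union_left.trans subset_union_left))] at hX₁
    obtain ⟨u, hu, hua⟩ := hX₁.subset h1.left_mem
    obtain ⟨v, hv', hvb⟩ := hX₁.subset h1.right_mem
    have huG := vertsOf_subset_vertexSet hu
    obtain ⟨Y₁, hY₁, k1, rfl⟩ := h1.of_contr hinj hv (hv hu) huG (hv hv') hua hvb
    obtain ⟨Y₂, hY₂, k2, rfl⟩ := h2.of_contr hinj
      (vertsOf_mono (subset_union_right.trans subset_union_left)) (hv hu) huG (hv hv') hua hvb
    obtain ⟨Y₃, hY₃, k3, rfl⟩ := h3.of_contr hinj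
      (vertsOf_mono subset_union_right) (hv hu) huG (hv hv') hua hvb
    have key : ∀ {Y Y' Q Q'}, G.IsPath u v Y Q → G.IsPath u v Y' Q' →
        Y ⊆ G.vertsOf (P₁ ∪ P₂ ∪ P₃) → q '' Y ∩ q '' Y' = {a, b} → Y ∩ Y' = {u, v} := by
      intro Y Y' Q Q' hY hY' hYS hI
      refine Subset.antisymm ?_ (insert_subset ⟨hY.left_mem, hY'.left_mem⟩
        (singleton_subset_iff.2 ⟨hY.right_mem, hY'.right_mem⟩))
      rintro t ⟨ht, ht'⟩
      rcases hI.subset ⟨mem_image_of_mem q ht, mem_image_of_mem q ht'⟩ with hta | htb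
      · exact Or.inl (hinj (hYS ht) (hv hu) (hta.trans hua.symm))
      · exact Or.inr (hinj (hYS ht) (hv hv') (htb.trans hvb.symm))
    refine ⟨u, v, Y₁, Y₂, Y₃, ?_, k1, k2, k3, key k1 k2 hY₁ h12, key k1 k3 hY₁ h13,
      key k2 k3 hY₂ h23, hdis⟩
    rintro rfl
    exact hab (hua.symm.trans hvb)
  · rintro ⟨ht, hd⟩
    have hinj := h.injOn_theta ht.isCycle₁₂ ht.perm₁₃₂.isCycle₁₂ ht.perm₂₁₃.perm₁₃₂.isCycle₁₂ hd
    obtain ⟨u, v, X₁, X₂, X₃, huv, h1, h2, h3, h12, h13, h23, hdis⟩ := ht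
    have key : ∀ {X Q}, G.IsPath u v X Q → Q ⊆ P₁ ∪ P₂ ∪ P₃ →
        (G.contr L q).IsPath (q u) (q v) (q '' X) Q ∧ X ⊆ G.vertsOf (P₁ ∪ P₂ ∪ P₃) := by
      intro X Q hQ hQs
      have := h.isPath_contr hQ
      rw [sdiff_eq_left.2 (hd.mono_left hQs)] at this
      refine ⟨this, ?_⟩
      rw [← hQ.vertsOf_eq (hQ.nonempty_of_ne huv)]
      exact vertsOf_mono hQs
    obtain ⟨k1, s1⟩ := key h1 (subset_union_left.trans subset_union_left)
    obtain ⟨k2, s2⟩ := key h2 (subset_union_right.trans subset_union_left)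
    obtain ⟨k3, s3⟩ := key h3 subset_union_right
    refine ⟨q u, q v, _, _, _, fun hh => huv (hinj (s1 h1.left_mem) (s1 h1.right_mem) hh),
      k1, k2, k3, ?_, ?_, ?_, hdis⟩
    · rw [← hinj.image_inter s1 s2, h12, image_pair]
    · rw [← hinj.image_inter s1 s3, h13, image_pair]
    · rw [← hinj.image_inter s2 s3, h23, image_pair]

theorem isBiased_contr (hB : G.IsBiased B) :
    (G.contr L q).IsBiased (restrictCycles B Lᶜ) where
  isCycle C hC := h.isCycle_contr_iff.2 ⟨hB.isCycle C hC.1, disjoint_left.2 hC.2⟩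
  theta P₁ P₂ P₃ ht h12 h13 :=
    ⟨hB.theta P₁ P₂ P₃ (h.isTheta_contr_iff.1 ht).1 h12.1 h13.1,
      union_subset (subset_union_right.trans h12.2) (subset_union_right.trans h13.2)⟩

theorem isUnbalanced_contr_iff : (G.contr L q).IsUnbalanced (restrictCycles B Lᶜ) C ↔
    G.IsUnbalanced B C ∧ Disjoint C L := by
  rw [IsUnbalanced, IsUnbalanced, h.isCycle_contr_iff]
  constructor
  · rintro ⟨⟨h1, h2⟩, h3⟩
    exact ⟨⟨h1, fun h => h3 ⟨h, subset_compl_iff_disjoint_right.2 h2⟩⟩, h2⟩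
  · rintro ⟨⟨h1, h3⟩, h2⟩
    exact ⟨⟨h1, h2⟩, fun h => h3 h.1⟩

theorem subset_fiber_iff (hC : G.IsCycle C) (hx : x ∈ G.vertsOf C) :
    C ⊆ E(G.fiber L q a) ↔ C ⊆ L ∧ q x = a := by
  constructor
  · intro hs
    have hCL : C ⊆ L := fun e he => (h.mem_fiber_iff.1 (hs he)).1
    refine ⟨hCL, ?_⟩
    obtain ⟨e, he⟩ := hC.nonempty
    obtain ⟨-, t, ht, rfl⟩ := h.mem_fiber_iff.1 (hs he)
    exact ((h.exists_image_eq hC hCL hx).subset (mem_image_of_mem q ⟨e, he, ht⟩)).symm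
  · rintro ⟨hCL, rfl⟩ e he
    obtain ⟨s, t, hl⟩ := exists_isLink_of_mem_edgeSet (hC.subset_edgeSet he)
    exact h.mem_fiber_iff.2 ⟨hCL he, s, hl.inc_left, (h.exists_image_eq hC hCL hx).subset
      (mem_image_of_mem q (hl.left_mem_vertsOf he))⟩

end IsBlockContraction

end Graph

/-! ### Circuits of the contraction and its fibers versus cycles, thetas and handcuffs of `G` -/

namespace Graph

variable {V V' α : Type*} {G : Graph V α} {x y z u v w : V} {e f : α} {Y Z : Set V}
  {P Q C C₁ C₂ D L : Set α} {B : Set (Set α)} {a b : V'} {Z' : Set V'} {q : V → V'}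

theorem IsUnbalancedTheta.mono {H : Graph V' α} {B' : Set (Set α)} {X : Set α}
    (hX : G.IsUnbalancedTheta B X)
    (hG : ∀ P₁ P₂ P₃, G.IsTheta P₁ P₂ P₃ → X = P₁ ∪ P₂ ∪ P₃ → H.IsTheta P₁ P₂ P₃)
    (hB : ∀ C ∈ B', C ⊆ X → C ∈ B) : H.IsUnbalancedTheta B' X := by
  obtain ⟨P₁, P₂, P₃, ht, h12, h13, h23, rfl⟩ := hX
  exact ⟨P₁, P₂, P₃, hG _ _ _ ht rfl, fun h => h12 (hB _ h subset_union_left),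
    fun h => h13 (hB _ h (union_subset_union_left _ subset_union_left)),
    fun h => h23 (hB _ h (union_subset_union_left _ subset_union_right)), rfl⟩

theorem IsCycle.exists_isPath (hC : G.IsCycle C) (hx : x ∈ G.vertsOf C) (hy : y ∈ G.vertsOf C) :
    ∃ Z P, G.IsPath x y Z P ∧ Z ⊆ G.vertsOf C ∧ P ⊆ C :=
  (hC.connVia hx hy).exists_isPath hx (vertsOf_subset_vertexSet hx)

theorem image_vertsOf_subset_contr : q '' G.vertsOf C ⊆ V(G.contr L q) :=
  image_mono (vertsOf_subset_vertexSet (G := G))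

namespace IsBlockContraction

variable (h : G.IsBlockContraction L q)
include h

/-- Going along `C` from `u` to `x` and then along `P` gives a path with identified ends. It lies in
`L`, so it has no edge of `C`. -/
theorem eq_of_isCycle_isPath (hC : G.IsCycle C) (hd : Disjoint C L) (hP : G.IsPath x y Z P)
    (hZ : Z ∩ G.vertsOf C = {x}) (hu : u ∈ G.vertsOf C) (hq : q u = q y) : u = x := by
  by_contra hne
  obtain ⟨Y, Q, hQ, hY, hQC⟩ := hC.exists_isPath hu (hZ.superset rfl).2
  obtain ⟨e, he⟩ := hQ.nonempty_of_ne hne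
  have := hQ.append hP fun t ht => hZ.subset ⟨ht.2, hY ht.1⟩
  exact disjoint_left.1 hd (hQC he) (h.isPath_subset this hq (Or.inl he))

/-- Two vertex-disjoint unbalanced cycles that are joined by a path of the contracted graph form
a loose handcuff. -/
theorem exists_isLoose (h₁ : G.IsUnbalanced B C₁) (h₂ : G.IsUnbalanced B C₂)
    (hdis : Disjoint (G.vertsOf C₁) (G.vertsOf C₂)) (hP : (G.contr L q).IsPath a b Z' P)
    (ha : Z' ∩ q '' G.vertsOf C₁ = {a}) (hb : Z' ∩ q '' G.vertsOf C₂ = {b}) :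
    ∃ x y Z Q, G.IsLoose B C₁ C₂ x y Z Q ∧ P = Q \ L := by
  obtain ⟨x₀, hx₀, hxa⟩ := (ha.superset rfl).2
  obtain ⟨y₀, hy₀, hyb⟩ := (hb.superset rfl).2
  obtain ⟨Z₀, Q₀, hQ₀, rfl, rfl⟩ :=
    h.exists_isPath_lift hP (vertsOf_subset_vertexSet hx₀) hxa hyb
  obtain ⟨x, hx, y, hy, Z, Q, hQ, hZ, hQQ, hZx, hZy⟩ := hQ₀.exists_minimal hx₀ hy₀
  have hqx : q x = a := ha.subset
    ⟨mem_image_of_mem q (hZ hQ.left_mem), mem_image_of_mem q hx⟩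
  have hqy : q y = b := hb.subset
    ⟨mem_image_of_mem q (hZ hQ.right_mem), mem_image_of_mem q hy⟩
  refine ⟨x, y, Z, Q, ⟨h₁, h₂, hdis, hQ, hZx, hZy⟩, ?_⟩
  -- Trimming the lifted path loses only edges of `L`, because its projection still has the ends of
  -- `P` and is contained in `P`.
  have := h.isPath_contr hQ
  rw [hqx, hqy] at this
  exact (this.eq_of_subset hP (sdiff_subset_sdiff_left hQQ)).symm

theorem image_vertsOf_fiber (hC : G.IsCycle C) (hf : C ⊆ E(G.fiber L q a)) :
    q '' G.vertsOf C = {a} := by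
  obtain ⟨x, hx⟩ := hC.vertsOf_nonempty
  obtain ⟨hCL, rfl⟩ := (h.subset_fiber_iff hC hx).1 hf
  exact h.exists_image_eq hC hCL hx

theorem image_inter_of_isLoose (hl : G.IsLoose B C₁ C₂ x y Z P) (hd : Disjoint C₁ L) :
    q '' Z ∩ q '' G.vertsOf C₁ = {q x} := by
  refine Subset.antisymm ?_ (singleton_subset_iff.2
    ⟨mem_image_of_mem q hl.isPath.left_mem, mem_image_of_mem q hl.mem_left⟩)
  rintro _ ⟨⟨t, ht, rfl⟩, u, hu, hq⟩
  obtain ⟨Z₁, P₁, Z₂, P₂, h1, -, -, rfl, -⟩ := hl.isPath.split ht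
  have hx : Z₁ ∩ G.vertsOf C₁ = {x} :=
    ((inter_subset_inter_left _ subset_union_left).trans hl.inter₁.le).antisymm
      (singleton_subset_iff.2 ⟨h1.left_mem, hl.mem_left⟩)
  rw [← h.eq_of_isCycle_isPath hl.unb₁.1 hd h1 hx hu hq, hq]
  rfl

theorem eq_of_isLoose (hl : G.IsLoose B C₁ C₂ x y Z P) (hd : Disjoint C₁ L)
    (hu : u ∈ G.vertsOf C₁) (hw : w ∈ G.vertsOf C₂) (hq : q u = q w) : u = x := by
  obtain ⟨Y, Q, hQ, hY, -⟩ := hl.unb₂.1.exists_isPath hl.symm.mem_left hw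
  refine h.eq_of_isCycle_isPath hl.unb₁.1 hd
    (hl.isPath.append hQ fun t ht => hl.inter₂.subset ⟨ht.1, hY ht.2⟩) ?_ hu hq
  rw [union_inter_distrib_right, hl.inter₁,
    (hl.disj.symm.mono_left hY).inter_eq, union_empty]

/-- The delicate case is a tight handcuff. Its cycles either meet in `G` already or are joined by a
path within `L`, and then they form a loose handcuff whose path is deleted completely. -/
theorem circuit_of_isFrameCircuit (hD : (G.contr L q).IsFrameCircuit (restrictCycles B Lᶜ) D) :
    D ∈ B ∨ G.IsUnbalancedTheta B D ∨ G.IsTightHandcuff B D ∨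
      ∃ C₁ C₂ x y Z P, G.IsLoose B C₁ C₂ x y Z P ∧ D = C₁ ∪ C₂ ∪ P \ L := by
  rcases hD with hD | hD | ⟨C₁, C₂, h₁, h₂, hd, ⟨a, ha⟩, rfl⟩ |
    ⟨C₁, C₂, a, b, Z, P, h₁, h₂, hd, hP, ha, hb, rfl⟩
  · exact Or.inl hD.1
  · refine Or.inr (Or.inl (hD.mono (fun _ _ _ ht _ => (h.isTheta_contr_iff.1 ht).1)
      fun C hC hCD => ⟨hC, hCD.trans ?_⟩))
    obtain ⟨P₁, P₂, P₃, ht, -, -, -, rfl⟩ := hD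
    exact subset_compl_iff_disjoint_right.2 (h.isTheta_contr_iff.1 ht).2
  · obtain ⟨h₁, d₁⟩ := h.isUnbalanced_contr_iff.1 h₁
    obtain ⟨h₂, d₂⟩ := h.isUnbalanced_contr_iff.1 h₂
    rw [vertsOf_contr d₁, vertsOf_contr d₂] at ha
    have haa := ha.superset (rfl : a = a)
    by_cases hdis : Disjoint (G.vertsOf C₁) (G.vertsOf C₂)
    · have haV : a ∈ V(G.contr L q) := image_vertsOf_subset_contr haa.1
      obtain ⟨x, y, Z, Q, hl, hQ⟩ := h.exists_isLoose h₁ h₂ hdis (.nil a haV)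
        (inter_eq_left.2 (singleton_subset_iff.2 haa.1))
        (inter_eq_left.2 (singleton_subset_iff.2 haa.2))
      exact Or.inr (Or.inr (Or.inr ⟨C₁, C₂, x, y, Z, Q, hl, by rw [← hQ, union_empty]⟩))
    · obtain ⟨t, ht₁, ht₂⟩ := not_disjoint_iff.1 hdis
      refine Or.inr (Or.inr (Or.inl ⟨C₁, C₂, h₁, h₂, hd, ⟨t, ?_⟩, rfl⟩))
      refine Subset.antisymm (fun s hs => ?_) (singleton_subset_iff.2 ⟨ht₁, ht₂⟩)
      refine h.injOn_vertsOf h₁.1 d₁ hs.1 ht₁ ?_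
      rw [ha.subset ⟨mem_image_of_mem q hs.1, mem_image_of_mem q hs.2⟩]
      exact (ha.subset ⟨mem_image_of_mem q ht₁, mem_image_of_mem q ht₂⟩).symm
  · obtain ⟨h₁, d₁⟩ := h.isUnbalanced_contr_iff.1 h₁
    obtain ⟨h₂, d₂⟩ := h.isUnbalanced_contr_iff.1 h₂
    rw [vertsOf_contr d₁] at hd ha
    rw [vertsOf_contr d₂] at hd hb
    obtain ⟨x, y, Z, Q, hl, rfl⟩ := h.exists_isLoose h₁ h₂ (Disjoint.of_image hd) hP ha hb
    exact Or.inr (Or.inr (Or.inr ⟨C₁, C₂, x, y, Z, Q, hl, rfl⟩))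

/-- Disjoint unbalanced cycles in one fiber are joined by a path in `L`, so a bracelet is a loose
handcuff with its whole path deleted. -/
theorem circuit_of_isLiftCircuit
    (hD : (G.fiber L q a).IsLiftCircuit (restrictCycles B E(G.fiber L q a)) D) :
    D ∈ B ∨ G.IsUnbalancedTheta B D ∨ G.IsTightHandcuff B D ∨
      ∃ C₁ C₂ x y Z P, G.IsLoose B C₁ C₂ x y Z P ∧ D = C₁ ∪ C₂ ∪ P \ L := by
  rcases hD with hD | hD | ⟨C₁, C₂, h₁, h₂, hd, hv, rfl⟩ | ⟨C₁, C₂, h₁, h₂, hd, rfl⟩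
  · exact Or.inl hD.1
  · refine Or.inr (Or.inl (hD.mono (fun _ _ _ ht _ => ht.of_le fiber_le)
      fun C hC hCD => ⟨hC, hCD.trans ?_⟩))
    obtain ⟨P₁, P₂, P₃, ht, -, -, -, rfl⟩ := hD
    exact ht.subset_edgeSet
  · obtain ⟨h₁, d₁⟩ := (isUnbalanced_iff_of_le fiber_le).1 h₁
    obtain ⟨h₂, d₂⟩ := (isUnbalanced_iff_of_le fiber_le).1 h₂
    rw [vertsOf_of_le fiber_le d₁, vertsOf_of_le fiber_le d₂] at hv
    exact Or.inr (Or.inr (Or.inl ⟨C₁, C₂, h₁, h₂, hd, hv, rfl⟩))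
  · obtain ⟨h₁, d₁⟩ := (isUnbalanced_iff_of_le fiber_le).1 h₁
    obtain ⟨h₂, d₂⟩ := (isUnbalanced_iff_of_le fiber_le).1 h₂
    rw [vertsOf_of_le fiber_le d₁, vertsOf_of_le fiber_le d₂] at hd
    have k₁ := h.image_vertsOf_fiber h₁.1 d₁
    have k₂ := h.image_vertsOf_fiber h₂.1 d₂
    have haV : a ∈ V(G.contr L q) := image_vertsOf_subset_contr (k₁.superset rfl)
    obtain ⟨x, y, Z, Q, hl, hQ⟩ := h.exists_isLoose h₁ h₂ hd (.nil a haV)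
      (by rw [k₁, inter_self]) (by rw [k₂, inter_self])
    exact Or.inr (Or.inr (Or.inr ⟨C₁, C₂, x, y, Z, Q, hl, by rw [← hQ, union_empty]⟩))

theorem circuit_of_isBrokenHandcuffOne
    (hD : (G.contr L q).IsBrokenHandcuffOne (restrictCycles B Lᶜ) (G.fiber L q)
      (fun a => restrictCycles B E(G.fiber L q a)) D) :
    G.IsTightHandcuff B D ∨
      ∃ C₁ C₂ x y Z P, G.IsLoose B C₁ C₂ x y Z P ∧ D = C₁ ∪ C₂ ∪ P \ L := by
  obtain ⟨a, ha, C, C', y, Z, P, h₁, h₂, hP, hy, rfl⟩ := hD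
  obtain ⟨h₁, d₁⟩ := h.isUnbalanced_contr_iff.1 h₁
  obtain ⟨h₂, d₂⟩ := (isUnbalanced_iff_of_le fiber_le).1 h₂
  rw [vertsOf_contr d₁] at hy
  have k₂ := h.image_vertsOf_fiber h₂.1 d₂
  by_cases hdis : Disjoint (G.vertsOf C) (G.vertsOf C')
  · obtain ⟨x, y, Z, Q, hl, rfl⟩ := h.exists_isLoose h₁ h₂ hdis hP.reverse hy
      (by rw [k₂]; exact inter_eq_right.2 (singleton_subset_iff.2 hP.left_mem))
    exact Or.inr ⟨C, C', x, y, Z, Q, hl, rfl⟩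
  · obtain ⟨t, ht₁, ht₂⟩ := not_disjoint_iff.1 hdis
    have hta : q t = a := k₂.subset (mem_image_of_mem q ht₂)
    obtain rfl : a = y := hy.subset ⟨hP.left_mem, hta ▸ mem_image_of_mem q ht₁⟩
    rw [hP.eq_nil.2, union_empty]
    refine Or.inl ⟨C, C', h₁, h₂, d₁.mono_right fun e he => (h.mem_fiber_iff.1 (d₂ he)).1, ⟨t, ?_⟩,
      rfl⟩
    refine Subset.antisymm (fun s hs => ?_) (singleton_subset_iff.2 ⟨ht₁, ht₂⟩)
    exact h.injOn_vertsOf h₁.1 d₁ hs.1 ht₁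
      ((k₂.subset (mem_image_of_mem q hs.2) : q s = a).trans hta.symm)

theorem circuit_of_isBrokenHandcuffTwo
    (hD : (G.contr L q).IsBrokenHandcuffTwo (G.fiber L q)
      (fun a => restrictCycles B E(G.fiber L q a)) D) :
    ∃ C₁ C₂ x y Z P, G.IsLoose B C₁ C₂ x y Z P ∧ D = C₁ ∪ C₂ ∪ P \ L := by
  obtain ⟨a, -, b, -, hab, C, C', Z, P, h₁, h₂, hP, rfl⟩ := hD
  obtain ⟨h₁, d₁⟩ := (isUnbalanced_iff_of_le fiber_le).1 h₁
  obtain ⟨h₂, d₂⟩ := (isUnbalanced_iff_of_le fiber_le).1 h₂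
  have k₁ := h.image_vertsOf_fiber h₁.1 d₁
  have k₂ := h.image_vertsOf_fiber h₂.1 d₂
  have hdis : Disjoint (G.vertsOf C) (G.vertsOf C') := by
    refine disjoint_left.2 fun t ht ht' => hab ?_
    exact (k₁.subset (mem_image_of_mem q ht) : q t = a).symm.trans
      (k₂.subset (mem_image_of_mem q ht'))
  obtain ⟨x, y, Z, Q, hl, rfl⟩ := h.exists_isLoose h₁ h₂ hdis hP
    (by rw [k₁]; exact inter_eq_right.2 (singleton_subset_iff.2 hP.left_mem))
    (by rw [k₂]; exact inter_eq_right.2 (singleton_subset_iff.2 hP.right_mem))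
  exact ⟨C, C', x, y, Z, Q, hl, rfl⟩

theorem circuit_of_mem (hB : ∀ C ∈ B, G.IsCycle C) (hD : D ∈ B) :
    (G.contr L q).IsFrameCircuit (restrictCycles B Lᶜ) D ∨ ∃ a ∈ V(G.contr L q),
      (G.fiber L q a).IsLiftCircuit (restrictCycles B E(G.fiber L q a)) D := by
  obtain ⟨x, hx⟩ := (hB D hD).vertsOf_nonempty
  rcases h.subset_or_disjoint (hB D hD) with hL | hd
  · exact Or.inr ⟨q x, image_vertsOf_subset_contr (mem_image_of_mem q hx),
      Or.inl ⟨hD, (h.subset_fiber_iff (hB D hD) hx).2 ⟨hL, rfl⟩⟩⟩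
  · exact Or.inl (Or.inl ⟨hD, subset_compl_iff_disjoint_right.2 hd⟩)

/-- Two cycles of the theta share `P₁` and cover it, so all of it lies in `L` or all of it avoids
`L`. -/
theorem circuit_of_isUnbalancedTheta (hD : G.IsUnbalancedTheta B D) :
    (G.contr L q).IsFrameCircuit (restrictCycles B Lᶜ) D ∨ ∃ a ∈ V(G.contr L q),
      (G.fiber L q a).IsLiftCircuit (restrictCycles B E(G.fiber L q a)) D := by
  have hD' := hD
  obtain ⟨P₁, P₂, P₃, ht, -, -, -, rfl⟩ := hD'
  obtain ⟨e, he⟩ := ht.nonempty₁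
  obtain ⟨x, y, hl⟩ := exists_isLink_of_mem_edgeSet (ht.isCycle₁₂.subset_edgeSet (Or.inl he))
  have hx12 : x ∈ G.vertsOf (P₁ ∪ P₂) := hl.left_mem_vertsOf (Or.inl he)
  have hx13 : x ∈ G.vertsOf (P₁ ∪ P₃) := hl.left_mem_vertsOf (Or.inl he)
  by_cases heL : e ∈ L
  · have h12 := (h.subset_fiber_iff (a := q x) ht.isCycle₁₂ hx12).2
      ⟨h.subset _ ht.isCycle₁₂ e (Or.inl he) heL, rfl⟩
    have h13 := (h.subset_fiber_iff (a := q x) ht.perm₁₃₂.isCycle₁₂ hx13).2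
      ⟨h.subset _ ht.perm₁₃₂.isCycle₁₂ e (Or.inl he) heL, rfl⟩
    have hs := union_subset h12 (subset_union_right.trans h13)
    exact Or.inr ⟨q x, ⟨x, hl.left_mem, rfl⟩, Or.inr (Or.inl (hD.mono
      (fun Q₁ Q₂ Q₃ hQ hQe => hQ.anti fiber_le (hQe ▸ hs)) fun C hC _ => hC.1))⟩
  · have h12 := h.disjoint_of_isCycle ht.isCycle₁₂ (Or.inl he) heL
    have h13 := h.disjoint_of_isCycle ht.perm₁₃₂.isCycle₁₂ (Or.inl he) heL
    have hs := h12.union_left (h13.mono_left subset_union_right)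
    exact Or.inl (Or.inr (Or.inl (hD.mono (fun Q₁ Q₂ Q₃ hQ hQe =>
      h.isTheta_contr_iff.2 ⟨hQ, hQe ▸ hs⟩) fun C hC _ => hC.1)))

theorem circuit_of_isTightHandcuff (hD : G.IsTightHandcuff B D) :
    (G.contr L q).IsFrameCircuit (restrictCycles B Lᶜ) D ∨ (∃ a ∈ V(G.contr L q),
      (G.fiber L q a).IsLiftCircuit (restrictCycles B E(G.fiber L q a)) D) ∨
      (G.contr L q).IsBrokenHandcuffOne (restrictCycles B Lᶜ) (G.fiber L q)
      (fun a => restrictCycles B E(G.fiber L q a)) D := by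
  obtain ⟨C₁, C₂, h₁, h₂, hd, ⟨v, hv⟩, rfl⟩ := hD
  have hvv := hv.superset (rfl : v = v)
  have hqv : q v ∈ V(G.contr L q) := image_vertsOf_subset_contr (mem_image_of_mem q hvv.1)
  have key : ∀ C₁ C₂, G.IsUnbalanced B C₁ → G.IsUnbalanced B C₂ →
      G.vertsOf C₁ ∩ G.vertsOf C₂ = {v} → Disjoint C₁ L → C₂ ⊆ L →
      (G.contr L q).IsBrokenHandcuffOne (restrictCycles B Lᶜ) (G.fiber L q)
      (fun a => restrictCycles B E(G.fiber L q a)) (C₁ ∪ C₂) := by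
    intro C₁ C₂ h₁ h₂ hv d₁ d₂
    have hvv := hv.superset (rfl : v = v)
    refine ⟨q v, hqv, C₁, C₂, q v, {q v}, ∅, h.isUnbalanced_contr_iff.2 ⟨h₁, d₁⟩,
      (isUnbalanced_iff_of_le fiber_le).2 ⟨h₂, (h.subset_fiber_iff h₂.1 hvv.2).2 ⟨d₂, rfl⟩⟩,
      .nil _ hqv, ?_, (union_empty _).symm⟩
    rw [vertsOf_contr d₁]
    exact inter_eq_left.2 (singleton_subset_iff.2 (mem_image_of_mem q hvv.1))
  rcases h.subset_or_disjoint h₁.1 with d₁ | d₁ <;> rcases h.subset_or_disjoint h₂.1 with d₂ | d₂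
  · have k₁ := (h.subset_fiber_iff h₁.1 hvv.1).2 ⟨d₁, rfl⟩
    have k₂ := (h.subset_fiber_iff h₂.1 hvv.2).2 ⟨d₂, rfl⟩
    refine Or.inr (Or.inl ⟨q v, hqv, Or.inr (Or.inr (Or.inl ⟨C₁, C₂,
      (isUnbalanced_iff_of_le fiber_le).2 ⟨h₁, k₁⟩,
      (isUnbalanced_iff_of_le fiber_le).2 ⟨h₂, k₂⟩, hd, ⟨v, ?_⟩, rfl⟩))⟩)
    rw [vertsOf_of_le fiber_le k₁, vertsOf_of_le fiber_le k₂, hv]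
  · rw [union_comm]
    rw [inter_comm] at hv
    exact Or.inr (Or.inr (key _ _ h₂ h₁ hv d₂ d₁))
  · exact Or.inr (Or.inr (key _ _ h₁ h₂ hv d₁ d₂))
  · refine Or.inl (Or.inr (Or.inr (Or.inl ⟨C₁, C₂, h.isUnbalanced_contr_iff.2 ⟨h₁, d₁⟩,
      h.isUnbalanced_contr_iff.2 ⟨h₂, d₂⟩, hd, ⟨q v, ?_⟩, rfl⟩)))
    rw [vertsOf_contr d₁, vertsOf_contr d₂]
    refine Subset.antisymm ?_ (singleton_subset_iff.2
      ⟨mem_image_of_mem q hvv.1, mem_image_of_mem q hvv.2⟩)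
    rintro _ ⟨⟨s, hs, rfl⟩, t, ht, hq⟩
    obtain ⟨Z, P, hP, hZ, -⟩ := h₂.1.exists_isPath hvv.2 ht
    rw [h.eq_of_isCycle_isPath h₁.1 d₁ hP ?_ hs hq.symm]
    · rfl
    · exact Subset.antisymm (fun r hr => hv.subset ⟨hr.2, hZ hr.1⟩)
        (singleton_subset_iff.2 ⟨hP.left_mem, hvv.1⟩)

/-- Each of the two cycles lies in `L` or avoids it. Both in `L`: a bracelet in a fiber if `q x = q
y`, else a broken handcuff at two vertices. One in `L`: a broken handcuff at one vertex. None: a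
tight handcuff of the contraction if `q x = q y`, else a loose one. -/
theorem circuit_of_isLoose (hl : G.IsLoose B C₁ C₂ x y Z P) :
    (G.contr L q).IsFrameCircuit (restrictCycles B Lᶜ) (C₁ ∪ C₂ ∪ P \ L) ∨
      (∃ a ∈ V(G.contr L q), (G.fiber L q a).IsLiftCircuit
        (restrictCycles B E(G.fiber L q a)) (C₁ ∪ C₂ ∪ P \ L)) ∨
      (G.contr L q).IsBrokenHandcuffOne (restrictCycles B Lᶜ) (G.fiber L q)
        (fun a => restrictCycles B E(G.fiber L q a)) (C₁ ∪ C₂ ∪ P \ L) ∨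
      (G.contr L q).IsBrokenHandcuffTwo (G.fiber L q)
        (fun a => restrictCycles B E(G.fiber L q a)) (C₁ ∪ C₂ ∪ P \ L) := by
  have hqV : ∀ {u}, u ∈ Z → q u ∈ V(G.contr L q) := fun hu =>
    ⟨_, hl.isPath.subset_vertexSet hu, rfl⟩
  have hP := h.isPath_contr hl.isPath
  have key : ∀ C₁ C₂ x y, G.IsLoose B C₁ C₂ x y Z P → Disjoint C₁ L → C₂ ⊆ L →
      (G.contr L q).IsBrokenHandcuffOne (restrictCycles B Lᶜ) (G.fiber L q)
      (fun a => restrictCycles B E(G.fiber L q a)) (C₁ ∪ C₂ ∪ P \ L) := by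
    intro C₁ C₂ x y hl d₁ d₂
    refine ⟨q y, hqV hl.isPath.right_mem, C₁, C₂, q x, q '' Z, P \ L,
      h.isUnbalanced_contr_iff.2 ⟨hl.unb₁, d₁⟩, (isUnbalanced_iff_of_le fiber_le).2
      ⟨hl.unb₂, (h.subset_fiber_iff hl.unb₂.1 hl.symm.mem_left).2 ⟨d₂, rfl⟩⟩,
      h.isPath_contr hl.isPath.reverse, ?_, rfl⟩
    rw [vertsOf_contr d₁, h.image_inter_of_isLoose hl d₁]
  rcases h.subset_or_disjoint hl.unb₁.1 with d₁ | d₁ <;>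
    rcases h.subset_or_disjoint hl.unb₂.1 with d₂ | d₂
  · have k₁ := (h.subset_fiber_iff hl.unb₁.1 hl.mem_left).2 ⟨d₁, rfl⟩
    have k₂ := (h.subset_fiber_iff hl.unb₂.1 hl.symm.mem_left).2 ⟨d₂, rfl⟩
    by_cases hq : q x = q y
    · rw [← hq] at k₂
      rw [sdiff_eq_empty.2 (h.isPath_subset hl.isPath hq), union_empty]
      refine Or.inr (Or.inl ⟨q x, hqV hl.isPath.left_mem, Or.inr (Or.inr (Or.inr ⟨C₁, C₂,
        (isUnbalanced_iff_of_le fiber_le).2 ⟨hl.unb₁, k₁⟩,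
        (isUnbalanced_iff_of_le fiber_le).2 ⟨hl.unb₂, k₂⟩, ?_, rfl⟩))⟩)
      rw [vertsOf_of_le fiber_le k₁, vertsOf_of_le fiber_le k₂]
      exact hl.disj
    · exact Or.inr (Or.inr (Or.inr ⟨q x, hqV hl.isPath.left_mem, q y, hqV hl.isPath.right_mem, hq,
        C₁, C₂, q '' Z, P \ L, (isUnbalanced_iff_of_le fiber_le).2 ⟨hl.unb₁, k₁⟩,
        (isUnbalanced_iff_of_le fiber_le).2 ⟨hl.unb₂, k₂⟩, hP, rfl⟩))
  · rw [union_comm C₁]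
    exact Or.inr (Or.inr (Or.inl (key _ _ _ _ hl.symm d₂ d₁)))
  · exact Or.inr (Or.inr (Or.inl (key _ _ _ _ hl d₁ d₂)))
  · have u₁ := h.isUnbalanced_contr_iff.2 ⟨hl.unb₁, d₁⟩
    have u₂ := h.isUnbalanced_contr_iff.2 ⟨hl.unb₂, d₂⟩
    have hsub : q '' G.vertsOf C₁ ∩ q '' G.vertsOf C₂ ⊆ {q x} ∩ {q y} := by
      rintro _ ⟨⟨s, hs, rfl⟩, t, ht, hts⟩
      exact ⟨by rw [h.eq_of_isLoose hl d₁ hs ht hts.symm]; rfl,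
        by rw [← hts, h.eq_of_isLoose hl.symm d₂ ht hs hts]; rfl⟩
    by_cases hq : q x = q y
    · rw [sdiff_eq_empty.2 (h.isPath_subset hl.isPath hq), union_empty]
      refine Or.inl (Or.inr (Or.inr (Or.inl ⟨C₁, C₂, u₁, u₂, ?_, ⟨q x, ?_⟩, rfl⟩)))
      · refine disjoint_left.2 fun e he₁ he₂ => ?_
        obtain ⟨s, t, hst⟩ := exists_isLink_of_mem_edgeSet (hl.unb₁.1.subset_edgeSet he₁)
        exact disjoint_left.1 hl.disj (hst.left_mem_vertsOf he₁) (hst.left_mem_vertsOf he₂)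
      · rw [vertsOf_contr d₁, vertsOf_contr d₂]
        refine (hsub.trans inter_subset_left).antisymm (singleton_subset_iff.2
          ⟨mem_image_of_mem q hl.mem_left, ?_⟩)
        rw [hq]
        exact mem_image_of_mem q hl.symm.mem_left
    · refine Or.inl (Or.inr (Or.inr (Or.inr ⟨C₁, C₂, q x, q y, q '' Z, P \ L, u₁, u₂, ?_, hP, ?_,
        ?_, rfl⟩)))
      · rw [vertsOf_contr d₁, vertsOf_contr d₂]
        refine disjoint_iff_inter_eq_empty.2 (subset_empty_iff.1 (hsub.trans ?_))
        rintro t ⟨h1, h2⟩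
        exact hq (h1.symm.trans h2)
      · rw [vertsOf_contr d₁, h.image_inter_of_isLoose hl d₁]
      · rw [vertsOf_contr d₂, h.image_inter_of_isLoose hl.symm d₂]

end IsBlockContraction

end Graph

/-! ### Assembling the broken handcuff matroid -/

namespace Matroid

variable {α : Type*} {M : Matroid α}

theorem isBrokenHandcuff_of_isBlockContraction {V V' : Type} {G : Graph V α} {L : Set α}
    {B : Set (Set α)} {q : V → V'} (h : G.IsBlockContraction L q) (hfin : V(G).Finite)
    (hE : E(G) = M.E) (hB : G.IsBiased B)
    (hM : ∀ D, M.IsCircuit D ↔ D ∈ B ∨ G.IsUnbalancedTheta B D ∨ G.IsTightHandcuff B D ∨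
      ∃ C₁ C₂ x y Z P, G.IsLoose B C₁ C₂ x y Z P ∧ D = C₁ ∪ C₂ ∪ P \ L) :
    M.IsBrokenHandcuff := by
  refine ⟨V', V, G.contr L q, Graph.restrictCycles B Lᶜ, G.fiber L q,
    fun a => Graph.restrictCycles B E(G.fiber L q a), hfin.image q,
    fun a _ => hfin.subset Graph.fiber_le.vertexSet_mono, h.isBiased_contr hB,
    fun a _ => hB.of_le Graph.fiber_le, fun a _ => ?_, fun a _ b _ hab => ?_, ?_, fun D => ?_⟩
  · exact disjoint_sdiff_left.mono_right fun e he => (h.mem_fiber_iff.1 he).1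
  · refine disjoint_left.2 fun e ha hb => hab ?_
    obtain ⟨heL, s, hs, rfl⟩ := h.mem_fiber_iff.1 ha
    obtain ⟨-, t, ht, rfl⟩ := h.mem_fiber_iff.1 hb
    obtain ⟨r, hr⟩ := hs
    obtain rfl | rfl := ht.eq_or_eq_of_isLink hr
    exacts [rfl, h.eq_of_isLink hr heL]
  · rw [← hE]
    refine Subset.antisymm (fun e he => ?_) (union_subset sdiff_subset
      (iUnion₂_subset fun a _ => Graph.fiber_le.edgeSet_mono))
    by_cases heL : e ∈ L
    · obtain ⟨x, y, hl⟩ := Graph.exists_isLink_of_mem_edgeSet he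
      exact Or.inr (mem_iUnion₂.2 ⟨q x, ⟨x, hl.left_mem, rfl⟩,
        h.mem_fiber_iff.2 ⟨heL, x, hl.inc_left, rfl⟩⟩)
    · exact Or.inl ⟨he, heL⟩
  · rw [hM]
    constructor
    · rintro (hD | hD | hD | ⟨C₁, C₂, x, y, Z, P, hl, rfl⟩)
      · rcases h.circuit_of_mem hB.isCycle hD with h | h
        exacts [Or.inl h, Or.inr (Or.inl h)]
      · rcases h.circuit_of_isUnbalancedTheta hD with h | h
        exacts [Or.inl h, Or.inr (Or.inl h)]
      · rcases h.circuit_of_isTightHandcuff hD with h | h | h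
        exacts [Or.inl h, Or.inr (Or.inl h), Or.inr (Or.inr (Or.inl h))]
      · exact h.circuit_of_isLoose hl
    · rintro (hD | ⟨a, -, hD⟩ | hD | hD)
      · exact h.circuit_of_isFrameCircuit hD
      · exact h.circuit_of_isLiftCircuit hD
      · exact Or.inr (Or.inr (h.circuit_of_isBrokenHandcuffOne hD))
      · exact Or.inr (Or.inr (Or.inr (h.circuit_of_isBrokenHandcuffTwo hD)))

end Matroid

namespace Matroid

variable {V α : Type*} {M : Matroid α} {G : Graph V α}

/-- The elements of `M` form a single component of `M`, which lies in one component of `G`; isolated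
vertices are disregarded. -/
theorem IsBiasedGraphicWith.connVia (h : M.IsBiasedGraphicWith G) (hM : M.IsConnected) :
    G.ConnVia E(G) (G.vertsOf E(G)) := by
  rintro a ⟨e, he, hea⟩ b ⟨f, hf, hfb⟩
  obtain ⟨_, ⟨x, hx, rfl⟩, hK⟩ := h.component_subset _ ⟨e, h.edgeSet_eq ▸ he, rfl⟩
  have key : ∀ {f b}, G.Inc f b → G.Reach E(G) (G.vertsOf E(G)) x b := by
    intro f b hfb
    have hf := hfb.edge_mem
    have hmem := @hK f ⟨h.edgeSet_eq ▸ hf, by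
      by_cases hfe : f = e
      · exact Or.inl hfe
      · obtain ⟨C, hC, hfC, heC⟩ := hM f (h.edgeSet_eq ▸ hf) e (h.edgeSet_eq ▸ he) hfe
        exact Or.inr ⟨C, hC, heC, hfC⟩⟩
    obtain ⟨s, t, hl, hs, ht⟩ := hmem
    have hb : Relation.ReflTransGen G.Adj x b := by
      obtain rfl | rfl := hfb.eq_or_eq_of_isLink hl <;> assumption
    clear hfb hl
    induction hb with
    | refl => exact .refl
    | tail _ hst ih =>
      obtain ⟨g, hg⟩ := hst
      exact ih.trans (hg.reach hg.edge_mem (hg.left_mem_vertsOf hg.edge_mem)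
        (hg.right_mem_vertsOf hg.edge_mem))
  exact (key hea).symm.trans (key hfb)

theorem IsBiasedGraphicWith.isBrokenHandcuff {V : Type} {G : Graph V α} [M.Finite]
    (h : M.IsBiasedGraphicWith G) (hM : M.IsConnected)
    (hu : ∃ C, G.IsUnbalanced (M.balancedCycles G) C) (hj : ∃ z w, G.IsJoint z w) :
    M.IsBrokenHandcuff := by
  -- The vertices of the frame part are the classes of vertices joined by lift edges.
  let r : Setoid V := ⟨G.Reach {e | M.IsLiftEdge G e} univ, fun _ => .refl, .symm, .trans⟩
  exact isBrokenHandcuff_of_isBlockContraction (q := Quotient.mk r)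
    ⟨fun x y => Quotient.eq (r := r), fun C hC e he heL f hf => IsLiftEdge.of_isCycle heL hC he hf⟩
    h.finite_vertexSet h.edgeSet_eq h.isBiased
    fun D => h.isCircuit_iff (h.connVia hM) hu hM hj

end Matroid

theorem mainTheorem7 {α : Type*} (M : Matroid α) [M.Finite] (hconn : M.IsConnected)
    (hM : M.IsBiasedGraphic) : M.IsQuasiGraphic ∨ M.IsBrokenHandcuff := by
  obtain ⟨V, G, h⟩ := hM
  by_cases hu : ∃ C, G.IsUnbalanced (M.balancedCycles G) C
  · by_cases hj : ∃ z w, G.IsJoint z w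
    · exact Or.inr (h.isBrokenHandcuff hconn hu hj)
    · exact Or.inl ⟨V, G, h.isFramework_of_no_joint (h.connVia hconn) hu
        fun z w hzw => hj ⟨z, w, hzw⟩⟩
  · exact Or.inl ⟨V, G, h.isFramework_of_balanced hu⟩
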